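/- **Setting.** Let $q\ge 1$, $\epsilon=(-1)^q$, let $\Lambda$ be a unital ring with involution $a\mapsto\bar a$ over which the rank of finitely generated free modules is well defined, and let $Z\subset \widetilde K_1(\Lambda)=\operatorname{coker}(K_1(\mathbb Z)\to K_1(\Lambda))$ be a subgroup closed under the operation $[A]\mapsto[A^*]$ (conjugate transpose). Modules are left modules. *Based modules.* An $s$-basis of a module $M$ is a basis of $M\oplus\Lambda^m$ with $n$ elements, for some $m,n\in\mathbb N$; the rank of $M$ is then $n-m$. An isomorphism $f:M\cong N$ of modules with $s$-bases is simple if the torsion in $\widetilde K_1(\Lambda)$ of $f\oplus\mathrm{id}$, computed in the $s$-bases stabilised by standard bases, lies in $Z$. Two $s$-bases of $M$ are equivalent if $\mathrm{id}_M$ is simple; a based module is a module with an equivalence class of $s$-bases. Direct sums, free modules $\Lambda^r$ and duals $M^*=\operatorname{Hom}_\Lambda(M,\Lambda)$ (a left module by $(af)(x)=f(x)\bar a$) are based in the evident way. A short exact sequence $0\to A\to B\to C\to 0$ of based modules is based if the isomorphism $A\oplus C\cong B$ given by some (equivalently any) splitting is simple. *Forms.* Let $T_\epsilon\varphi(x)(y)=\epsilon\,\overline{\varphi(y)(x)}$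 on $\operatorname{Hom}_\Lambda(M,M^*)$ and $Q_\epsilon(M)=\operatorname{coker}(1-T_\epsilon)$. An ($\epsilon$-quadratic) form is a pair $(M,\psi)$ of a based module $M$ and $\psi\in Q_\epsilon(M)$; put $\phi=(1+T_\epsilon)\psi:M\to M^*$. The form is simple if $\phi$ is a simple isomorphism. Isometries are simple isomorphisms $f$ with $f^*\psi'f=\psi$. The hyperbolic form $H_\epsilon(L)$ is $L\oplus L^*$ with the class of $((x,f),(y,g))\mapsto f(y)$. The annihilator of a submodule $j:V\hookrightarrow M$ is $V^\perp=\operatorname{Ker}(j^*\phi:M\to V^*)$. A Lagrangian of a simple form is a based direct summand $i:L\hookrightarrow M$ with $L=L^\perp$ as submodules and $i^*\psi i=0\in Q_\epsilon(L)$; it is simple if $0\to L\to M\xrightarrow{\,i^*\phi\,}L^*\to0$ is based. The abelian monoid $\mathcal F^{\rm zs}_{2q}(\Lambda)$ of $0$-stabilised forms consists of the classes $[v]$ of forms under the relation $v\sim v'$ iff $v\oplus(P,0)\cong v'\oplus(P',0)$ for some based modules $P,P'$, with direct sum as addition. *Quasi-formations.* A quasi-formation $x=(M,\psi;L,V)$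 is a simple form $(M,\psi)$ with a simple Lagrangian $L$ and a based direct summand $V$ with $\operatorname{rk}M=2\operatorname{rk}V$. It is a formation if $V$ is a (not necessarily simple) Lagrangian. An isomorphism of quasi-formations is an isometry $f$ with $f(L)=L'$, $f(V)=V'$ such that $L\cong L'$ and $V\cong V'$ are simple. The trivial formations are $(H_\epsilon(P);P,P^*)$, $P$ a based module. The boundary of a homomorphism $\rho:K\to K^*$, $K$ a based module, is $\delta(K,\rho)=(H_\epsilon(K);K,\{(x,\rho(x))\mid x\in K\})$, where the graph is based by $K$. The abelian monoid $l_{2q+1}(\Lambda)$ is the set of quasi-formations modulo the smallest equivalence relation that is compatible with direct sums, identifies isomorphic quasi-formations, satisfies $x\oplus t\sim x$ for trivial formations $t$, and satisfies $$(M,\psi;K,L)\oplus(M,\psi;L,V)\sim(M,\psi;K,V)$$ for all simple Lagrangians $K,L$; addition is direct sum. An element is elementary if it is the class of some boundary $\delta(K,\rho)$; the elementary elements form a submonoid $\mathcal El_{2q+1}(\Lambda)$. The subset $L_{2q+1}(\Lambda)\subset l_{2q+1}(\Lambda)$ consists of the classes of formations. **Statement.** For every quasi-formation $(M,\psi;L,V)$,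 with inclusion $j:V\hookrightarrow M$, the module $V^\perp$ has an $s$-basis for which $0\to V^\perp\to M\xrightarrow{\,j^*\phi\,}V^*\to0$ is based. With $V^\perp$ so based, and with $\theta$ and $\theta^\perp$ the restrictions of $\psi$ to $V$ and to $V^\perp$, there is a well-defined monoid homomorphism $$b: l_{2q+1}(\Lambda)\to\mathcal F^{\rm zs}_{2q}(\Lambda)\times\mathcal F^{\rm zs}_{2q}(\Lambda),\qquad [M,\psi;L,V]\mapsto([V,\theta],[V^\perp,-\theta^\perp]),$$ and it satisfies: (i) $\operatorname{Im}(b)=\{([w],[w'])\mid [w]+[H_\epsilon(\Lambda^r)]=[w']+[H_\epsilon(\Lambda^r)]\text{ for some } r\ge0\}$. (ii) The restriction of $b$ to $\mathcal El_{2q+1}(\Lambda)$ is an isomorphism of monoids onto the diagonal $\{([w],[w])\mid [w]\in\mathcal F^{\rm zs}_{2q}(\Lambda)\}$. In particular, for every $[w]$ there is a unique elementary element $e([w])\in l_{2q+1}(\Lambda)$ with $b(e([w]))=([w],[w])$. (iii) $b^{-1}((0,0))=L_{2q+1}(\Lambda)$. -/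

import Mathlib

namespace SurgeryMonoid

universe u v

noncomputable section

open Module

section Torsion

/-- The stabilisation `GL_n(R) → GL_{n+k}(R)`, `A ↦ A ⊕ 1`. -/
def stabGL (R : Type u) [Ring R] (n k : ℕ) :
    (Matrix (Fin n) (Fin n) R)ˣ →* (Matrix (Fin (n + k)) (Fin (n + k)) R)ˣ :=
  Units.map
    { toFun := fun A => (Matrix.fromBlocks A 0 0 1).submatrix finSumFinEquiv.symm
        finSumFinEquiv.symm
      map_one' := by simp
      map_mul' := fun A B => by
        rw [Matrix.submatrix_mul_equiv, Matrix.fromBlocks_multiply]; simp }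

/-- The relations presenting `K₁(R) = colim_n GL_n(R)^{ab}` on the generators `[A]`,
`A ∈ GL_n(R)`: `[AB] = [A] + [B]` and `[A ⊕ 1] = [A]`. -/
def K1Rel (R : Type u) [Ring R] :
    AddSubgroup (FreeAbelianGroup (Σ n : ℕ, (Matrix (Fin n) (Fin n) R)ˣ)) :=
  AddSubgroup.closure
    ({x | ∃ (n : ℕ) (A B : (Matrix (Fin n) (Fin n) R)ˣ),
        x = FreeAbelianGroup.of ⟨n, A * B⟩ -
          (FreeAbelianGroup.of ⟨n, A⟩ + FreeAbelianGroup.of ⟨n, B⟩)} ∪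
     {x | ∃ (n k : ℕ) (A : (Matrix (Fin n) (Fin n) R)ˣ),
        x = FreeAbelianGroup.of ⟨n + k, stabGL R n k A⟩ - FreeAbelianGroup.of ⟨n, A⟩})

/-- `K₁(R) = GL(R)^{ab} = colim_n GL_n(R)^{ab}`. -/
def K1 (R : Type u) [Ring R] : Type u :=
  FreeAbelianGroup (Σ n : ℕ, (Matrix (Fin n) (Fin n) R)ˣ) ⧸ K1Rel R

instance (R : Type u) [Ring R] : AddCommGroup (K1 R) :=
  inferInstanceAs (AddCommGroup (_ ⧸ K1Rel R))

/-- The class `[A] ∈ K₁(R)` of an invertible matrix. -/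
def K1.cls {R : Type u} [Ring R] {n : ℕ} (A : (Matrix (Fin n) (Fin n) R)ˣ) : K1 R :=
  QuotientAddGroup.mk (FreeAbelianGroup.of ⟨n, A⟩)

theorem K1.cls_mul {R : Type u} [Ring R] {n : ℕ} (A B : (Matrix (Fin n) (Fin n) R)ˣ) :
    K1.cls (A * B) = K1.cls A + K1.cls B := by
  refine (QuotientAddGroup.eq_iff_sub_mem).2 (AddSubgroup.subset_closure (Or.inl ⟨n, A, B, rfl⟩))

theorem K1.cls_stab {R : Type u} [Ring R] {n : ℕ} (k : ℕ) (A : (Matrix (Fin n) (Fin n) R)ˣ) :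
    K1.cls (stabGL R n k A) = K1.cls A := by
  refine (QuotientAddGroup.eq_iff_sub_mem).2
    (AddSubgroup.subset_closure (Or.inr ⟨n, k, A, rfl⟩))

/-- A homomorphism out of `K₁(R)`. -/
def K1.lift {R : Type u} [Ring R] {G : Type v} [AddCommGroup G]
    (F : ∀ n : ℕ, (Matrix (Fin n) (Fin n) R)ˣ → G)
    (hmul : ∀ n (A B : (Matrix (Fin n) (Fin n) R)ˣ), F n (A * B) = F n A + F n B)
    (hstab : ∀ n k (A : (Matrix (Fin n) (Fin n) R)ˣ), F (n + k) (stabGL R n k A) = F n A) :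
    K1 R →+ G :=
  QuotientAddGroup.lift (K1Rel R) (FreeAbelianGroup.lift fun x => F x.1 x.2) <| by
    refine (AddSubgroup.closure_le _).2 ?_
    rintro x (⟨n, A, B, rfl⟩ | ⟨n, k, A, rfl⟩)
    · simp [hmul]
    · simp [hstab]

/-- Functoriality of `K₁`: `[A] ↦ [f(A)]`. -/
def K1.map {R : Type u} {S : Type v} [Ring R] [Ring S] (f : R →+* S) : K1 R →+ K1 S :=
  K1.lift (fun _ A => K1.cls (Units.map f.mapMatrix.toMonoidHom A))
    (fun n A B => by rw [map_mul, K1.cls_mul])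
    (fun n k A => by
      refine Eq.trans ?_ (K1.cls_stab k _)
      refine congrArg (K1.cls (R := S)) (Units.ext (Matrix.ext fun i j => ?_))
      simp only [stabGL, Units.coe_map, MonoidHom.coe_mk, OneHom.coe_mk, RingHom.toMonoidHom_eq_coe,
        MonoidHom.coe_coe, RingHom.mapMatrix_apply, Matrix.map_apply, Matrix.submatrix_apply]
      rcases finSumFinEquiv.symm i with i | i <;> rcases finSumFinEquiv.symm j with j | j <;>
        simp [Matrix.one_apply, apply_ite f])

/-- The conjugate transpose `[A] ↦ [A*]` on `K₁`. -/
def K1.conj {R : Type u} [Ring R] [StarRing R] : K1 R →+ K1 R :=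
  K1.lift (fun _ A => K1.cls (star A))
    (fun n A B => by rw [star_mul, K1.cls_mul, add_comm])
    (fun n k A => by
      refine Eq.trans ?_ (K1.cls_stab k _)
      refine congrArg (K1.cls (R := R)) (Units.ext (Matrix.ext fun i j => ?_))
      simp only [stabGL, Units.coe_map, MonoidHom.coe_mk, OneHom.coe_mk, Units.coe_star,
        Matrix.star_apply, Matrix.submatrix_apply]
      rcases finSumFinEquiv.symm i with i | i <;> rcases finSumFinEquiv.symm j with j | j <;>
        simp [Matrix.one_apply, apply_ite star, eq_comm])

theorem K1.map_cls {R : Type u} {S : Type v} [Ring R] [Ring S] (f : R →+* S) {n : ℕ}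
    (A : (Matrix (Fin n) (Fin n) R)ˣ) :
    K1.map f (K1.cls A) = K1.cls (Units.map f.mapMatrix.toMonoidHom A) := by
  exact FreeAbelianGroup.lift_apply_of _ _

theorem K1.conj_cls {R : Type u} [Ring R] [StarRing R] {n : ℕ}
    (A : (Matrix (Fin n) (Fin n) R)ˣ) : K1.conj (K1.cls A) = K1.cls (star A) := by
  exact FreeAbelianGroup.lift_apply_of _ _

theorem K1.induction {R : Type u} [Ring R] {p : K1 R → Prop}
    (h0 : p 0) (h : ∀ (n : ℕ) (A : (Matrix (Fin n) (Fin n) R)ˣ), p (K1.cls A))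
    (hneg : ∀ x, p x → p (-x)) (hadd : ∀ x y, p x → p y → p (x + y)) (x : K1 R) : p x := by
  obtain ⟨x, rfl⟩ := QuotientAddGroup.mk_surjective x
  induction x using FreeAbelianGroup.induction_on with
  | zero => exact h0
  | of x => exact h x.1 x.2
  | neg x hx => exact hneg _ hx
  | add x y hx hy => exact hadd _ _ hx hy

theorem K1.conj_map {R : Type u} [Ring R] [StarRing R] (x : K1 ℤ) :
    K1.conj (K1.map (Int.castRingHom R) x) = K1.map (Int.castRingHom R) (K1.conj x) := by
  induction x using K1.induction with
  | h0 => simp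
  | h n A =>
    rw [K1.map_cls, K1.conj_cls, K1.conj_cls, K1.map_cls]
    congr 1
    ext i j
    simp
  | hneg x hx => simp [hx]
  | hadd x y hx hy => simp [hx, hy]

/-- The reduced group `K̃₁(Λ) = coker(K₁(ℤ) → K₁(Λ))`. -/
def RedK1 (Λ : Type u) [Ring Λ] : Type u :=
  K1 Λ ⧸ (K1.map (Int.castRingHom Λ)).range

instance (Λ : Type u) [Ring Λ] : AddCommGroup (RedK1 Λ) :=
  inferInstanceAs (AddCommGroup (_ ⧸ (K1.map (Int.castRingHom Λ)).range))

/-- The class `[A] ∈ K̃₁(Λ)` of an invertible matrix. -/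
def RedK1.cls {Λ : Type u} [Ring Λ] {n : ℕ} (A : (Matrix (Fin n) (Fin n) Λ)ˣ) : RedK1 Λ :=
  QuotientAddGroup.mk (K1.cls A)

/-- The `*`-operation `[A] ↦ [A*]` on `K̃₁(Λ)`. -/
def RedK1.conj {Λ : Type u} [Ring Λ] [StarRing Λ] : RedK1 Λ →+ RedK1 Λ :=
  QuotientAddGroup.map _ _ K1.conj <| by
    rintro _ ⟨x, rfl⟩
    exact ⟨K1.conj x, (K1.conj_map x).symm⟩

theorem RedK1.conj_cls {Λ : Type u} [Ring Λ] [StarRing Λ] {n : ℕ}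
    (A : (Matrix (Fin n) (Fin n) Λ)ˣ) : RedK1.conj (RedK1.cls A) = RedK1.cls (star A) := by
  rw [RedK1.cls, RedK1.cls, ← K1.conj_cls]; rfl

variable {Λ : Type u} [Ring Λ]

theorem RedK1.cls_mul {n : ℕ} (A B : (Matrix (Fin n) (Fin n) Λ)ˣ) :
    RedK1.cls (A * B) = RedK1.cls A + RedK1.cls B := by
  rw [RedK1.cls, K1.cls_mul]; rfl

theorem RedK1.cls_stab {n : ℕ} (k : ℕ) (A : (Matrix (Fin n) (Fin n) Λ)ˣ) :
    RedK1.cls (stabGL Λ n k A) = RedK1.cls A := by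
  rw [RedK1.cls, K1.cls_stab]; rfl

theorem RedK1.cls_int {n : ℕ} (A : (Matrix (Fin n) (Fin n) ℤ)ˣ) :
    RedK1.cls (Units.map (Int.castRingHom Λ).mapMatrix.toMonoidHom A) = 0 := by
  rw [RedK1.cls, ← K1.map_cls]
  exact (QuotientAddGroup.eq_zero_iff _).2 ⟨_, rfl⟩

theorem RedK1.cls_one {n : ℕ} : RedK1.cls (1 : (Matrix (Fin n) (Fin n) Λ)ˣ) = 0 := by
  have := RedK1.cls_mul (1 : (Matrix (Fin n) (Fin n) Λ)ˣ) 1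
  simpa using this

variable {M N P M' N' : Type u} [AddCommGroup M] [Module Λ M] [AddCommGroup N] [Module Λ N]
  [AddCommGroup P] [Module Λ P] [AddCommGroup M'] [Module Λ M'] [AddCommGroup N'] [Module Λ N']

/-- The matrix of an isomorphism of free modules in respect to bases. -/
def isoMatrix {n : ℕ} (b : Basis (Fin n) Λ M) (c : Basis (Fin n) Λ N) (f : M ≃ₗ[Λ] N) :
    (Matrix (Fin n) (Fin n) Λ)ˣ where
  val := Matrix.of fun i j => c.repr (f (b i)) j
  inv := Matrix.of fun i j => b.repr (f.symm (c i)) j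
  val_inv := by
    ext i k
    have h := congrArg (fun x => b.repr (f.symm x) k) (c.sum_repr (f (b i)))
    simp only [map_sum, map_smul, Finsupp.coe_finsetSum, Finset.sum_apply, Finsupp.smul_apply,
      smul_eq_mul, LinearEquiv.symm_apply_apply, Basis.repr_self] at h
    simp only [Matrix.mul_apply, Matrix.of_apply, h, Matrix.one_apply, Finsupp.single_apply]
  inv_val := by
    ext i k
    have h := congrArg (fun x => c.repr (f x) k) (b.sum_repr (f.symm (c i)))
    simp only [map_sum, map_smul, Finsupp.coe_finsetSum, Finset.sum_apply, Finsupp.smul_apply,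
      smul_eq_mul, LinearEquiv.apply_symm_apply, Basis.repr_self] at h
    simp only [Matrix.mul_apply, Matrix.of_apply, h, Matrix.one_apply, Finsupp.single_apply]

/-- The torsion in `K̃₁(Λ)` of an isomorphism of free modules in respect to bases. -/
def torsion {n : ℕ} (b : Basis (Fin n) Λ M) (c : Basis (Fin n) Λ N) (f : M ≃ₗ[Λ] N) : RedK1 Λ :=
  RedK1.cls (isoMatrix b c f)

theorem torsion_trans {n : ℕ} (b : Basis (Fin n) Λ M) (c : Basis (Fin n) Λ N)
    (d : Basis (Fin n) Λ P) (f : M ≃ₗ[Λ] N) (g : N ≃ₗ[Λ] P) :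
    torsion b d (f.trans g) = torsion b c f + torsion c d g := by
  rw [torsion, torsion, torsion, ← RedK1.cls_mul]
  congr 1
  ext i k
  have h := congrArg (fun x => d.repr (g x) k) (c.sum_repr (f (b i)))
  simp only [map_sum, map_smul, Finsupp.coe_finsetSum, Finset.sum_apply, Finsupp.smul_apply,
    smul_eq_mul] at h
  simp only [isoMatrix, Units.val_mul, Matrix.mul_apply, Matrix.of_apply, h, LinearEquiv.trans_apply]

theorem torsion_eq_zero {n : ℕ} (b : Basis (Fin n) Λ M) (c : Basis (Fin n) Λ N)
    (f : M ≃ₗ[Λ] N) (h : ∀ i, f (b i) = c i) : torsion b c f = 0 := by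
  rw [torsion, ← RedK1.cls_one (n := n)]
  congr 1
  ext i j
  simp [isoMatrix, h, Finsupp.single_apply, Matrix.one_apply]

/-- Isomorphisms with integral matrices have torsion zero. -/
theorem torsion_int {n : ℕ} (b : Basis (Fin n) Λ M) (c : Basis (Fin n) Λ N)
    (f : M ≃ₗ[Λ] N) (A : (Matrix (Fin n) (Fin n) ℤ)ˣ)
    (h : ∀ i, f (b i) = ∑ j, (A.1 i j) • c j) : torsion b c f = 0 := by
  rw [torsion, ← RedK1.cls_int A]
  congr 1
  ext i j
  simp [isoMatrix, h, Finsupp.single_apply]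

theorem torsion_reindex {n : ℕ} (b : Basis (Fin n) Λ M) (e : Fin n ≃ Fin n) :
    torsion b (b.reindex e) (LinearEquiv.refl Λ M) = 0 := by
  refine torsion_int _ _ _ ⟨e.toPEquiv.toMatrix, e.symm.toPEquiv.toMatrix, ?_, ?_⟩ ?_
  · rw [← PEquiv.toMatrix_trans, ← Equiv.toPEquiv_trans]; simp
  · rw [← PEquiv.toMatrix_trans, ← Equiv.toPEquiv_trans]; simp
  · intro i
    simp [PEquiv.toMatrix_apply, Equiv.toPEquiv_apply, eq_comm]

theorem torsion_refl {n : ℕ} (b : Basis (Fin n) Λ M) :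
    torsion b b (LinearEquiv.refl Λ M) = 0 := torsion_eq_zero _ _ _ fun _ => rfl

theorem torsion_symm {n : ℕ} (b : Basis (Fin n) Λ M) (c : Basis (Fin n) Λ N)
    (f : M ≃ₗ[Λ] N) : torsion c b f.symm = - torsion b c f := by
  have h := torsion_trans b c b f f.symm
  rw [LinearEquiv.self_trans_symm, torsion_refl] at h
  exact eq_neg_of_add_eq_zero_right h.symm

theorem torsion_prod_refl {n k : ℕ} (b : Basis (Fin n) Λ M) (c : Basis (Fin n) Λ N)
    (d : Basis (Fin k) Λ P) (f : M ≃ₗ[Λ] N) :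
    torsion ((b.prod d).reindex finSumFinEquiv) ((c.prod d).reindex finSumFinEquiv)
      (f.prodCongr (LinearEquiv.refl Λ P)) = torsion b c f := by
  rw [torsion, torsion]
  refine Eq.trans ?_ (RedK1.cls_stab k _)
  refine congrArg (RedK1.cls (Λ := Λ)) (Units.ext (Matrix.ext fun i j => ?_))
  simp only [isoMatrix, stabGL, Units.coe_map, MonoidHom.coe_mk, OneHom.coe_mk, Matrix.of_apply,
    Basis.reindex_apply, Basis.repr_reindex_apply, Matrix.submatrix_apply]
  rcases finSumFinEquiv.symm i with i | i <;> rcases finSumFinEquiv.symm j with j | j <;>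
    simp [Matrix.one_apply, Finsupp.single_apply]


/-- An isomorphism of f.g. free modules with bases is `Z`-simple if its torsion, computed for
any numbering of the bases, lies in `Z`. -/
def IsSimpleFor {ι κ : Type} (Z : AddSubgroup (RedK1 Λ)) (b : Basis ι Λ M) (c : Basis κ Λ N)
    (f : M ≃ₗ[Λ] N) : Prop :=
  ∃ (n : ℕ) (e : ι ≃ Fin n) (e' : κ ≃ Fin n), torsion (b.reindex e) (c.reindex e') f ∈ Z

namespace IsSimpleFor

variable {Z : AddSubgroup (RedK1 Λ)} {ι κ μ ι' κ' : Type}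

theorem mem {b : Basis ι Λ M} {c : Basis κ Λ N} {f : M ≃ₗ[Λ] N} (h : IsSimpleFor Z b c f)
    {n : ℕ} (e : ι ≃ Fin n) (e' : κ ≃ Fin n) : torsion (b.reindex e) (c.reindex e') f ∈ Z := by
  obtain ⟨m, d, d', h⟩ := h
  obtain rfl : m = n := by simpa using Fintype.card_congr (d.symm.trans e)
  have h1 : b.reindex e = (b.reindex d).reindex (d.symm.trans e) := by ext; simp
  have h2 : c.reindex e' = (c.reindex d').reindex (d'.symm.trans e') := by ext; simp
  have h3 := torsion_trans (b.reindex e) (b.reindex d) (c.reindex e')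
    (LinearEquiv.refl Λ M) f
  have h4 := torsion_trans (b.reindex d) (c.reindex d') (c.reindex e') f (LinearEquiv.refl Λ N)
  have h5 := torsion_symm (b.reindex d) (b.reindex e) (LinearEquiv.refl Λ M)
  rw [LinearEquiv.refl_symm] at h5
  rw [LinearEquiv.refl_trans] at h3
  rw [LinearEquiv.trans_refl] at h4
  rw [h3, h4, h5, h1, torsion_reindex, h2, torsion_reindex]
  simpa using h

theorem trans {b : Basis ι Λ M} {c : Basis κ Λ N} {d : Basis μ Λ P} {f : M ≃ₗ[Λ] N}
    {g : N ≃ₗ[Λ] P} (h : IsSimpleFor Z b c f) (h' : IsSimpleFor Z c d g) :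
    IsSimpleFor Z b d (f.trans g) := by
  obtain ⟨n, e, e', h⟩ := h
  obtain ⟨m, e1, e2, h'⟩ := h'
  obtain rfl : m = n := by simpa using Fintype.card_congr (e1.symm.trans e')
  have h' := mem ⟨m, e1, e2, h'⟩ e' e2
  exact ⟨m, e, e2, by rw [torsion_trans _ (c.reindex e')]; exact Z.add_mem h h'⟩

theorem symm {b : Basis ι Λ M} {c : Basis κ Λ N} {f : M ≃ₗ[Λ] N} (h : IsSimpleFor Z b c f) :
    IsSimpleFor Z c b f.symm := by
  obtain ⟨n, e, e', h⟩ := h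
  exact ⟨n, e', e, by rw [torsion_symm]; exact Z.neg_mem h⟩

theorem of_smul [Finite ι] {b : Basis ι Λ M} {c : Basis κ Λ N} {f : M ≃ₗ[Λ] N} (σ : ι ≃ κ)
    (ε : ι → ℤˣ) (h : ∀ i, f (b i) = (ε i : ℤ) • c (σ i)) : IsSimpleFor Z b c f := by
  have := Fintype.ofFinite ι
  refine ⟨_, Fintype.equivFin ι, σ.symm.trans (Fintype.equivFin ι), ?_⟩
  rw [torsion_int _ _ _ ⟨Matrix.diagonal fun i => (ε ((Fintype.equivFin ι).symm i) : ℤ),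
    Matrix.diagonal fun i => (ε ((Fintype.equivFin ι).symm i) : ℤ), ?_, ?_⟩]
  · exact Z.zero_mem
  · intro i
    simp [h, Matrix.diagonal_apply]
  · simp [Matrix.diagonal_mul_diagonal, ← Units.val_mul]
  · simp [Matrix.diagonal_mul_diagonal, ← Units.val_mul]

theorem of_perm [Finite ι] {b : Basis ι Λ M} {c : Basis κ Λ N} {f : M ≃ₗ[Λ] N} (σ : ι ≃ κ)
    (h : ∀ i, f (b i) = c (σ i)) : IsSimpleFor Z b c f :=
  of_smul σ (fun _ => 1) (by simpa using h)

theorem prod_refl [Finite μ] {b : Basis ι Λ M} {c : Basis κ Λ N} (d : Basis μ Λ P)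
    {f : M ≃ₗ[Λ] N} (h : IsSimpleFor Z b c f) :
    IsSimpleFor Z (b.prod d) (c.prod d) (f.prodCongr (LinearEquiv.refl Λ P)) := by
  obtain ⟨n, e, e', h⟩ := h
  have := Fintype.ofFinite μ
  let t := Fintype.equivFin μ
  refine ⟨_, (Equiv.sumCongr e t).trans finSumFinEquiv, (Equiv.sumCongr e' t).trans finSumFinEquiv,
    ?_⟩
  rw [← torsion_prod_refl _ _ (d.reindex t)] at h
  convert h using 2
  all_goals
    ext i
    all_goals
      simp only [Basis.reindex_apply, Equiv.symm_trans_apply, Equiv.sumCongr_symm]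
      rcases finSumFinEquiv.symm i with i | i <;> simp

theorem cancel [Finite ι] [Finite κ] [Finite μ] {b : Basis ι Λ M} {c : Basis κ Λ N}
    {d : Basis μ Λ P} {f : M ≃ₗ[Λ] N}
    (h : IsSimpleFor Z (b.prod d) (c.prod d) (f.prodCongr (LinearEquiv.refl Λ P))) :
    IsSimpleFor Z b c f := by
  have := Fintype.ofFinite μ
  have := Fintype.ofFinite ι
  have := Fintype.ofFinite κ
  have hc : Fintype.card ι = Fintype.card κ := by
    obtain ⟨n, e, e', -⟩ := h
    simpa using Fintype.card_congr (e.trans e'.symm)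
  let t := Fintype.equivFin μ
  let e := Fintype.equivFin ι
  let e' : κ ≃ Fin (Fintype.card ι) := (Fintype.equivFin κ).trans (finCongr hc.symm)
  refine ⟨_, e, e', ?_⟩
  rw [← torsion_prod_refl _ _ (d.reindex t)]
  convert h.mem ((Equiv.sumCongr e t).trans finSumFinEquiv)
    ((Equiv.sumCongr e' t).trans finSumFinEquiv) using 2
  all_goals
    ext i
    all_goals
      simp only [Basis.reindex_apply, Equiv.symm_trans_apply, Equiv.sumCongr_symm]
      rcases finSumFinEquiv.symm i with i | i <;> simp

theorem finite_left {b : Basis ι Λ M} {c : Basis κ Λ N} {f : M ≃ₗ[Λ] N}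
    (h : IsSimpleFor Z b c f) : Finite ι := by
  obtain ⟨n, e, -⟩ := h
  exact Finite.of_equiv _ e.symm

theorem prod {b : Basis ι Λ M} {c : Basis κ Λ N} {b' : Basis ι' Λ M'} {c' : Basis κ' Λ N'}
    {f : M ≃ₗ[Λ] N} {g : M' ≃ₗ[Λ] N'} (h : IsSimpleFor Z b c f) (h' : IsSimpleFor Z b' c' g) :
    IsSimpleFor Z (b.prod b') (c.prod c') (f.prodCongr g) := by
  have := h.finite_left
  have := h'.finite_left
  have := h.symm.finite_left
  have := h'.symm.finite_left
  have h1 := h.prod_refl b'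
  have h2 := h'.prod_refl c
  have s1 : IsSimpleFor Z (c.prod b') (b'.prod c) (LinearEquiv.prodComm Λ N M') :=
    of_perm (Equiv.sumComm _ _) (by rintro (i | i) <;> simp)
  have s2 : IsSimpleFor Z (c'.prod c) (c.prod c') (LinearEquiv.prodComm Λ N' N) :=
    of_perm (Equiv.sumComm _ _) (by rintro (i | i) <;> simp)
  have h3 := ((h1.trans s1).trans h2).trans s2
  convert h3 using 1
  exact LinearEquiv.ext fun _ => rfl

theorem congr {b : Basis ι Λ M} {c : Basis κ Λ N} {f g : M ≃ₗ[Λ] N} (h : IsSimpleFor Z b c f)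
    (hfg : ∀ x, f x = g x) : IsSimpleFor Z b c g :=
  LinearEquiv.ext hfg ▸ h

theorem of_map [Finite ι] (b : Basis ι Λ M) (e : ι ≃ κ) (g : M ≃ₗ[Λ] N) :
    IsSimpleFor Z b ((b.reindex e).map g) g :=
  of_perm e fun i => by simp

/-- Torsion is invariant under conjugation. -/
theorem conj {b : Basis ι Λ M} {c : Basis ι Λ N} {f : M ≃ₗ[Λ] M} (g : M ≃ₗ[Λ] N)
    [Finite ι] (h : IsSimpleFor Z b b f) :
    IsSimpleFor Z c c ((g.symm.trans f).trans g) := by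
  have := Fintype.ofFinite ι
  let e := Fintype.equivFin ι
  refine ⟨_, e, e, ?_⟩
  have h := h.mem e e
  rw [torsion_trans _ (b.reindex e), torsion_trans _ (b.reindex e), torsion_symm]
  simpa using h

end IsSimpleFor

end Torsion

section Based

/-- A based module: a module `M` together with an `s`-basis, that is a basis of `M ⊕ Λ^m`.
Only the class of the `s`-basis matters below: two `s`-bases of `M` are `Z`-equivalent if and
only if the identity of `M` is `Z`-simple (`BasedModule.IsSimple`) in respect to them. -/
structure BasedModule (Λ : Type u) [Ring Λ] where
  carrier : Type u
  [addCommGroup : AddCommGroup carrier]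
  [module : Module Λ carrier]
  m : ℕ
  n : ℕ
  basis : Basis (Fin n) Λ (carrier × (Fin m → Λ))

attribute [instance] BasedModule.addCommGroup BasedModule.module

instance (Λ : Type u) [Ring Λ] : CoeSort (BasedModule Λ) (Type u) := ⟨BasedModule.carrier⟩

namespace BasedModule

variable {Λ : Type u} [Ring Λ]

/-- The rank `n - m` of a stably free module with `M ⊕ Λ^m ≅ Λ^n`. -/
def rank (X : BasedModule Λ) : ℤ := (X.n : ℤ) - X.m

/-- `f ⊕ id` on `X ⊕ Λ^m ⊕ Λ^{m'}`, where the two free summands of the target are written in the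
order in which the stabilised `s`-basis of the target needs them. -/
def stabIso (X Y : BasedModule Λ) (f : X ≃ₗ[Λ] Y) :
    ((X × (Fin X.m → Λ)) × (Fin Y.m → Λ)) ≃ₗ[Λ] ((Y × (Fin Y.m → Λ)) × (Fin X.m → Λ)) where
  toFun p := ((f p.1.1, p.2), p.1.2)
  invFun p := ((f.symm p.1.1, p.2), p.1.2)
  map_add' _ _ := by simp
  map_smul' _ _ := by simp
  left_inv _ := by simp
  right_inv _ := by simp

/-- `f : X ≅ Y` is (`Z`-)simple: the torsion of `f ⊕ id` in respect to the `s`-bases of `X` and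
`Y`, stabilised by standard bases, lies in `Z`. -/
def IsSimple (Z : AddSubgroup (RedK1 Λ)) (X Y : BasedModule Λ) (f : X ≃ₗ[Λ] Y) : Prop :=
  IsSimpleFor Z (X.basis.prod (Pi.basisFun Λ (Fin Y.m))) (Y.basis.prod (Pi.basisFun Λ (Fin X.m)))
    (stabIso X Y f)

/-- `(Λ^a) ⊕ (Λ^b) ≅ Λ^{a+b}`, standard basis to standard basis. -/
def finAdd (Λ : Type u) [Ring Λ] (a b : ℕ) :
    ((Fin a → Λ) × (Fin b → Λ)) ≃ₗ[Λ] (Fin (a + b) → Λ) :=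
  ((Pi.basisFun Λ (Fin a)).prod (Pi.basisFun Λ (Fin b))).equiv (Pi.basisFun Λ (Fin (a + b)))
    finSumFinEquiv

/-- The direct sum of based modules. -/
abbrev prod (X Y : BasedModule Λ) : BasedModule Λ where
  carrier := X × Y
  m := X.m + Y.m
  n := X.n + Y.n
  basis := ((X.basis.prod Y.basis).reindex finSumFinEquiv).map
    ((LinearEquiv.prodProdProdComm Λ X (Fin X.m → Λ) Y (Fin Y.m → Λ)).trans
      ((LinearEquiv.refl Λ (X × Y)).prodCongr (finAdd Λ X.m Y.m)))

/-- The zero module. -/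
abbrev zero (Λ : Type u) [Ring Λ] : BasedModule Λ where
  carrier := PUnit.{u + 1}
  m := 0
  n := 0
  basis := Basis.empty _

/-- The free module `Λ^r` with its standard basis. -/
abbrev free (Λ : Type u) [Ring Λ] (r : ℕ) : BasedModule Λ where
  carrier := Fin r → Λ
  m := 0
  n := r
  basis := (Pi.basisFun Λ (Fin r)).map LinearEquiv.prodUnique.symm

variable {Z : AddSubgroup (RedK1 Λ)}

theorem ghost {ι μ : Type} [Finite ι] [Finite μ] {A F : Type u} [AddCommGroup A] [Module Λ A]
    [AddCommGroup F] [Module Λ F] (B : Basis ι Λ (A × F)) (d : Basis μ Λ F) {D : F ≃ₗ[Λ] F}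
    (hD : IsSimpleFor Z d d D) :
    IsSimpleFor Z B B ((LinearEquiv.refl Λ A).prodCongr D) := by
  have h1 : IsSimpleFor Z (B.prod d) (B.prod d)
      ((LinearEquiv.refl Λ (A × F)).prodCongr D) :=
    (IsSimpleFor.of_perm (Equiv.refl _) fun _ => rfl).prod hD
  let g : ((A × F) × F) ≃ₗ[Λ] ((A × F) × F) :=
    { toFun := fun p => ((p.1.1, p.2), p.1.2)
      invFun := fun p => ((p.1.1, p.2), p.1.2)
      map_add' := fun _ _ => rfl
      map_smul' := fun _ _ => rfl
      left_inv := fun _ => rfl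
      right_inv := fun _ => rfl }
  have h2 := h1.conj (c := B.prod d) g
  refine IsSimpleFor.cancel (d := d) ?_
  convert h2 using 1
  exact LinearEquiv.ext fun _ => rfl

theorem IsSimple.of_direct {X Y : BasedModule Λ} {f : X ≃ₗ[Λ] Y}
    (σ : (Fin X.m → Λ) ≃ₗ[Λ] (Fin Y.m → Λ))
    (hσ : IsSimpleFor Z (Pi.basisFun Λ (Fin X.m)) (Pi.basisFun Λ (Fin Y.m)) σ)
    (h : IsSimpleFor Z X.basis Y.basis (f.prodCongr σ)) : IsSimple Z X Y f := by
  have h1 := h.prod hσ.symm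
  let d := (Pi.basisFun Λ (Fin X.m)).prod (Pi.basisFun Λ (Fin Y.m))
  let D : ((Fin X.m → Λ) × (Fin Y.m → Λ)) ≃ₗ[Λ] ((Fin X.m → Λ) × (Fin Y.m → Λ)) :=
    { toFun := fun p => (σ.symm p.2, σ p.1)
      invFun := fun p => (σ.symm p.2, σ p.1)
      map_add' := fun _ _ => by simp
      map_smul' := fun _ _ => by simp
      left_inv := fun _ => by simp
      right_inv := fun _ => by simp }
  have hD : IsSimpleFor Z d d D := by
    have s : IsSimpleFor Z ((Pi.basisFun Λ (Fin Y.m)).prod (Pi.basisFun Λ (Fin X.m))) d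
        (LinearEquiv.prodComm Λ _ _) :=
      IsSimpleFor.of_perm (Equiv.sumComm _ _) (by rintro (i | i) <;> simp [d])
    have h2 := (hσ.prod hσ.symm).trans s
    convert h2 using 1
    exact LinearEquiv.ext fun _ => rfl
  have a1 : IsSimpleFor Z (X.basis.prod (Pi.basisFun Λ (Fin Y.m)))
      ((X.basis.prod (Pi.basisFun Λ (Fin Y.m))).map (LinearEquiv.prodAssoc Λ _ _ _))
      (LinearEquiv.prodAssoc Λ _ _ _) :=
    IsSimpleFor.of_perm (Equiv.refl _) fun _ => rfl
  have h3 := ((a1.trans (ghost _ d hD)).trans a1.symm).trans h1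
  refine h3.congr fun p => ?_
  change ((f p.1.1, σ (σ.symm p.2)), σ.symm (σ p.1.2)) = ((f p.1.1, p.2), p.1.2)
  simp

theorem IsSimple.refl (X : BasedModule Λ) : IsSimple Z X X (LinearEquiv.refl Λ X) :=
  .of_direct (LinearEquiv.refl _ _) (IsSimpleFor.of_perm (Equiv.refl _) fun _ => rfl)
    (IsSimpleFor.of_perm (Equiv.refl _) fun _ => rfl)

theorem IsSimple.symm {X Y : BasedModule Λ} {f : X ≃ₗ[Λ] Y} (h : IsSimple Z X Y f) :
    IsSimple Z Y X f.symm := by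
  unfold IsSimple at h
  exact h.symm.congr fun _ => rfl

theorem IsSimple.trans {X Y W : BasedModule Λ} {f : X ≃ₗ[Λ] Y} {g : Y ≃ₗ[Λ] W}
    (hf : IsSimple Z X Y f) (hg : IsSimple Z Y W g) : IsSimple Z X W (f.trans g) := by
  have h1 := IsSimpleFor.prod_refl (Pi.basisFun Λ (Fin W.m)) hf
  have h2 := IsSimpleFor.prod_refl (Pi.basisFun Λ (Fin X.m)) hg
  unfold IsSimple
  refine IsSimpleFor.cancel (d := Pi.basisFun Λ (Fin Y.m)) ?_
  have sw (U : BasedModule Λ) (a b : ℕ) :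
      ∃ s : (((U × (Fin U.m → Λ)) × (Fin a → Λ)) × (Fin b → Λ)) ≃ₗ[Λ]
        (((U × (Fin U.m → Λ)) × (Fin b → Λ)) × (Fin a → Λ)),
      (∀ p, s p = ((p.1.1, p.2), p.1.2)) ∧
      IsSimpleFor Z ((U.basis.prod (Pi.basisFun Λ (Fin a))).prod (Pi.basisFun Λ (Fin b)))
        ((U.basis.prod (Pi.basisFun Λ (Fin b))).prod (Pi.basisFun Λ (Fin a))) s := by
    refine ⟨{ toFun := fun p => ((p.1.1, p.2), p.1.2)
              invFun := fun p => ((p.1.1, p.2), p.1.2)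
              map_add' := fun _ _ => rfl
              map_smul' := fun _ _ => rfl
              left_inv := fun _ => rfl
              right_inv := fun _ => rfl }, fun _ => rfl, ?_⟩
    refine IsSimpleFor.of_perm ⟨
      Sum.elim (Sum.elim (fun i => .inl (.inl i)) (fun i => .inr i)) (fun i => .inl (.inr i)),
      Sum.elim (Sum.elim (fun i => .inl (.inl i)) (fun i => .inr i)) (fun i => .inl (.inr i)),
      ?_, ?_⟩ ?_
    · rintro ((i | i) | i) <;> rfl
    · rintro ((i | i) | i) <;> rfl
    · rintro ((i | i) | i) <;> simp
  obtain ⟨s1, e1, p1⟩ := sw X W.m Y.m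
  obtain ⟨s2, e2, p2⟩ := sw Y X.m W.m
  obtain ⟨s3, e3, p3⟩ := sw W Y.m X.m
  have h3 := (((p1.trans h1).trans p2).trans h2).trans p3
  refine h3.congr fun p => ?_
  simp only [LinearEquiv.trans_apply, LinearEquiv.prodCongr_apply, LinearEquiv.refl_apply, e1, e2,
    e3, stabIso, LinearEquiv.coe_mk, LinearMap.coe_mk, AddHom.coe_mk]

theorem finAdd_simple (a b : ℕ) :
    IsSimpleFor Z ((Pi.basisFun Λ (Fin a)).prod (Pi.basisFun Λ (Fin b)))
      (Pi.basisFun Λ (Fin (a + b))) (finAdd Λ a b) :=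
  IsSimpleFor.of_perm finSumFinEquiv fun i => by simp only [finAdd, Basis.equiv_apply]

theorem prod_simple (X Y : BasedModule Λ) :
    IsSimpleFor Z (X.basis.prod Y.basis) (prod X Y).basis
      ((LinearEquiv.prodProdProdComm Λ X (Fin X.m → Λ) Y (Fin Y.m → Λ)).trans
      ((LinearEquiv.refl Λ (X × Y)).prodCongr (finAdd Λ X.m Y.m))) :=
  IsSimpleFor.of_map _ _ _

theorem IsSimple.prod {X Y X' Y' : BasedModule Λ} {f : X ≃ₗ[Λ] Y} {f' : X' ≃ₗ[Λ] Y'}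
    (h : IsSimple Z X Y f) (h' : IsSimple Z X' Y' f') :
    IsSimple Z (X.prod X') (Y.prod Y') (f.prodCongr f') := by
  have key (U U' : BasedModule Λ) (a a' : ℕ) :
      ∃ s : (((U × (Fin U.m → Λ)) × (Fin a → Λ)) × ((U' × (Fin U'.m → Λ)) × (Fin a' → Λ))) ≃ₗ[Λ]
        (((U.prod U') × (Fin (U.prod U').m → Λ)) × (Fin (a + a') → Λ)),
      (∀ p, s p = (((p.1.1.1, p.2.1.1), finAdd Λ _ _ (p.1.1.2, p.2.1.2)),
        finAdd Λ _ _ (p.1.2, p.2.2))) ∧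
      IsSimpleFor Z ((U.basis.prod (Pi.basisFun Λ (Fin a))).prod
        (U'.basis.prod (Pi.basisFun Λ (Fin a'))))
        ((U.prod U').basis.prod (Pi.basisFun Λ (Fin (a + a')))) s := by
    have h1 : IsSimpleFor Z ((U.basis.prod (Pi.basisFun Λ (Fin a))).prod
        (U'.basis.prod (Pi.basisFun Λ (Fin a'))))
        ((U.basis.prod U'.basis).prod ((Pi.basisFun Λ (Fin a)).prod (Pi.basisFun Λ (Fin a'))))
        (LinearEquiv.prodProdProdComm Λ _ _ _ _) :=
      IsSimpleFor.of_perm (Equiv.sumSumSumComm _ _ _ _)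
        (by rintro ((i | i) | (i | i)) <;> simp)
    exact ⟨_, fun _ => rfl, h1.trans ((prod_simple U U').prod (finAdd_simple a a'))⟩
  obtain ⟨s1, e1, p1⟩ := key X X' Y.m Y'.m
  obtain ⟨s2, e2, p2⟩ := key Y Y' X.m X'.m
  have h3 := (p1.symm.trans (IsSimpleFor.prod h h')).trans p2
  refine h3.congr fun p => ?_
  obtain ⟨p, rfl⟩ := s1.surjective p
  change s2 ((stabIso X Y f).prodCongr (stabIso X' Y' f') (s1.symm (s1 p))) = _
  rw [LinearEquiv.symm_apply_apply, e1, e2]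
  rfl

theorem IsSimple.congr {X Y : BasedModule Λ} {f g : X ≃ₗ[Λ] Y} (h : IsSimple Z X Y f)
    (hfg : ∀ x, f x = g x) : IsSimple Z X Y g :=
  LinearEquiv.ext hfg ▸ h

theorem IsSimple.prodComm (X Y : BasedModule Λ) :
    IsSimple Z (X.prod Y) (Y.prod X) (LinearEquiv.prodComm Λ X Y) := by
  refine .of_direct (((finAdd Λ X.m Y.m).symm.trans (LinearEquiv.prodComm Λ _ _)).trans
    (finAdd Λ Y.m X.m)) ?_ ?_
  · exact ((finAdd_simple _ _).symm.trans (IsSimpleFor.of_perm (Equiv.sumComm _ _)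
      (by rintro (i | i) <;> simp))).trans (finAdd_simple _ _)
  · have s : IsSimpleFor Z (X.basis.prod Y.basis) (Y.basis.prod X.basis)
        (LinearEquiv.prodComm Λ _ _) :=
      IsSimpleFor.of_perm (Equiv.sumComm _ _) (by rintro (i | i) <;> simp)
    exact (((prod_simple X Y).symm.trans s).trans (prod_simple Y X)).congr fun _ => rfl

theorem IsSimple.prodAssoc (X Y W : BasedModule Λ) :
    IsSimple Z ((X.prod Y).prod W) (X.prod (Y.prod W)) (LinearEquiv.prodAssoc Λ X Y W) := by
  have f1 : IsSimpleFor Z (((Pi.basisFun Λ (Fin X.m)).prod (Pi.basisFun Λ (Fin Y.m))).prod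
      (Pi.basisFun Λ (Fin W.m))) (Pi.basisFun Λ (Fin (X.m + Y.m + W.m))) _ :=
    ((finAdd_simple _ _).prod_refl _).trans (finAdd_simple _ _)
  have f2 : IsSimpleFor Z ((Pi.basisFun Λ (Fin X.m)).prod ((Pi.basisFun Λ (Fin Y.m)).prod
      (Pi.basisFun Λ (Fin W.m)))) (Pi.basisFun Λ (Fin (X.m + (Y.m + W.m)))) _ :=
    ((IsSimpleFor.of_perm (f := LinearEquiv.refl _ _) (Equiv.refl _) fun _ => rfl).prod
      (finAdd_simple _ _)).trans (finAdd_simple _ _)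
  have f3 : IsSimpleFor Z (((Pi.basisFun Λ (Fin X.m)).prod (Pi.basisFun Λ (Fin Y.m))).prod
      (Pi.basisFun Λ (Fin W.m))) ((Pi.basisFun Λ (Fin X.m)).prod ((Pi.basisFun Λ (Fin Y.m)).prod
      (Pi.basisFun Λ (Fin W.m)))) (LinearEquiv.prodAssoc Λ _ _ _) :=
    IsSimpleFor.of_perm (Equiv.sumAssoc _ _ _) (by rintro ((i | i) | i) <;> simp)
  refine .of_direct _ ((f1.symm.trans f3).trans f2) ?_
  have g1 := ((prod_simple (Z := Z) X Y).prod_refl W.basis).trans (prod_simple (X.prod Y) W)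
  have g2 := ((IsSimpleFor.of_perm (Z := Z) (b := X.basis) (c := X.basis)
    (f := LinearEquiv.refl _ _) (Equiv.refl _) fun _ => rfl).prod
      (prod_simple Y W)).trans (prod_simple X (Y.prod W))
  have g3 : IsSimpleFor Z ((X.basis.prod Y.basis).prod W.basis)
      (X.basis.prod (Y.basis.prod W.basis)) (LinearEquiv.prodAssoc Λ _ _ _) :=
    IsSimpleFor.of_perm (Equiv.sumAssoc _ _ _) (by rintro ((i | i) | i) <;> simp)
  refine ((g1.symm.trans g3).trans g2).congr fun p => ?_
  rfl

/-- `0 ⊕ M ≅ M`. -/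
def sndEquiv (A M : Type u) [AddCommGroup A] [Module Λ A] [Subsingleton A] [AddCommGroup M]
    [Module Λ M] : (A × M) ≃ₗ[Λ] M where
  toFun := Prod.snd
  invFun x := (0, x)
  map_add' _ _ := rfl
  map_smul' _ _ := rfl
  left_inv _ := Prod.ext (Subsingleton.elim _ _) rfl
  right_inv _ := rfl

theorem IsSimple.zeroProd (X : BasedModule Λ) :
    IsSimple Z ((zero Λ).prod X) X (sndEquiv PUnit.{u + 1} X) := by
  have f0 : IsSimpleFor Z ((Pi.basisFun Λ (Fin 0)).prod (Pi.basisFun Λ (Fin X.m)))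
      (Pi.basisFun Λ (Fin X.m)) (sndEquiv _ _) :=
    IsSimpleFor.of_perm (Equiv.emptySum _ _) (by
      rintro (i | i)
      · exact i.elim0
      · simp [sndEquiv])
  have g0 : IsSimpleFor Z ((zero Λ).basis.prod X.basis) X.basis
      (sndEquiv (PUnit.{u + 1} × (Fin 0 → Λ)) _) :=
    IsSimpleFor.of_perm (Equiv.emptySum (Fin 0) _) (by
      rintro (i | i)
      · exact i.elim0
      · rw [Basis.prod_apply]
        rfl)
  refine .of_direct _ ((finAdd_simple 0 X.m).symm.trans f0) ?_
  exact ((prod_simple (zero Λ) X).symm.trans g0).congr fun p => rfl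

/-- Multiplication by `±1`. -/
def signEquiv (ε : ℤˣ) (M : Type u) [AddCommGroup M] [Module Λ M] : M ≃ₗ[Λ] M where
  toFun x := (ε : ℤ) • x
  invFun x := (ε : ℤ) • x
  map_add' := smul_add _
  map_smul' a x := smul_comm _ a x
  left_inv x := by beta_reduce; rw [smul_smul, Int.units_coe_mul_self, one_smul]
  right_inv x := by beta_reduce; rw [smul_smul, Int.units_coe_mul_self, one_smul]

theorem IsSimple.sign (ε : ℤˣ) (X : BasedModule Λ) : IsSimple Z X X (signEquiv ε X) :=
  .of_direct (signEquiv ε _) (IsSimpleFor.of_smul (Equiv.refl _) (fun _ => ε) fun _ => rfl)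
    (IsSimpleFor.of_smul (Equiv.refl _) (fun _ => ε) fun _ => rfl)

end BasedModule
end Based
section Dual

set_option linter.unusedSectionVars false

variable {Λ : Type u} [Ring Λ] [StarRing Λ]

/-- The dual `M* = Hom_Λ(M, Λ)`, a left module through the involution: `(a f)(x) = f(x) ā`. -/
def SDual (Λ : Type u) [Ring Λ] (M : Type u) [AddCommGroup M] [Module Λ M] : Type u := M →ₗ[Λ] Λ

section

variable {M N P : Type u} [AddCommGroup M] [Module Λ M] [AddCommGroup N] [Module Λ N]
  [AddCommGroup P] [Module Λ P]

instance : AddCommGroup (SDual Λ M) := inferInstanceAs (AddCommGroup (M →ₗ[Λ] Λ))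

instance : FunLike (SDual Λ M) M Λ := inferInstanceAs (FunLike (M →ₗ[Λ] Λ) M Λ)

instance : LinearMapClass (SDual Λ M) Λ M Λ :=
  inferInstanceAs (LinearMapClass (M →ₗ[Λ] Λ) Λ M Λ)

namespace SDual

@[ext] theorem ext {f g : SDual Λ M} (h : ∀ x, f x = g x) : f = g := LinearMap.ext h

@[simp] theorem add_apply (f g : SDual Λ M) (x : M) : (f + g) x = f x + g x := rfl
@[simp] theorem zero_apply (x : M) : (0 : SDual Λ M) x = 0 := rfl
@[simp] theorem neg_apply (f : SDual Λ M) (x : M) : (-f) x = - f x := rfl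
@[simp] theorem sub_apply (f g : SDual Λ M) (x : M) : (f - g) x = f x - g x := rfl

instance : Module Λ (SDual Λ M) where
  smul a f :=
    { toFun := fun x => f x * star a
      map_add' := fun x y => by rw [map_add, add_mul]
      map_smul' := fun r x => by simp [mul_assoc] }
  one_smul f := ext fun x => show f x * star 1 = f x by simp
  mul_smul a b f := ext fun x => show f x * star (a * b) = f x * star b * star a by
    simp [mul_assoc]
  smul_zero a := ext fun x => zero_mul _
  smul_add a f g := ext fun x => add_mul _ _ _
  add_smul a b f := ext fun x => show f x * star (a + b) = f x * star a + f x * star b by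
    simp [mul_add]
  zero_smul f := ext fun x => show f x * star 0 = 0 by simp

@[simp] theorem smul_apply (a : Λ) (f : SDual Λ M) (x : M) : (a • f) x = f x * star a := rfl

@[simp] theorem zsmul_apply (a : ℤ) (f : SDual Λ M) (x : M) : (a • f) x = a • f x :=
  map_zsmul (AddMonoidHom.mk' (fun g : SDual Λ M => g x) fun _ _ => rfl) a f

@[simp] theorem sum_apply {ι : Type*} (s : Finset ι) (f : ι → SDual Λ M) (x : M) :
    (∑ i ∈ s, f i) x = ∑ i ∈ s, f i x :=
  map_sum (AddMonoidHom.mk' (fun g : SDual Λ M => g x) fun _ _ => rfl) f s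

/-- The dual `f* : N* → M*` of `f : M → N`. -/
def map (f : M →ₗ[Λ] N) : SDual Λ N →ₗ[Λ] SDual Λ M where
  toFun g := LinearMap.comp (g : N →ₗ[Λ] Λ) f
  map_add' _ _ := rfl
  map_smul' _ _ := rfl

@[simp] theorem map_apply (f : M →ₗ[Λ] N) (g : SDual Λ N) (x : M) : map f g x = g (f x) := rfl

/-- The isomorphism `(M ⊕ N)* ≅ M* ⊕ N*`. -/
def prodEquiv (M N : Type u) [AddCommGroup M] [Module Λ M] [AddCommGroup N] [Module Λ N] :
    SDual Λ (M × N) ≃ₗ[Λ] SDual Λ M × SDual Λ N where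
  toFun f := (map (LinearMap.inl Λ M N) f, map (LinearMap.inr Λ M N) f)
  invFun p := map (LinearMap.fst Λ M N) p.1 + map (LinearMap.snd Λ M N) p.2
  map_add' _ _ := rfl
  map_smul' _ _ := rfl
  left_inv f := ext fun x => by
    obtain ⟨x, y⟩ := x
    change f (x, 0) + f (0, y) = f (x, y)
    rw [← map_add]; simp
  right_inv p := by
    refine Prod.ext (ext fun x => ?_) (ext fun x => ?_)
    · change p.1 x + p.2 0 = p.1 x
      simp
    · change p.1 0 + p.2 x = p.2 x
      simp

/-- Coordinates on the dual of a free module: `f ↦ (conj f(b_i))_i`. -/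
def coordEquiv {ι : Type} [Fintype ι] (b : Basis ι Λ M) : SDual Λ M ≃ₗ[Λ] (ι → Λ) where
  toFun f i := star (f (b i))
  invFun c := b.constr ℤ fun i => star (c i)
  map_add' _ _ := by ext; simp
  map_smul' _ _ := by ext; simp
  left_inv f := by
    change b.constr ℤ _ = (f : M →ₗ[Λ] Λ)
    exact b.ext fun i => (b.constr_basis ℤ _ i).trans (star_star _)
  right_inv c := by
    ext i
    change star (b.constr ℤ (fun i => star (c i)) (b i)) = c i
    rw [b.constr_basis, star_star]

/-- The dual basis. -/
def dualBasis {ι : Type} [Fintype ι] (b : Basis ι Λ M) : Basis ι Λ (SDual Λ M) :=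
  Basis.ofEquivFun (coordEquiv b)

theorem dualBasis_apply {ι : Type} [Fintype ι] [DecidableEq ι] (b : Basis ι Λ M) (i j : ι) :
    dualBasis b i (b j) = if i = j then 1 else 0 := by
  have h : coordEquiv b (dualBasis b i) = Pi.single i 1 := by
    simp [dualBasis, Basis.coe_ofEquivFun]
  have h' := congrFun h j
  change star _ = _ at h'
  rw [← star_star (dualBasis b i (b j)), h', Pi.single_apply]
  by_cases hij : i = j
  · simp [hij]
  · simp [hij, Ne.symm hij]

theorem dualBasis_eq {ι : Type} [Fintype ι] [DecidableEq ι] (b : Basis ι Λ M) (i : ι)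
    (f : SDual Λ M) (h : ∀ j, f (b j) = if i = j then 1 else 0) : dualBasis b i = f := by
  refine b.ext (f₁ := (dualBasis b i : M →ₗ[Λ] Λ)) (f₂ := (f : M →ₗ[Λ] Λ)) fun j => ?_
  exact (dualBasis_apply b i j).trans (h j).symm

/-- The evaluation `M → M**`. -/
def eval (M : Type u) [AddCommGroup M] [Module Λ M] : M →ₗ[Λ] SDual Λ (SDual Λ M) where
  toFun x :=
    { toFun := fun f => star (f x)
      map_add' := fun f g => by simp
      map_smul' := fun a f => by simp }
  map_add' x y := ext fun f => show star (f (x + y)) = star (f x) + star (f y) by simp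
  map_smul' a x := ext fun f => show star (f (a • x)) = star (f x) * star a by simp

@[simp] theorem eval_apply (x : M) (f : SDual Λ M) : eval M x f = star (f x) := rfl

end SDual

end

/-- The dual of a based module, with the dual `s`-basis. -/
abbrev BasedModule.dual (X : BasedModule Λ) : BasedModule Λ where
  carrier := SDual Λ X
  m := X.m
  n := X.n
  basis := (SDual.dualBasis X.basis).map ((SDual.prodEquiv X (Fin X.m → Λ)).trans
    ((LinearEquiv.refl Λ _).prodCongr (SDual.coordEquiv (Pi.basisFun Λ (Fin X.m)))))

namespace SDual

variable {M N P : Type u} [AddCommGroup M] [Module Λ M] [AddCommGroup N] [Module Λ N]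
  {Z : AddSubgroup (RedK1 Λ)} {ι κ : Type} [Fintype ι] [Fintype κ]

/-- The isomorphism `(f⁻¹)* : M* ≅ N*` for `f : M ≅ N`. -/
def congr (f : M ≃ₗ[Λ] N) : SDual Λ M ≃ₗ[Λ] SDual Λ N where
  toFun := map f.symm.toLinearMap
  invFun := map f.toLinearMap
  map_add' := map_add _
  map_smul' := map_smul _
  left_inv g := ext fun x => by simp
  right_inv g := ext fun x => by simp

theorem congr_simple {b : Basis ι Λ M} {c : Basis κ Λ N} {f : M ≃ₗ[Λ] N} (σ : ι ≃ κ)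
    (h : ∀ i, f (b i) = c (σ i)) : IsSimpleFor Z (dualBasis b) (dualBasis c) (congr f) := by
  classical
  refine .of_perm σ fun i => (dualBasis_eq _ _ _ fun j => ?_).symm
  obtain ⟨j, rfl⟩ := σ.surjective j
  rw [← h]
  change dualBasis b i (f.symm (f (b j))) = _
  simp [dualBasis_apply]

theorem prodEquiv_simple (b : Basis ι Λ M) (c : Basis κ Λ N) :
    IsSimpleFor Z (dualBasis (b.prod c)) ((dualBasis b).prod (dualBasis c)) (prodEquiv M N) := by
  classical
  have h : IsSimpleFor Z ((dualBasis b).prod (dualBasis c)) (dualBasis (b.prod c))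
      (prodEquiv M N).symm := by
    refine IsSimpleFor.of_perm (Equiv.refl _) fun i => (dualBasis_eq _ _ _ fun j => ?_).symm
    change (((dualBasis b).prod (dualBasis c)) i).1 (b.prod c j).1 +
      (((dualBasis b).prod (dualBasis c)) i).2 (b.prod c j).2 = _
    rcases i with i | i <;> rcases j with j | j <;> simp [dualBasis_apply]
  exact h.symm.congr fun _ => rfl

theorem coordEquiv_simple (b : Basis ι Λ M) :
    IsSimpleFor Z (dualBasis b) (Pi.basisFun Λ ι) (coordEquiv b) := by
  classical
  refine IsSimpleFor.of_perm (Equiv.refl ι) fun i => ?_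
  rw [dualBasis, Basis.coe_ofEquivFun, LinearEquiv.apply_symm_apply, Pi.basisFun_apply]
  rfl

theorem eval_basis (b : Basis ι Λ M) (i : ι) :
    eval M (b i) = dualBasis (dualBasis b) i := by
  classical
  refine (dualBasis_eq _ _ _ fun j => ?_).symm
  rw [eval_apply, dualBasis_apply]
  by_cases h : i = j
  · simp [h]
  · simp [h, Ne.symm h]

end SDual

namespace BasedModule

variable {Z : AddSubgroup (RedK1 Λ)}

theorem dual_simple (X : BasedModule Λ) :
    IsSimpleFor Z (SDual.dualBasis X.basis) X.dual.basis
      ((SDual.prodEquiv X (Fin X.m → Λ)).trans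
    ((LinearEquiv.refl Λ _).prodCongr (SDual.coordEquiv (Pi.basisFun Λ (Fin X.m))))) :=
  .of_perm (Equiv.refl _) fun _ => by simp

theorem IsSimple.dualProd (X Y : BasedModule Λ) :
    IsSimple Z (X.prod Y).dual (X.dual.prod Y.dual) (SDual.prodEquiv X Y) := by
  have f0 := SDual.coordEquiv_simple (Z := Z) (Pi.basisFun Λ (Fin (X.m + Y.m)))
  have f1 : IsSimpleFor Z (SDual.dualBasis (Pi.basisFun Λ (Fin (X.m + Y.m)))) _ _ :=
    SDual.congr_simple (f := (finAdd Λ X.m Y.m).symm) (Z := Z) finSumFinEquiv.symm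
      (c := (Pi.basisFun Λ (Fin X.m)).prod (Pi.basisFun Λ (Fin Y.m))) fun i => by
        rw [LinearEquiv.symm_apply_eq, finAdd, Basis.equiv_apply, Equiv.apply_symm_apply]
  have f2 := f1.trans (SDual.prodEquiv_simple _ _)
  have f3 := f2.trans ((SDual.coordEquiv_simple _).prod (SDual.coordEquiv_simple _))
  have f4 := (f0.symm.trans f3).trans (finAdd_simple _ _)
  refine .of_direct _ f4 ?_
  let t := (LinearEquiv.prodProdProdComm Λ X (Fin X.m → Λ) Y (Fin Y.m → Λ)).trans
      ((LinearEquiv.refl Λ (X × Y)).prodCongr (finAdd Λ X.m Y.m))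
  have g1 : IsSimpleFor Z (SDual.dualBasis (X.prod Y).basis) _ _ :=
    SDual.congr_simple (f := t.symm) (Z := Z) finSumFinEquiv.symm (c := X.basis.prod Y.basis)
      fun i => by
        rw [LinearEquiv.symm_apply_eq]
        simp only [Basis.map_apply, Basis.reindex_apply]
        rfl
  have g2 := (g1.trans (SDual.prodEquiv_simple _ _)).trans ((dual_simple X).prod (dual_simple Y))
  have g3 := ((dual_simple (X.prod Y)).symm.trans g2).trans (prod_simple X.dual Y.dual)
  refine g3.congr fun p => ?_
  obtain ⟨f, u⟩ := p
  let k := (SDual.coordEquiv (Pi.basisFun Λ (Fin (X.m + Y.m)))).symm u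
  refine Prod.ext (Prod.ext (SDual.ext fun x => ?_) (SDual.ext fun y => ?_)) ?_
  · change f (x, 0) + k (finAdd Λ _ _ (0, 0)) = f (x, 0)
    have h : k (finAdd Λ X.m Y.m (0, 0)) = 0 :=
      (congrArg k (map_zero (finAdd Λ X.m Y.m))).trans (map_zero k)
    rw [h, add_zero]
  · change f (0, y) + k (finAdd Λ _ _ (0, 0)) = f (0, y)
    have h : k (finAdd Λ X.m Y.m (0, 0)) = 0 :=
      (congrArg k (map_zero (finAdd Λ X.m Y.m))).trans (map_zero k)
    rw [h, add_zero]
  · have h : f (0, 0) = 0 := map_zero f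
    refine congrArg (finAdd Λ X.m Y.m) (Prod.ext (funext fun i => ?_) (funext fun i => ?_))
    · change star (f (0, 0) + k _) = star (k _)
      rw [h, zero_add]
      rfl
    · change star (f (0, 0) + k _) = star (k _)
      rw [h, zero_add]
      rfl

/-- The evaluation isomorphism `M ≅ M**` of a free module. -/
def evalFree {M : Type u} [AddCommGroup M] [Module Λ M] {n : ℕ} (b : Basis (Fin n) Λ M) :
    M ≃ₗ[Λ] SDual Λ (SDual Λ M) :=
  LinearEquiv.ofBijective (SDual.eval M) <| by
    have h : (b.equiv (SDual.dualBasis (SDual.dualBasis b)) (Equiv.refl _)).toLinearMap =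
        SDual.eval _ := b.ext fun i => by
      rw [SDual.eval_basis]
      simp
    rw [← h]
    exact LinearEquiv.bijective _

/-- The evaluation isomorphism `X ≅ X**` of a based module. -/
def evalEquiv (X : BasedModule Λ) : X ≃ₗ[Λ] SDual Λ (SDual Λ X) :=
  LinearEquiv.ofBijective (SDual.eval X) <| by
    constructor
    · rw [injective_iff_map_eq_zero]
      intro x hx
      have h : evalFree X.basis (x, 0) = 0 :=
        SDual.ext fun f => congrArg (fun Θ => Θ (SDual.map (LinearMap.inl Λ X _) f)) hx
      simpa using h
    · intro Θ
      obtain ⟨p, hp⟩ :=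
        (evalFree X.basis).surjective (SDual.map (SDual.map (LinearMap.inl Λ X _)) Θ)
      refine ⟨p.1, SDual.ext fun g => ?_⟩
      exact congrArg (fun Θ => Θ (SDual.map (LinearMap.fst Λ X _) g)) hp

@[simp] theorem evalEquiv_apply (X : BasedModule Λ) (x : X) (f : SDual Λ X) :
    evalEquiv X x f = star (f x) := rfl

theorem IsSimple.eval (X : BasedModule Λ) : IsSimple Z X X.dual.dual (evalEquiv X) := by
  refine .of_direct (LinearEquiv.refl _ _) (.of_perm (Equiv.refl _) fun _ => rfl) ?_
  have g1 : IsSimpleFor Z X.basis (SDual.dualBasis (SDual.dualBasis X.basis)) (evalFree X.basis) :=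
    .of_perm (Equiv.refl _) fun i => SDual.eval_basis X.basis i
  have g2 : IsSimpleFor Z (SDual.dualBasis (SDual.dualBasis X.basis))
      (SDual.dualBasis X.dual.basis) _ :=
    SDual.congr_simple (Z := Z) (f := ((SDual.prodEquiv X (Fin X.m → Λ)).trans
      ((LinearEquiv.refl Λ _).prodCongr (SDual.coordEquiv (Pi.basisFun Λ (Fin X.m))))))
      (Equiv.refl _) fun i => by simp
  have g3 := (g1.trans g2).trans (dual_simple X.dual)
  refine g3.congr fun p => ?_
  obtain ⟨x, u⟩ := p
  refine Prod.ext (SDual.ext fun f => ?_) (funext fun i => ?_)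
  · change star (f x + (SDual.coordEquiv (Pi.basisFun Λ (Fin X.m))).symm 0 u) = star (f x)
    rw [map_zero, SDual.zero_apply, add_zero]
  · change star (star ((0 : SDual Λ X) x +
      (SDual.coordEquiv (Pi.basisFun Λ (Fin X.m))).symm (Pi.basisFun Λ _ i) u)) = u i
    rw [star_star, SDual.zero_apply, zero_add]
    change (Pi.basisFun Λ (Fin X.m)).constr ℤ _ u = u i
    simp [Basis.constr_apply_fintype, Pi.single_apply, apply_ite star]

end BasedModule

end Dual
section Forms

set_option linter.unusedSectionVars false

variable {Λ : Type u} [Ring Λ] [StarRing Λ]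

section

variable {M N P M' N' : Type u} [AddCommGroup M] [Module Λ M] [AddCommGroup N] [Module Λ N]
  [AddCommGroup P] [Module Λ P] [AddCommGroup M'] [Module Λ M'] [AddCommGroup N'] [Module Λ N']

/-- The `ε`-duality involution `(T_ε φ)(x)(y) = ε conj(φ(y)(x))` on `Hom_Λ(M, M*)`. -/
def dualityInvolution (ε : ℤˣ) (M : Type u) [AddCommGroup M] [Module Λ M] :
    (M →ₗ[Λ] SDual Λ M) →+ (M →ₗ[Λ] SDual Λ M) where
  toFun φ :=
    { toFun := fun x =>
        { toFun := fun y => (ε : ℤ) • star (φ y x)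
          map_add' := fun y z => by simp
          map_smul' := fun a y => by simp [-zsmul_eq_mul] }
      map_add' := fun x y => SDual.ext fun z =>
        show (ε : ℤ) • star (φ z (x + y)) = (ε : ℤ) • star (φ z x) + (ε : ℤ) • star (φ z y) by simp
      map_smul' := fun a x => SDual.ext fun z =>
        show (ε : ℤ) • star (φ z (a • x)) = ((ε : ℤ) • star (φ z x)) * star a by
          simp [-zsmul_eq_mul] }
  map_zero' := LinearMap.ext fun x => SDual.ext fun y =>
    show (ε : ℤ) • star (0 : Λ) = 0 by simp
  map_add' φ ψ := LinearMap.ext fun x => SDual.ext fun y =>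
    show (ε : ℤ) • star (φ y x + ψ y x) = (ε : ℤ) • star (φ y x) + (ε : ℤ) • star (ψ y x) by
      simp

@[simp] theorem dualityInvolution_apply (ε : ℤˣ) (φ : M →ₗ[Λ] SDual Λ M) (x y : M) :
    dualityInvolution ε M φ x y = (ε : ℤ) • star (φ y x) := rfl

theorem dualityInvolution_self (ε : ℤˣ) (φ : M →ₗ[Λ] SDual Λ M) :
    dualityInvolution ε M (dualityInvolution ε M φ) = φ := by
  refine LinearMap.ext fun x => SDual.ext fun y => ?_
  simp [-zsmul_eq_mul, smul_smul]

/-- `Q_ε(M) = coker(1 - T_ε)`. -/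
def QEps (ε : ℤˣ) (M : Type u) [AddCommGroup M] [Module Λ M] : Type u :=
  (M →ₗ[Λ] SDual Λ M) ⧸ (AddMonoidHom.id (M →ₗ[Λ] SDual Λ M) - dualityInvolution ε M).range

instance (ε : ℤˣ) : AddCommGroup (QEps (Λ := Λ) ε M) :=
  inferInstanceAs (AddCommGroup (_ ⧸
    (AddMonoidHom.id (M →ₗ[Λ] SDual Λ M) - dualityInvolution ε M).range))

namespace QEps

/-- The class in `Q_ε(M)` of a sesquilinear form. -/
def mk (ε : ℤˣ) : (M →ₗ[Λ] SDual Λ M) →+ QEps (Λ := Λ) ε M := QuotientAddGroup.mk' _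

theorem mk_surjective (ε : ℤˣ) : Function.Surjective (mk (Λ := Λ) (M := M) ε) :=
  QuotientAddGroup.mk'_surjective _

theorem mk_eq {ε : ℤˣ} {φ ψ χ : M →ₗ[Λ] SDual Λ M}
    (h : ∀ x y, φ x y - ψ x y = χ x y - (ε : ℤ) • star (χ y x)) : mk ε φ = mk ε ψ := by
  rw [← sub_eq_zero, ← map_sub]
  refine (QuotientAddGroup.eq_zero_iff _).2 ⟨χ, ?_⟩
  exact LinearMap.ext fun x => SDual.ext fun y => (h x y).symm

/-- The symmetrisation `1 + T_ε : Q_ε(M) → Q^ε(M) ⊆ Hom_Λ(M, M*)`. -/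
def sym (ε : ℤˣ) : QEps (Λ := Λ) ε M →+ (M →ₗ[Λ] SDual Λ M) :=
  QuotientAddGroup.lift _ (AddMonoidHom.id _ + dualityInvolution ε M) <| by
    rintro _ ⟨φ, rfl⟩
    simp [AddMonoidHom.mem_ker, dualityInvolution_self]

@[simp] theorem sym_mk {ε : ℤˣ} (φ : M →ₗ[Λ] SDual Λ M) (x y : M) :
    sym ε (mk ε φ) x y = φ x y + (ε : ℤ) • star (φ y x) := rfl

/-- The form `f* φ f` on `M`, for `f : M → N`. -/
def pullHom (f : M →ₗ[Λ] N) : (N →ₗ[Λ] SDual Λ N) →+ (M →ₗ[Λ] SDual Λ M) where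
  toFun φ := (SDual.map f).comp (φ.comp f)
  map_zero' := rfl
  map_add' _ _ := rfl

@[simp] theorem pullHom_apply (f : M →ₗ[Λ] N) (φ : N →ₗ[Λ] SDual Λ N) (x y : M) :
    pullHom f φ x y = φ (f x) (f y) := rfl

/-- The map `ψ ↦ f* ψ f` from `Q_ε(N)` to `Q_ε(M)`, for `f : M → N`. -/
def pull {ε : ℤˣ} (f : M →ₗ[Λ] N) : QEps (Λ := Λ) ε N →+ QEps (Λ := Λ) ε M :=
  QuotientAddGroup.map _ _ (pullHom f) <| by
    rintro _ ⟨φ, rfl⟩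
    exact ⟨pullHom f φ, rfl⟩

@[simp] theorem pull_mk {ε : ℤˣ} (f : M →ₗ[Λ] N) (φ : N →ₗ[Λ] SDual Λ N) :
    pull f (mk ε φ) = mk ε (pullHom f φ) := rfl

theorem pull_pull {ε : ℤˣ} (f : M →ₗ[Λ] N) (g : N →ₗ[Λ] P) (ψ : QEps (Λ := Λ) ε P) :
    pull f (pull g ψ) = pull (g.comp f) ψ := by
  obtain ⟨φ, rfl⟩ := mk_surjective ε ψ
  rfl

theorem pull_id {ε : ℤˣ} (ψ : QEps (Λ := Λ) ε M) : pull LinearMap.id ψ = ψ := by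
  obtain ⟨φ, rfl⟩ := mk_surjective ε ψ
  rfl

theorem pull_zero {ε : ℤˣ} (ψ : QEps (Λ := Λ) ε N) : pull (0 : M →ₗ[Λ] N) ψ = 0 := by
  obtain ⟨φ, rfl⟩ := mk_surjective ε ψ
  have h : pullHom (0 : M →ₗ[Λ] N) φ = 0 := by
    refine LinearMap.ext fun x => SDual.ext fun y => ?_
    simp
  rw [pull_mk, h, map_zero]

theorem sym_pull {ε : ℤˣ} (f : M →ₗ[Λ] N) (ψ : QEps (Λ := Λ) ε N) (x y : M) :
    sym ε (pull f ψ) x y = sym ε ψ (f x) (f y) := by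
  obtain ⟨φ, rfl⟩ := mk_surjective ε ψ
  rfl

/-- The orthogonal sum. -/
def prod {ε : ℤˣ} (ψ : QEps (Λ := Λ) ε M) (ψ' : QEps (Λ := Λ) ε N) : QEps (Λ := Λ) ε (M × N) :=
  pull (LinearMap.fst Λ M N) ψ + pull (LinearMap.snd Λ M N) ψ'

theorem pull_prod {ε : ℤˣ} (f : P →ₗ[Λ] M × N) (ψ : QEps (Λ := Λ) ε M)
    (ψ' : QEps (Λ := Λ) ε N) : pull f (prod ψ ψ') =
      pull ((LinearMap.fst Λ M N).comp f) ψ + pull ((LinearMap.snd Λ M N).comp f) ψ' := by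
  rw [prod, map_add, pull_pull, pull_pull]

theorem pull_prodCongr {ε : ℤˣ} (f : M →ₗ[Λ] M') (g : N →ₗ[Λ] N') (ψ : QEps (Λ := Λ) ε M')
    (ψ' : QEps (Λ := Λ) ε N') :
    pull (f.prodMap g) (prod ψ ψ') = prod (pull f ψ) (pull g ψ') := by
  rw [pull_prod, prod, pull_pull, pull_pull]; rfl

theorem pull_prodComm {ε : ℤˣ} (ψ : QEps (Λ := Λ) ε M) (ψ' : QEps (Λ := Λ) ε N) :
    pull (LinearEquiv.prodComm Λ M N).toLinearMap (prod ψ' ψ) = prod ψ ψ' := by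
  rw [pull_prod, prod, add_comm]; rfl

theorem pull_prodAssoc {ε : ℤˣ} (ψ : QEps (Λ := Λ) ε M) (ψ' : QEps (Λ := Λ) ε N)
    (ψ'' : QEps (Λ := Λ) ε P) :
    pull (LinearEquiv.prodAssoc Λ M N P).toLinearMap (prod ψ (prod ψ' ψ'')) =
      prod (prod ψ ψ') ψ'' := by
  rw [pull_prod, pull_prod, prod, prod, map_add, pull_pull, pull_pull, ← add_assoc]; rfl

theorem prod_zero_zero {ε : ℤˣ} :
    prod (0 : QEps (Λ := Λ) ε M) (0 : QEps (Λ := Λ) ε N) = 0 := by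
  rw [prod, map_zero, map_zero, add_zero]

theorem pull_sndEquiv {ε : ℤˣ} [Subsingleton M] (ψ : QEps (Λ := Λ) ε N) :
    pull (BasedModule.sndEquiv M N).toLinearMap ψ = prod 0 ψ := by
  rw [prod, map_zero, zero_add]; rfl

theorem sym_prod {ε : ℤˣ} (ψ : QEps (Λ := Λ) ε M) (ψ' : QEps (Λ := Λ) ε N) (p r : M × N) :
    sym ε (prod ψ ψ') p r = sym ε ψ p.1 r.1 + sym ε ψ' p.2 r.2 := by
  rw [prod, map_add, LinearMap.add_apply, SDual.add_apply, sym_pull, sym_pull]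
  rfl

end QEps

end

/-- An `ε`-quadratic form `(X, ψ)` on a based module `X`. -/
structure QForm (Λ : Type u) [Ring Λ] [StarRing Λ] (ε : ℤˣ) where
  X : BasedModule Λ
  ψ : QEps (Λ := Λ) ε X

namespace QForm

variable {ε : ℤˣ}

/-- The symmetrisation `φ = (1 + T_ε)ψ`. -/
def sym (v : QForm Λ ε) : v.X →ₗ[Λ] SDual Λ v.X := QEps.sym ε v.ψ

/-- `(X, ψ)` is simple if its symmetrisation is a simple isomorphism `X ≅ X*`. -/
def IsSimple (Z : AddSubgroup (RedK1 Λ)) (v : QForm Λ ε) : Prop :=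
  ∃ e : v.X ≃ₗ[Λ] SDual Λ v.X, (∀ x, e x = v.sym x) ∧ BasedModule.IsSimple Z v.X v.X.dual e

/-- `v` and `w` are related by a simple isometry. -/
def Isometric (Z : AddSubgroup (RedK1 Λ)) (v w : QForm Λ ε) : Prop :=
  ∃ e : v.X ≃ₗ[Λ] w.X, BasedModule.IsSimple Z v.X w.X e ∧ QEps.pull e.toLinearMap w.ψ = v.ψ

/-- The direct sum of quadratic forms. -/
abbrev prod (v w : QForm Λ ε) : QForm Λ ε := ⟨v.X.prod w.X, QEps.prod v.ψ w.ψ⟩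

/-- The zero form `(P, 0)`. -/
abbrev zeroForm (ε : ℤˣ) (P : BasedModule Λ) : QForm Λ ε := ⟨P, 0⟩

/-- The sesquilinear form `((x, f), (y, g)) ↦ f(y)` on `L ⊕ L*`. -/
def hypHom (L : Type u) [AddCommGroup L] [Module Λ L] :
    (L × SDual Λ L) →ₗ[Λ] SDual Λ (L × SDual Λ L) :=
  (SDual.map (LinearMap.fst Λ L (SDual Λ L))).comp (LinearMap.snd Λ L (SDual Λ L))

/-- The hyperbolic form `H_ε(L)` on `L ⊕ L*`. -/
abbrev hyp (ε : ℤˣ) (L : BasedModule Λ) : QForm Λ ε := ⟨L.prod L.dual, QEps.mk ε (hypHom L)⟩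

variable {Z : AddSubgroup (RedK1 Λ)}

theorem Isometric.refl (v : QForm Λ ε) : Isometric Z v v :=
  ⟨LinearEquiv.refl Λ _, .refl _, QEps.pull_id _⟩

theorem Isometric.symm {v w : QForm Λ ε} (h : Isometric Z v w) : Isometric Z w v := by
  obtain ⟨e, he, h⟩ := h
  refine ⟨e.symm, he.symm, ?_⟩
  rw [← h, QEps.pull_pull]
  convert QEps.pull_id w.ψ using 2
  ext; simp

theorem Isometric.trans {u v w : QForm Λ ε} (h : Isometric Z u v) (h' : Isometric Z v w) :
    Isometric Z u w := by
  obtain ⟨e, he, h⟩ := h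
  obtain ⟨e', he', h'⟩ := h'
  exact ⟨e.trans e', he.trans he', by rw [← h, ← h', QEps.pull_pull]; rfl⟩

theorem Isometric.prod {v w v' w' : QForm Λ ε} (h : Isometric Z v w) (h' : Isometric Z v' w') :
    Isometric Z (v.prod v') (w.prod w') := by
  obtain ⟨e, he, h⟩ := h
  obtain ⟨e', he', h'⟩ := h'
  exact ⟨e.prodCongr e', he.prod he', (QEps.pull_prodCongr e.toLinearMap e'.toLinearMap _ _).trans
    (congrArg₂ QEps.prod h h')⟩

theorem Isometric.prodComm (v w : QForm Λ ε) : Isometric Z (v.prod w) (w.prod v) :=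
  ⟨LinearEquiv.prodComm Λ _ _, .prodComm _ _, QEps.pull_prodComm _ _⟩

theorem Isometric.prodAssoc (u v w : QForm Λ ε) :
    Isometric Z ((u.prod v).prod w) (u.prod (v.prod w)) :=
  ⟨LinearEquiv.prodAssoc Λ _ _ _, .prodAssoc _ _ _, QEps.pull_prodAssoc _ _ _⟩

theorem Isometric.zeroProd (v : QForm Λ ε) :
    Isometric Z ((zeroForm ε (BasedModule.zero Λ)).prod v) v :=
  ⟨_, .zeroProd _, QEps.pull_sndEquiv _⟩

theorem Isometric.zeroForm_prod (P Q : BasedModule Λ) :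
    Isometric Z ((zeroForm ε P).prod (zeroForm ε Q)) (zeroForm ε (P.prod Q)) :=
  ⟨LinearEquiv.refl Λ _, .refl _, (map_zero _).trans QEps.prod_zero_zero.symm⟩

theorem Isometric.prodProdProdComm (u v w x : QForm Λ ε) :
    Isometric Z ((u.prod v).prod (w.prod x)) ((u.prod w).prod (v.prod x)) :=
  (Isometric.prodAssoc _ _ _).trans <| .trans (.prod (.refl _) <|
    (Isometric.prodAssoc _ _ _).symm.trans <| (Isometric.prodComm v w).prod (.refl x) |>.trans <|
      .prodAssoc _ _ _) (Isometric.prodAssoc _ _ _).symm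

/-- Two forms define the same `0`-stabilised form if they become isometric, by a simple isometry,
after addition of zero forms. -/
def ZeroStabEquiv (Z : AddSubgroup (RedK1 Λ)) (v w : QForm Λ ε) : Prop :=
  ∃ P Q : BasedModule Λ, Isometric Z (v.prod (zeroForm ε P)) (w.prod (zeroForm ε Q))

theorem ZeroStabEquiv.of_isometric {v w : QForm Λ ε} (h : Isometric Z v w) :
    ZeroStabEquiv Z v w :=
  ⟨BasedModule.zero Λ, BasedModule.zero Λ, h.prod (.refl _)⟩

theorem ZeroStabEquiv.symm {v w : QForm Λ ε} (h : ZeroStabEquiv Z v w) : ZeroStabEquiv Z w v :=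
  let ⟨P, Q, h⟩ := h
  ⟨Q, P, h.symm⟩

theorem ZeroStabEquiv.trans {u v w : QForm Λ ε} (h : ZeroStabEquiv Z u v)
    (h' : ZeroStabEquiv Z v w) : ZeroStabEquiv Z u w := by
  obtain ⟨P, Q, h⟩ := h
  obtain ⟨P', Q', h'⟩ := h'
  refine ⟨P.prod P', Q'.prod Q, ?_⟩
  have a (x : QForm Λ ε) (A B : BasedModule Λ) : Isometric Z
      (x.prod (zeroForm ε (A.prod B))) ((x.prod (zeroForm ε A)).prod (zeroForm ε B)) :=
    (Isometric.prod (.refl x) (Isometric.zeroForm_prod A B).symm).trans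
      (Isometric.prodAssoc _ _ _).symm
  have sw : Isometric Z ((v.prod (zeroForm ε Q)).prod (zeroForm ε P'))
      ((v.prod (zeroForm ε P')).prod (zeroForm ε Q)) :=
    (Isometric.prodAssoc _ _ _).trans
      ((Isometric.prod (.refl v) (.prodComm _ _)).trans (Isometric.prodAssoc _ _ _).symm)
  exact ((a u P P').trans (h.prod (.refl _))).trans
    (sw.trans ((h'.prod (.refl _)).trans (a w Q' Q).symm))

theorem ZeroStabEquiv.prod {v w v' w' : QForm Λ ε} (h : ZeroStabEquiv Z v w)
    (h' : ZeroStabEquiv Z v' w') : ZeroStabEquiv Z (v.prod v') (w.prod w') := by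
  obtain ⟨P, Q, h⟩ := h
  obtain ⟨P', Q', h'⟩ := h'
  have a (x y : QForm Λ ε) (A B : BasedModule Λ) : Isometric Z
      ((x.prod y).prod (zeroForm ε (A.prod B)))
      ((x.prod (zeroForm ε A)).prod (y.prod (zeroForm ε B))) :=
    (Isometric.prod (.refl _) (Isometric.zeroForm_prod A B).symm).trans (.prodProdProdComm _ _ _ _)
  exact ⟨P.prod P', Q.prod Q', (a _ _ _ _).trans ((h.prod h').trans (a _ _ _ _).symm)⟩

/-- `ZeroStabEquiv` as a setoid. -/
def zeroStabSetoid (Z : AddSubgroup (RedK1 Λ)) (ε : ℤˣ) : Setoid (QForm Λ ε) where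
  r := ZeroStabEquiv Z
  iseqv := ⟨fun v => .of_isometric (.refl v), .symm, .trans⟩

end QForm

/-- The monoid `F^zs(Λ)` of `0`-stabilised `ε`-quadratic forms. -/
def ZeroStabForms (Z : AddSubgroup (RedK1 Λ)) (ε : ℤˣ) : Type (u + 1) :=
  Quotient (QForm.zeroStabSetoid Z ε)

namespace ZeroStabForms

variable {ε : ℤˣ}

/-- The `0`-stabilised form `[v]`. -/
def mk (Z : AddSubgroup (RedK1 Λ)) (v : QForm Λ ε) : ZeroStabForms Z ε := Quotient.mk _ v

instance (Z : AddSubgroup (RedK1 Λ)) : Add (ZeroStabForms Z ε) :=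
  ⟨Quotient.map₂ QForm.prod fun _ _ h _ _ h' => QForm.ZeroStabEquiv.prod h h'⟩

instance (Z : AddSubgroup (RedK1 Λ)) : Zero (ZeroStabForms Z ε) :=
  ⟨mk Z (QForm.zeroForm ε (BasedModule.zero Λ))⟩

/-- Addition is induced by the direct sum of forms, and the unit is `[0, 0] = [P, 0]`. -/
instance (Z : AddSubgroup (RedK1 Λ)) : AddCommMonoid (ZeroStabForms Z ε) where
  add_assoc := by
    rintro ⟨u⟩ ⟨v⟩ ⟨w⟩
    exact Quotient.sound (.of_isometric (.prodAssoc u v w))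
  zero_add := by
    rintro ⟨v⟩
    exact Quotient.sound (.of_isometric (.zeroProd v))
  add_zero := by
    rintro ⟨v⟩
    exact Quotient.sound (.of_isometric ((QForm.Isometric.prodComm _ _).trans (.zeroProd v)))
  add_comm := by
    rintro ⟨v⟩ ⟨w⟩
    exact Quotient.sound (.of_isometric (.prodComm v w))
  nsmul := nsmulRec

end ZeroStabForms

end Forms
section QuasiFormations

set_option linter.unusedSectionVars false

variable {Λ : Type u} [Ring Λ] [StarRing Λ] {ε : ℤˣ}

/-- A sequence `0 → A → B → C → 0` of based modules is a based exact sequence if some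
(equivalently any) splitting `A ⊕ C ≅ B` of it is simple. -/
def BasedExact (Z : AddSubgroup (RedK1 Λ)) (A B C : BasedModule Λ) (i : A →ₗ[Λ] B)
    (p : B →ₗ[Λ] C) : Prop :=
  ∃ e : (A × C) ≃ₗ[Λ] B, BasedModule.IsSimple Z (A.prod C) B e ∧ (∀ a, e (a, 0) = i a) ∧
    ∀ a c, p (e (a, c)) = c

namespace QForm

/-- The map `j*φ : M → V*`, where `φ` is the symmetrisation of `v = (M, ψ)` and `j : V → M`. -/
def restr (v : QForm Λ ε) {V : Type u} [AddCommGroup V] [Module Λ V] (j : V →ₗ[Λ] v.X) :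
    v.X →ₗ[Λ] SDual Λ V :=
  (SDual.map j).comp v.sym

@[simp] theorem restr_apply (v : QForm Λ ε) {V : Type u} [AddCommGroup V] [Module Λ V]
    (j : V →ₗ[Λ] v.X) (x : v.X) (y : V) : v.restr j x y = v.sym x (j y) := rfl

/-- The annihilator `V^⊥ = Ker(j*φ : M → V*)` of `j : V → M`. -/
def perp (v : QForm Λ ε) {V : Type u} [AddCommGroup V] [Module Λ V] (j : V →ₗ[Λ] v.X) :
    Submodule Λ v.X :=
  LinearMap.ker (v.restr j)

/-- `i` is the inclusion of a direct summand. -/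
def IsSummand {M N : Type u} [AddCommGroup M] [Module Λ M] [AddCommGroup N] [Module Λ N]
    (i : M →ₗ[Λ] N) : Prop :=
  ∃ r : N →ₗ[Λ] M, ∀ x, r (i x) = x

/-- The based module `L`, embedded by `i`, is a Lagrangian of `v = (M, ψ)`: a direct summand with
`L = L^⊥` (as unbased modules) and `i*ψi = 0`. -/
def IsLagrangian (v : QForm Λ ε) (L : BasedModule Λ) (i : L →ₗ[Λ] v.X) : Prop :=
  IsSummand i ∧ LinearMap.range i = v.perp i ∧ QEps.pull i v.ψ = 0

/-- A Lagrangian `L` is simple if `0 → L → M → L* → 0` is a based exact sequence. -/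
def IsSimpleLagrangian (Z : AddSubgroup (RedK1 Λ)) (v : QForm Λ ε) (L : BasedModule Λ)
    (i : L →ₗ[Λ] v.X) : Prop :=
  v.IsLagrangian L i ∧ BasedExact Z L v.X L.dual i (v.restr i)

end QForm

/-- An `ε`-quadratic quasi-formation `(M, ψ; L, V)`: a simple form `(M, ψ)`, a simple Lagrangian
`L` and a based direct summand `V` of half rank. The submodules `L` and `V` are given by based
modules together with their inclusions `i` and `j` into `M`. -/
structure QuasiFormation (Z : AddSubgroup (RedK1 Λ)) (ε : ℤˣ) where
  form : QForm Λ ε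
  simple : form.IsSimple Z
  L : BasedModule Λ
  i : L →ₗ[Λ] form.X
  lag : form.IsSimpleLagrangian Z L i
  V : BasedModule Λ
  j : V →ₗ[Λ] form.X
  summand : QForm.IsSummand j
  half : form.X.rank = 2 * V.rank

theorem BasedExact.prod {Z : AddSubgroup (RedK1 Λ)} {A B C A' B' C' : BasedModule Λ}
    {i : A →ₗ[Λ] B} {p : B →ₗ[Λ] C} {i' : A' →ₗ[Λ] B'} {p' : B' →ₗ[Λ] C'}
    (h : BasedExact Z A B C i p) (h' : BasedExact Z A' B' C' i' p') :
    BasedExact Z (A.prod A') (B.prod B') (C.prod C') (i.prodMap i') (p.prodMap p') := by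
  obtain ⟨e, he, h1, h2⟩ := h
  obtain ⟨e', he', h1', h2'⟩ := h'
  refine ⟨(LinearEquiv.prodProdProdComm Λ A A' C C').trans (e.prodCongr e'), ?_, ?_, ?_⟩
  · have s : BasedModule.IsSimple Z ((A.prod A').prod (C.prod C')) ((A.prod C).prod (A'.prod C'))
        (LinearEquiv.prodProdProdComm Λ A A' C C') := by
      have a1 := BasedModule.IsSimple.prodAssoc (Z := Z) A A' (C.prod C')
      have a2 := BasedModule.IsSimple.prodAssoc (Z := Z) A' C C'
      have a3 := BasedModule.IsSimple.prodAssoc (Z := Z) C A' C'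
      have a4 := BasedModule.IsSimple.prodAssoc (Z := Z) A C (A'.prod C')
      have a5 := BasedModule.IsSimple.prodComm (Z := Z) A' C
      have a6 := (a2.symm.trans (a5.prod (.refl C'))).trans a3
      exact ((a1.trans ((BasedModule.IsSimple.refl A).prod a6)).trans a4.symm).congr fun _ => rfl
    exact s.trans (he.prod he')
  · exact fun a => Prod.ext (h1 a.1) (h1' a.2)
  · exact fun a c => Prod.ext (h2 a.1 c.1) (h2' a.2 c.2)

/-- Replacing the quotient in a based exact sequence. -/
theorem BasedExact.congr_right {Z : AddSubgroup (RedK1 Λ)} {A B C C' : BasedModule Λ}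
    {i : A →ₗ[Λ] B} {p : B →ₗ[Λ] C} (h : BasedExact Z A B C i p) (g : C ≃ₗ[Λ] C')
    (hg : BasedModule.IsSimple Z C C' g) {p' : B →ₗ[Λ] C'} (hp : ∀ x, p' x = g (p x)) :
    BasedExact Z A B C' i p' := by
  obtain ⟨e, he, h1, h2⟩ := h
  refine ⟨((LinearEquiv.refl Λ A).prodCongr g.symm).trans e,
    ((BasedModule.IsSimple.refl A).prod hg.symm).trans he, fun a => ?_, fun a c => ?_⟩
  · rw [← h1]
    change e (a, g.symm 0) = _
    rw [map_zero]
  · rw [hp]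
    change g (p (e (a, g.symm c))) = c
    rw [h2, LinearEquiv.apply_symm_apply]

namespace QForm

variable {Z : AddSubgroup (RedK1 Λ)}

theorem prod_sym (v w : QForm Λ ε) (p r : v.X × w.X) :
    (v.prod w).sym p r = v.sym p.1 r.1 + w.sym p.2 r.2 := QEps.sym_prod _ _ _ _

theorem prod_restr (v w : QForm Λ ε) {V W : Type u} [AddCommGroup V] [Module Λ V]
    [AddCommGroup W] [Module Λ W] (j : V →ₗ[Λ] v.X) (k : W →ₗ[Λ] w.X) (p : v.X × w.X) :
    (v.prod w).restr (j.prodMap k) p = (SDual.prodEquiv V W).symm (v.restr j p.1, w.restr k p.2) :=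
  SDual.ext fun r => prod_sym v w p (j r.1, k r.2)

theorem IsSimple.prod {v w : QForm Λ ε} (h : v.IsSimple Z) (h' : w.IsSimple Z) :
    (v.prod w).IsSimple Z := by
  obtain ⟨e, h1, h2⟩ := h
  obtain ⟨e', h1', h2'⟩ := h'
  refine ⟨(e.prodCongr e').trans (SDual.prodEquiv _ _).symm, fun p => SDual.ext fun r => ?_,
    (h2.prod h2').trans (BasedModule.IsSimple.dualProd _ _).symm⟩
  rw [prod_sym, ← h1, ← h1']
  rfl

theorem IsSummand.prod {M N M' N' : Type u} [AddCommGroup M] [Module Λ M] [AddCommGroup N]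
    [Module Λ N] [AddCommGroup M'] [Module Λ M'] [AddCommGroup N'] [Module Λ N']
    {i : M →ₗ[Λ] N} {i' : M' →ₗ[Λ] N'} (h : IsSummand i) (h' : IsSummand i') :
    IsSummand (i.prodMap i') := by
  obtain ⟨r, h⟩ := h
  obtain ⟨r', h'⟩ := h'
  exact ⟨r.prodMap r', fun x => Prod.ext (h x.1) (h' x.2)⟩

theorem mem_perp_prod {v w : QForm Λ ε} {V W : Type u} [AddCommGroup V] [Module Λ V]
    [AddCommGroup W] [Module Λ W] {j : V →ₗ[Λ] v.X} {k : W →ₗ[Λ] w.X} (p : v.X × w.X) :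
    p ∈ (v.prod w).perp (j.prodMap k) ↔ p.1 ∈ v.perp j ∧ p.2 ∈ w.perp k := by
  rw [perp, perp, perp, LinearMap.mem_ker, LinearMap.mem_ker, LinearMap.mem_ker]
  rw [show (v.prod w).restr (j.prodMap k) p = _ from prod_restr v w j k p,
    LinearEquiv.map_eq_zero_iff, Prod.mk_eq_zero]

theorem IsLagrangian.prod {v w : QForm Λ ε} {L K : BasedModule Λ} {i : L →ₗ[Λ] v.X}
    {k : K →ₗ[Λ] w.X} (h : v.IsLagrangian L i) (h' : w.IsLagrangian K k) :
    (v.prod w).IsLagrangian (L.prod K) (i.prodMap k) := by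
  refine ⟨h.1.prod h'.1, ?_, ?_⟩
  · refine Submodule.ext fun p => (Iff.trans ?_ (mem_perp_prod p).symm)
    rw [← h.2.1, ← h'.2.1]
    constructor
    · rintro ⟨r, rfl⟩
      exact ⟨⟨r.1, rfl⟩, ⟨r.2, rfl⟩⟩
    · rintro ⟨⟨a, ha⟩, ⟨b, hb⟩⟩
      exact ⟨(a, b), Prod.ext ha hb⟩
  · refine (QEps.pull_prodCongr i k v.ψ w.ψ).trans ?_
    rw [h.2.2, h'.2.2]
    exact QEps.prod_zero_zero

theorem IsSimpleLagrangian.prod {v w : QForm Λ ε} {L K : BasedModule Λ} {i : L →ₗ[Λ] v.X}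
    {k : K →ₗ[Λ] w.X} (h : v.IsSimpleLagrangian Z L i) (h' : w.IsSimpleLagrangian Z K k) :
    (v.prod w).IsSimpleLagrangian Z (L.prod K) (i.prodMap k) := by
  refine ⟨h.1.prod h'.1, ?_⟩
  have h1 := h.2.prod h'.2
  exact BasedExact.congr_right (C' := (L.prod K).dual) h1 (SDual.prodEquiv L K).symm
    (BasedModule.IsSimple.dualProd L K).symm fun p => prod_restr v w i k p

theorem hyp_sym (K : BasedModule Λ) (p r : K × SDual Λ K) :
    (hyp ε K).sym p r = p.2 r.1 + (ε : ℤ) • star (r.2 p.1) := rfl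

theorem hyp_simple (K : BasedModule Λ) : (hyp ε K).IsSimple Z := by
  refine ⟨((LinearEquiv.prodComm Λ K (SDual Λ K)).trans ((LinearEquiv.refl Λ _).prodCongr
    ((BasedModule.evalEquiv K).trans (BasedModule.signEquiv ε _)))).trans
      (SDual.prodEquiv _ _).symm, fun p => SDual.ext fun r => ?_, ?_⟩
  · rw [hyp_sym]
    change p.2 r.1 + ((ε : ℤ) • SDual.eval K p.1) r.2 = _
    rw [SDual.zsmul_apply, SDual.eval_apply]
  · exact ((BasedModule.IsSimple.prodComm K K.dual).trans
      ((BasedModule.IsSimple.refl K.dual).prod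
        ((BasedModule.IsSimple.eval K).trans (.sign ε K.dual.dual)))).trans
      (BasedModule.IsSimple.dualProd K K.dual).symm

theorem hyp_restr (K : BasedModule Λ) (p : K × SDual Λ K) :
    (hyp ε K).restr (LinearMap.inl Λ K (SDual Λ K)) p = p.2 :=
  SDual.ext fun r => by
    rw [restr_apply, hyp_sym]
    simp

/-- The summand `K` is a simple Lagrangian of `H_ε(K)`. -/
theorem hyp_lagrangian (K : BasedModule Λ) :
    (hyp ε K).IsSimpleLagrangian Z K (LinearMap.inl Λ K (SDual Λ K)) := by
  refine ⟨⟨⟨LinearMap.fst Λ K (SDual Λ K), fun _ => rfl⟩, ?_, ?_⟩,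
    ⟨LinearEquiv.refl Λ _, .refl _, fun _ => rfl, fun a c => hyp_restr K (a, c)⟩⟩
  · refine Submodule.ext fun p => ?_
    rw [perp, LinearMap.mem_ker, hyp_restr]
    constructor
    · rintro ⟨a, rfl⟩
      rfl
    · intro h
      exact ⟨p.1, Prod.ext rfl h.symm⟩
  · exact (QEps.mk_eq (ψ := 0) (χ := 0) fun x y => by simp [hypHom]).trans (map_zero _)

end QForm

namespace BasedModule

theorem rank_prod (X Y : BasedModule Λ) : (X.prod Y).rank = X.rank + Y.rank := by
  simp only [rank]; push_cast; ring

theorem rank_dual (X : BasedModule Λ) : X.dual.rank = X.rank := rfl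

end BasedModule

namespace QuasiFormation

variable {Z : AddSubgroup (RedK1 Λ)}

/-- The direct sum of quasi-formations. -/
def prod (x y : QuasiFormation Z ε) : QuasiFormation Z ε where
  form := x.form.prod y.form
  simple := x.simple.prod y.simple
  L := x.L.prod y.L
  i := x.i.prodMap y.i
  lag := x.lag.prod y.lag
  V := x.V.prod y.V
  j := x.j.prodMap y.j
  summand := x.summand.prod y.summand
  half := by
    rw [BasedModule.rank_prod, BasedModule.rank_prod, x.half, y.half]; ring

/-- The trivial formation `(H_ε(P); P, P*)`. -/
def trivial (Z : AddSubgroup (RedK1 Λ)) (ε : ℤˣ) (P : BasedModule Λ) : QuasiFormation Z ε where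
  form := QForm.hyp ε P
  simple := QForm.hyp_simple P
  L := P
  i := LinearMap.inl Λ P (SDual Λ P)
  lag := QForm.hyp_lagrangian P
  V := P.dual
  j := LinearMap.inr Λ P (SDual Λ P)
  summand := ⟨LinearMap.snd Λ P (SDual Λ P), fun _ => rfl⟩
  half := by rw [BasedModule.rank_prod, BasedModule.rank_dual]; ring

/-- The boundary `δ(K, ρ) = (H_ε(K); K, {(x, ρx)})` of an asymmetric form `ρ : K → K*`. -/
def boundary (Z : AddSubgroup (RedK1 Λ)) (ε : ℤˣ) (K : BasedModule Λ) (ρ : K →ₗ[Λ] SDual Λ K) :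
    QuasiFormation Z ε where
  form := QForm.hyp ε K
  simple := QForm.hyp_simple K
  L := K
  i := LinearMap.inl Λ K (SDual Λ K)
  lag := QForm.hyp_lagrangian K
  V := K
  j := LinearMap.prod LinearMap.id ρ
  summand := ⟨LinearMap.fst Λ K (SDual Λ K), fun _ => rfl⟩
  half := by rw [BasedModule.rank_prod, BasedModule.rank_dual]; ring

/-- Isomorphism of quasi-formations: a simple isometry `f` with `f(L) = L'` and `f(V) = V'` such
that the induced isomorphisms `L ≅ L'` and `V ≅ V'` are simple. -/
def Iso (x y : QuasiFormation Z ε) : Prop :=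
  ∃ f : x.form.X ≃ₗ[Λ] y.form.X, BasedModule.IsSimple Z x.form.X y.form.X f ∧
    QEps.pull f.toLinearMap y.form.ψ = x.form.ψ ∧
    (∃ g : x.L ≃ₗ[Λ] y.L, BasedModule.IsSimple Z x.L y.L g ∧ ∀ a, f (x.i a) = y.i (g a)) ∧
    (∃ h : x.V ≃ₗ[Λ] y.V, BasedModule.IsSimple Z x.V y.V h ∧ ∀ a, f (x.j a) = y.j (h a))

/-- `x` is an `ε`-quadratic formation: `V` is a (not necessarily simple) Lagrangian. -/
def IsFormation (x : QuasiFormation Z ε) : Prop := x.form.IsLagrangian x.V x.j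

/-- The quasi-formation `(M, ψ; K, V)` for another simple Lagrangian `K` of `(M, ψ)`. -/
def replaceLagrangian (x : QuasiFormation Z ε) (K : BasedModule Λ) (k : K →ₗ[Λ] x.form.X)
    (hk : x.form.IsSimpleLagrangian Z K k) : QuasiFormation Z ε :=
  { x with L := K, i := k, lag := hk }

end QuasiFormation

end QuasiFormations
section LMonoid

set_option linter.unusedSectionVars false

variable {Λ : Type u} [Ring Λ] [StarRing Λ] {ε : ℤˣ} {Z : AddSubgroup (RedK1 Λ)}

theorem BasedModule.IsSimple.rank_eq {X Y : BasedModule Λ} {f : X ≃ₗ[Λ] Y}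
    (h : BasedModule.IsSimple Z X Y f) : X.rank = Y.rank := by
  obtain ⟨_, σ, τ, -⟩ := h
  have := Fintype.card_congr (σ.trans τ.symm)
  simp only [Fintype.card_sum, Fintype.card_fin] at this
  simp only [BasedModule.rank]
  omega

theorem QForm.IsSimpleLagrangian.rank_eq {v : QForm Λ ε} {L : BasedModule Λ} {i : L →ₗ[Λ] v.X}
    (h : v.IsSimpleLagrangian Z L i) : v.X.rank = 2 * L.rank := by
  obtain ⟨-, e, he, -⟩ := h
  rw [← he.rank_eq, BasedModule.rank_prod, BasedModule.rank_dual]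
  ring

namespace QuasiFormation

/-- The simple formation `(M, ψ; K, L)`, where `x = (M, ψ; L, V)` and `K` is a simple
Lagrangian. -/
def ofLagrangian (x : QuasiFormation Z ε) (K : BasedModule Λ) (k : K →ₗ[Λ] x.form.X)
    (hk : x.form.IsSimpleLagrangian Z K k) : QuasiFormation Z ε where
  form := x.form
  simple := x.simple
  L := K
  i := k
  lag := hk
  V := x.L
  j := x.i
  summand := x.lag.1.1
  half := x.lag.rank_eq

theorem Iso.refl (x : QuasiFormation Z ε) : x.Iso x :=
  ⟨LinearEquiv.refl Λ _, .refl _, QEps.pull_id _, ⟨LinearEquiv.refl Λ _, .refl _, fun _ => rfl⟩,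
    ⟨LinearEquiv.refl Λ _, .refl _, fun _ => rfl⟩⟩

theorem Iso.prodComm (x y : QuasiFormation Z ε) : (x.prod y).Iso (y.prod x) :=
  ⟨LinearEquiv.prodComm Λ _ _, .prodComm _ _, QEps.pull_prodComm _ _,
    ⟨LinearEquiv.prodComm Λ _ _, .prodComm _ _, fun _ => rfl⟩,
    ⟨LinearEquiv.prodComm Λ _ _, .prodComm _ _, fun _ => rfl⟩⟩

theorem Iso.prodAssoc (x y z : QuasiFormation Z ε) :
    ((x.prod y).prod z).Iso (x.prod (y.prod z)) :=
  ⟨LinearEquiv.prodAssoc Λ _ _ _, .prodAssoc _ _ _, QEps.pull_prodAssoc _ _ _,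
    ⟨LinearEquiv.prodAssoc Λ _ _ _, .prodAssoc _ _ _, fun _ => rfl⟩,
    ⟨LinearEquiv.prodAssoc Λ _ _ _, .prodAssoc _ _ _, fun _ => rfl⟩⟩

/-- The equivalence relation that defines the `l`-monoid: the smallest one, compatible with direct
sums, that identifies isomorphic quasi-formations, makes trivial formations zero and contains
`(M, ψ; K, L) ⊕ (M, ψ; L, V) ~ (M, ψ; K, V)` for all simple Lagrangians `K` and `L`. -/
inductive Rel : QuasiFormation Z ε → QuasiFormation Z ε → Prop
  | iso {x y : QuasiFormation Z ε} : x.Iso y → Rel x y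
  | stab (x : QuasiFormation Z ε) (P : BasedModule Λ) : Rel (x.prod (trivial Z ε P)) x
  | shift (x : QuasiFormation Z ε) (K : BasedModule Λ) (k : K →ₗ[Λ] x.form.X)
      (hk : x.form.IsSimpleLagrangian Z K k) :
      Rel ((x.ofLagrangian K k hk).prod x) (x.replaceLagrangian K k hk)
  | add {x y x' y' : QuasiFormation Z ε} : Rel x y → Rel x' y' → Rel (x.prod x') (y.prod y')
  | symm {x y : QuasiFormation Z ε} : Rel x y → Rel y x
  | trans {x y z : QuasiFormation Z ε} : Rel x y → Rel y z → Rel x z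

/-- `Rel` as a setoid. -/
def setoid (Z : AddSubgroup (RedK1 Λ)) (ε : ℤˣ) : Setoid (QuasiFormation Z ε) where
  r := Rel
  iseqv := ⟨fun x => .iso (.refl x), .symm, .trans⟩

/-- The identification `H_ε(K) ⊕ H_ε(K') ≅ H_ε(K ⊕ K')`. -/
def hypProd (K K' : BasedModule Λ) :
    ((K × SDual Λ K) × (K' × SDual Λ K')) ≃ₗ[Λ] ((K × K') × SDual Λ (K × K')) :=
  (LinearEquiv.prodProdProdComm Λ K (SDual Λ K) K' (SDual Λ K')).trans
    ((LinearEquiv.refl Λ (K × K')).prodCongr (SDual.prodEquiv K K').symm)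

theorem _root_.SurgeryMonoid.BasedModule.IsSimple.prodProdProdComm (A B C D : BasedModule Λ) :
    BasedModule.IsSimple Z ((A.prod B).prod (C.prod D)) ((A.prod C).prod (B.prod D))
      (LinearEquiv.prodProdProdComm Λ A B C D) := by
  have a1 := BasedModule.IsSimple.prodAssoc (Z := Z) A B (C.prod D)
  have a2 := BasedModule.IsSimple.prodAssoc (Z := Z) B C D
  have a3 := BasedModule.IsSimple.prodAssoc (Z := Z) C B D
  have a4 := BasedModule.IsSimple.prodAssoc (Z := Z) A C (B.prod D)
  have a5 := BasedModule.IsSimple.prodComm (Z := Z) B C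
  have a6 := (a2.symm.trans (a5.prod (.refl D))).trans a3
  exact ((a1.trans ((BasedModule.IsSimple.refl A).prod a6)).trans a4.symm).congr fun _ => rfl

theorem hypProd_simple (K K' : BasedModule Λ) :
    BasedModule.IsSimple Z ((K.prod K.dual).prod (K'.prod K'.dual))
      ((K.prod K').prod (K.prod K').dual) (hypProd K K') :=
  (BasedModule.IsSimple.prodProdProdComm K K.dual K' K'.dual).trans
    ((BasedModule.IsSimple.refl (K.prod K')).prod (BasedModule.IsSimple.dualProd K K').symm)

theorem pull_hypProd (K K' : BasedModule Λ) :
    QEps.pull (hypProd K K').toLinearMap (QForm.hyp ε (K.prod K')).ψ =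
      ((QForm.hyp ε K).prod (QForm.hyp ε K')).ψ := rfl

/-- The boundary of a direct sum of asymmetric forms. -/
theorem boundary_prod (K K' : BasedModule Λ) (ρ : K →ₗ[Λ] SDual Λ K) (ρ' : K' →ₗ[Λ] SDual Λ K') :
    ((boundary Z ε K ρ).prod (boundary Z ε K' ρ')).Iso (boundary Z ε (K.prod K')
      ((SDual.prodEquiv K K').symm.toLinearMap.comp (ρ.prodMap ρ'))) :=
  ⟨hypProd K K', hypProd_simple K K', pull_hypProd K K',
    ⟨LinearEquiv.refl Λ _, .refl _, fun _ => Prod.ext rfl (map_zero (SDual.prodEquiv K K').symm)⟩,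
    ⟨LinearEquiv.refl Λ _, .refl _, fun _ => rfl⟩⟩

theorem zero_iso_boundary :
    (trivial Z ε (BasedModule.zero Λ)).Iso (boundary Z ε (BasedModule.zero Λ) 0) := by
  have hs : Subsingleton (SDual Λ (BasedModule.zero Λ)) :=
    ⟨fun f g => SDual.ext fun x => by
      rw [Subsingleton.elim (α := PUnit) x 0]; exact (map_zero f).trans (map_zero g).symm⟩
  let h : SDual Λ (BasedModule.zero Λ) ≃ₗ[Λ] (BasedModule.zero Λ : BasedModule Λ) :=
    { toFun := fun _ => 0
      invFun := fun _ => 0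
      map_add' := fun _ _ => rfl
      map_smul' := fun _ _ => rfl
      left_inv := fun _ => Subsingleton.elim _ _
      right_inv := fun _ => rfl }
  refine ⟨LinearEquiv.refl Λ _, .refl _, QEps.pull_id _,
    ⟨LinearEquiv.refl Λ _, .refl _, fun _ => rfl⟩, ⟨h, ?_, fun _ => Prod.ext rfl ?_⟩⟩
  · exact .of_direct (LinearEquiv.refl Λ _) (.of_perm (Equiv.refl _) fun _ => rfl)
      (.of_perm (Equiv.refl _) fun i => i.elim0)
  · exact Subsingleton.elim (α := SDual Λ (BasedModule.zero Λ)) _ _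

end QuasiFormation

/-- The monoid `l_{2q+1}(Λ)`, where `ε = (-1)^q`. -/
def LMonoid (Z : AddSubgroup (RedK1 Λ)) (ε : ℤˣ) : Type (u + 1) :=
  Quotient (QuasiFormation.setoid Z ε)

namespace LMonoid

/-- The class `[x] = [M, ψ; L, V]`. -/
def mk (x : QuasiFormation Z ε) : LMonoid Z ε := Quotient.mk _ x

instance : Add (LMonoid Z ε) :=
  ⟨Quotient.map₂ QuasiFormation.prod fun _ _ h _ _ h' => QuasiFormation.Rel.add h h'⟩

instance : Zero (LMonoid Z ε) := ⟨mk (QuasiFormation.trivial Z ε (BasedModule.zero Λ))⟩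

/-- Addition is induced by the direct sum, and the unit is the class of the trivial formations. -/
instance : AddCommMonoid (LMonoid Z ε) where
  add_assoc := by
    rintro ⟨x⟩ ⟨y⟩ ⟨z⟩
    exact Quotient.sound (.iso (.prodAssoc x y z))
  zero_add := by
    rintro ⟨x⟩
    exact Quotient.sound (.trans (.iso (.prodComm _ _)) (.stab x _))
  add_zero := by
    rintro ⟨x⟩
    exact Quotient.sound (.stab x _)
  add_comm := by
    rintro ⟨x⟩ ⟨y⟩
    exact Quotient.sound (.iso (.prodComm x y))
  nsmul := nsmulRec

/-- The submonoid of elementary elements, i.e. of the classes of the boundaries `δ(K, ρ)`. -/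
def elementary (Z : AddSubgroup (RedK1 Λ)) (ε : ℤˣ) : AddSubmonoid (LMonoid Z ε) where
  carrier := {X | ∃ (K : BasedModule Λ) (ρ : K →ₗ[Λ] SDual Λ K),
    X = mk (QuasiFormation.boundary Z ε K ρ)}
  zero_mem' := ⟨BasedModule.zero Λ, 0, Quotient.sound (.iso QuasiFormation.zero_iso_boundary)⟩
  add_mem' := by
    rintro _ _ ⟨K, ρ, rfl⟩ ⟨K', ρ', rfl⟩
    exact ⟨K.prod K', _, Quotient.sound (.iso (QuasiFormation.boundary_prod K K' ρ ρ'))⟩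

/-- `L_{2q+1}(Λ)`, the set of the classes of `ε`-quadratic formations. -/
def LGroup (Z : AddSubgroup (RedK1 Λ)) (ε : ℤˣ) : Set (LMonoid Z ε) :=
  {X | ∃ x : QuasiFormation Z ε, x.IsFormation ∧ X = mk x}

end LMonoid

namespace QuasiFormation

/-- The form `(V, θ)` of `x = (M, ψ; L, V)`, where `θ = j*ψj`. -/
def formV (x : QuasiFormation Z ε) : QForm Λ ε := ⟨x.V, QEps.pull x.j x.form.ψ⟩

/-- The based module `W` with `k : W → M` is the annihilator `V^⊥` of `V` with its preferred
`s`-basis: `0 → W → M → V* → 0` is a based exact sequence. In particular `k` is injective with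
image `V^⊥`. -/
def IsPerp (x : QuasiFormation Z ε) (W : BasedModule Λ) (k : W →ₗ[Λ] x.form.X) : Prop :=
  BasedExact Z W x.form.X x.V.dual k (x.form.restr x.j)

theorem IsPerp.range_eq {x : QuasiFormation Z ε} {W : BasedModule Λ} {k : W →ₗ[Λ] x.form.X}
    (h : x.IsPerp W k) : Function.Injective k ∧ LinearMap.range k = x.form.perp x.j := by
  obtain ⟨e, -, h1, h2⟩ := h
  refine ⟨fun a b hab => ?_, Submodule.ext fun m => ⟨?_, fun hm => ?_⟩⟩
  · rw [← h1, ← h1] at hab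
    exact congrArg Prod.fst (e.injective hab)
  · rintro ⟨a, rfl⟩
    exact LinearMap.mem_ker.2 ((congrArg _ (h1 a).symm).trans (h2 a 0))
  · obtain ⟨⟨a, c⟩, rfl⟩ := e.surjective m
    have hc : c = 0 := (h2 a c).symm.trans (LinearMap.mem_ker.1 hm)
    exact ⟨a, by rw [hc, h1]⟩

/-- The form `(V^⊥, -θ^⊥)`, where `θ^⊥` is the restriction of `ψ` to `V^⊥ = k(W)`. -/
def formPerp (x : QuasiFormation Z ε) (W : BasedModule Λ) (k : W →ₗ[Λ] x.form.X) : QForm Λ ε :=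
  ⟨W, -QEps.pull k x.form.ψ⟩

end QuasiFormation

/-- The diagonal `Δ(F) = {(w, w)}` of `F × F`. -/
def diagonal (F : Type v) [AddCommMonoid F] : AddSubmonoid (F × F) where
  carrier := {p | p.1 = p.2}
  zero_mem' := rfl
  add_mem' h h' := congrArg₂ (· + ·) h h'

end LMonoid

end

end SurgeryMonoid

open SurgeryMonoid

/-! Write φ for the symmetrisation of ψ. Since φ is an isomorphism and V is a direct summand, j*φ :
M → V* is a split epimorphism. Its kernel V^⊥ therefore inherits a based structure from M and V*
(`IsSimple.complement`), unique up to simple isomorphism because shears are simple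
(`IsSimple.of_triangular`). Both forms of the pair b ignore L, are additive, and vanish in the
monoid of 0-stabilised forms when V = V^⊥ is a Lagrangian. The relations defining the l-monoid only
add formations, change L, or apply isomorphisms, so b is well defined (`Rel.boundaryForms_eq`).
Closure of Z under conjugation is what keeps duals of simple isomorphisms simple.

Image. The diagonal copy of V is isotropic in (M, ψ) ⊕ (V, -θ). Splitting off a hyperbolic form
along it (`Isometric.of_isotropic`), using (M, ψ) ≅ H(L), and changing signs gives H(V) ⊕ (V^⊥,
-θ^⊥) ≅ H(L) ⊕ (V, θ) (`IsPerp.isometric_prod`); V and L have equal rank, so both hyperbolic forms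
become the same H(Λ^r) after stabilisation. Conversely, let A : v ⊕ H(R) ≅ v' ⊕ H(R) be a simple
isometry and let ρ represent the form of v'. The graph of ρ embeds v' isometrically in H(v'), hence
A embeds v ⊕ H(R) in H(v') ⊕ H(R). The image of v ⊕ R there has annihilator graph(-T_ε ρ) ⊕ R, whose
form is -v' ⊕ 0. This realises the pair ([v], [v']) (`exists_boundaryForms_eq`).

Elementary elements. The annihilator of graph(ρ) in H(K) is graph(-T_ε ρ), so b sends δ(K, ρ) to the
diagonal element given by [K, ρ], and every diagonal element arises. For injectivity, trading the
Lagrangian K for K* does not change the class of δ(K, ρ) (`mk_boundary`). With K* as Lagrangian, a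
shear of H(K) that fixes K* changes ρ by any χ - T_ε χ, so that only the class of ρ in Q_ε matters
(`Iso.dualBoundary`). Simple isometries and zero summands are equally harmless, so δ(K, ρ) depends
only on the 0-stabilised form (`mk_boundary_eq`).

Fibre over 0. A form is trivial in the monoid of 0-stabilised forms only if it is the zero form. If
ψ vanishes on both V and V^⊥, then V ⊆ V^⊥, and φ(V^⊥), which consists of all functionals vanishing
on V, also annihilates V^⊥; reflexivity of M then gives V^⊥ ⊆ V
(`isFormation_of_boundaryForms_eq_zero`). -/

namespace SurgeryMonoid

universe u

noncomputable section

open Module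

section

/-! ### Torsion of shears. -/

section ShearTorsion

variable {Λ : Type u} [Ring Λ] {M N : Type u} [AddCommGroup M] [Module Λ M] [AddCommGroup N]
  [Module Λ N] {Z : AddSubgroup (RedK1 Λ)}

/-- The shear `(x, y) ↦ (x + g y, y)` of `M ⊕ N`. -/
def shear (g : N →ₗ[Λ] M) : (M × N) ≃ₗ[Λ] (M × N) where
  toFun p := (p.1 + g p.2, p.2)
  invFun p := (p.1 - g p.2, p.2)
  map_add' p q := by ext <;> simp; abel
  map_smul' a p := by simp
  left_inv p := by simp
  right_inv p := by simp

/-- A shear becomes a commutator after stabilisation, so that it is simple. -/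
theorem IsSimpleFor.shear {ι κ : Type} [Finite ι] [Finite κ] (b : Basis ι Λ M) (c : Basis κ Λ N)
    (g : N →ₗ[Λ] M) : IsSimpleFor Z (b.prod c) (b.prod c) (shear g) := by
  have := Fintype.ofFinite ι
  have := Fintype.ofFinite κ
  refine IsSimpleFor.cancel (d := c) ?_
  let t := Fintype.equivFin ((ι ⊕ κ) ⊕ κ)
  refine ⟨_, t, t, ?_⟩
  let B := ((b.prod c).prod c).reindex t
  let α : ((M × N) × N) ≃ₗ[Λ] ((M × N) × N) :=
    { toFun := fun p => ((p.1.1 + g p.2, p.1.2), p.2)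
      invFun := fun p => ((p.1.1 - g p.2, p.1.2), p.2)
      map_add' := fun p q => by ext <;> simp; abel
      map_smul' := fun a p => by simp
      left_inv := fun p => by simp
      right_inv := fun p => by simp }
  let β : ((M × N) × N) ≃ₗ[Λ] ((M × N) × N) :=
    { toFun := fun p => (p.1, p.2 + p.1.2)
      invFun := fun p => (p.1, p.2 - p.1.2)
      map_add' := fun p q => by ext <;> simp; abel
      map_smul' := fun a p => by simp
      left_inv := fun p => by simp
      right_inv := fun p => by simp }
  -- On M ⊕ N ⊕ N the map α adds g of the last coordinate to the first, and β adds the middle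
  -- coordinate to the last. Their commutator is the elementary-matrix identity for the shear; all
  -- torsions are taken in the one basis B, so they cancel in the abelian group.
  have h : (SurgeryMonoid.shear g).prodCongr (LinearEquiv.refl Λ N) =
      ((α.trans β.symm).trans α.symm).trans β := by
    refine LinearEquiv.ext fun p => ?_
    change ((p.1.1 + g p.1.2, p.1.2), p.2) = ((p.1.1 + g p.2 - g (p.2 - p.1.2), p.1.2),
      p.2 - p.1.2 + p.1.2)
    rw [map_sub, sub_add_cancel]
    congr 2
    abel
  rw [h, torsion_trans B B B, torsion_trans B B B, torsion_trans B B B, torsion_symm, torsion_symm]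
  convert Z.zero_mem using 1
  abel

end ShearTorsion

/-! ### Torsion of dual isomorphisms. -/

section DualTorsion

variable {Λ : Type u} [Ring Λ] [StarRing Λ] {M N : Type u} [AddCommGroup M] [Module Λ M]
  [AddCommGroup N] [Module Λ N] {Z : AddSubgroup (RedK1 Λ)}

theorem SDual.dualBasis_apply_eq_repr {ι : Type} [Fintype ι] (b : Basis ι Λ M) (i : ι) (y : M) :
    dualBasis b i y = b.repr y i := by
  classical
  have h : dualBasis b i = (b.coord i : M →ₗ[Λ] Λ) :=
    dualBasis_eq b i _ fun j => by
      change b.coord i (b j) = _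
      simp [Finsupp.single_apply, eq_comm]
  rw [h]; rfl

/-- In the dual bases the matrix of the inverse dual of f is the conjugate transpose of the matrix
of f⁻¹; the inverse accounts for the minus sign. -/
theorem torsion_dual {n : ℕ} (b : Basis (Fin n) Λ M) (c : Basis (Fin n) Λ N) (f : M ≃ₗ[Λ] N) :
    torsion (SDual.dualBasis b) (SDual.dualBasis c) (SDual.congr f) =
      -RedK1.conj (torsion b c f) := by
  rw [← map_neg, ← torsion_symm, torsion, torsion, RedK1.conj_cls]
  refine congrArg RedK1.cls (Units.ext (Matrix.ext fun i j => ?_))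
  change star (SDual.dualBasis b i (f.symm (c j))) = star (b.repr (f.symm (c j)) i)
  rw [SDual.dualBasis_apply_eq_repr]

/-- This is where the closure of Z under conjugate transposition enters the whole argument. -/
theorem IsSimpleFor.dual (hZ : ∀ z ∈ Z, RedK1.conj z ∈ Z) {ι κ : Type} [Fintype ι] [Fintype κ]
    {b : Basis ι Λ M} {c : Basis κ Λ N} {f : M ≃ₗ[Λ] N} (h : IsSimpleFor Z b c f) :
    IsSimpleFor Z (SDual.dualBasis b) (SDual.dualBasis c) (SDual.congr f) := by
  classical
  obtain ⟨n, e, e', h⟩ := h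
  have key {ι : Type} [Fintype ι] {M : Type u} [AddCommGroup M] [Module Λ M] (b : Basis ι Λ M)
      (e : ι ≃ Fin n) : (SDual.dualBasis b).reindex e = SDual.dualBasis (b.reindex e) := by
    refine Basis.eq_of_apply_eq fun i => ?_
    refine SDual.ext fun y => ?_
    rw [Basis.reindex_apply, SDual.dualBasis_apply_eq_repr, SDual.dualBasis_apply_eq_repr]
    simp
  refine ⟨n, e, e', ?_⟩
  rw [key, key, torsion_dual]
  exact Z.neg_mem (hZ _ h)

end DualTorsion

/-! ### Calculus of simple isomorphisms between based modules. -/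

namespace BasedModule

section

variable {Λ : Type u} [Ring Λ] {Z : AddSubgroup (RedK1 Λ)}

/-- Extending g by zero on the free summands gives a shear in the actual bases of the stabilised
modules, so the case of honest bases applies. -/
theorem IsSimple.shear (X Y : BasedModule Λ) (g : Y →ₗ[Λ] X) :
    IsSimple Z (X.prod Y) (X.prod Y) (shear g) := by
  refine .of_direct (LinearEquiv.refl _ _) (.of_perm (Equiv.refl _) fun _ => rfl) ?_
  have h := IsSimpleFor.shear (Z := Z) X.basis Y.basis
    ((LinearMap.inl Λ X (Fin X.m → Λ)).comp (g.comp (LinearMap.fst Λ Y (Fin Y.m → Λ))))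
  refine (((prod_simple X Y).symm.trans h).trans (prod_simple X Y)).congr fun p => ?_
  obtain ⟨⟨⟨x, u⟩, ⟨y, v⟩⟩, rfl⟩ := ((LinearEquiv.prodProdProdComm Λ X (Fin X.m → Λ) Y
    (Fin Y.m → Λ)).trans ((LinearEquiv.refl Λ (X × Y)).prodCongr
      (finAdd Λ X.m Y.m))).surjective p
  simp only [LinearEquiv.trans_apply, LinearEquiv.symm_trans_apply, LinearEquiv.symm_apply_apply]
  refine Prod.ext rfl (congrArg (finAdd Λ X.m Y.m) (Prod.ext ?_ rfl))
  exact add_zero u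

/-- A free module with an arbitrary finite basis as a based module. -/
abbrev ofBasis {n : ℕ} {M : Type u} [AddCommGroup M] [Module Λ M] (b : Basis (Fin n) Λ M) :
    BasedModule Λ where
  carrier := M
  m := 0
  n := n
  basis := b.map LinearEquiv.prodUnique.symm

theorem IsSimple.ofBasis {n : ℕ} {M N : Type u} [AddCommGroup M] [Module Λ M]
    [AddCommGroup N] [Module Λ N] (b : Basis (Fin n) Λ M) (c : Basis (Fin n) Λ N)
    (e : Fin n ≃ Fin n) (f : M ≃ₗ[Λ] N) (h : ∀ i, f (b i) = c (e i)) :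
    IsSimple Z (BasedModule.ofBasis b) (BasedModule.ofBasis c) f :=
  .of_direct (LinearEquiv.refl _ _) (.of_perm (Equiv.refl _) fun _ => rfl)
    (.of_perm e fun i => by simp [h])

/-- The stabilised module `X ⊕ Λ^m` is simply isomorphic to the free module on the `s`-basis. -/
theorem IsSimple.stabilise (X : BasedModule Λ) :
    IsSimple Z (X.prod (free Λ X.m)) (BasedModule.ofBasis X.basis) (LinearEquiv.refl Λ _) := by
  let bm := Pi.basisFun Λ (Fin X.m)
  -- The s-basis of X involves the stabilising copy of Λ^m, whereas the target uses the added copy.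
  -- The identity thus differs from a bijection of bases by the swap of the two copies, which is
  -- simple by `ghost`.
  let D : ((Fin X.m → Λ) × (Fin X.m → Λ)) ≃ₗ[Λ] ((Fin X.m → Λ) × (Fin X.m → Λ)) :=
    LinearEquiv.prodComm Λ _ _
  have hD : IsSimpleFor Z (bm.prod bm) (bm.prod bm) D :=
    .of_perm (Equiv.sumComm _ _) (by rintro (i | i) <;> simp [D])
  have a1 : IsSimpleFor Z (X.basis.prod bm) ((X.basis.prod bm).map (LinearEquiv.prodAssoc Λ _ _ _))
      (LinearEquiv.prodAssoc Λ _ _ _) := .of_perm (Equiv.refl _) fun _ => rfl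
  have g1 := (a1.trans (ghost _ (bm.prod bm) hD)).trans a1.symm
  have q : IsSimpleFor Z bm (free Λ X.m).basis LinearEquiv.prodUnique.symm :=
    .of_perm (Equiv.refl _) fun _ => by simp [bm]
  have q' : IsSimpleFor Z X.basis (BasedModule.ofBasis X.basis).basis LinearEquiv.prodUnique.symm :=
    .of_perm (Equiv.refl _) fun _ => by simp
  have q0 : IsSimpleFor Z bm (bm.prod (Pi.basisFun Λ (Fin 0))) LinearEquiv.prodUnique.symm :=
    .of_perm (Equiv.sumEmpty _ _).symm fun i => by
      rw [Equiv.sumEmpty_symm_apply, Basis.prod_apply]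
      exact Prod.ext rfl (Subsingleton.elim _ _)
  have q1 : IsSimpleFor Z (X.prod (free Λ X.m)).basis
      ((X.prod (free Λ X.m)).basis.prod (Pi.basisFun Λ (Fin 0))) LinearEquiv.prodUnique.symm :=
    .of_perm (Equiv.sumEmpty _ _).symm fun i => by
      rw [Equiv.sumEmpty_symm_apply, Basis.prod_apply]
      exact Prod.ext rfl (Subsingleton.elim _ _)
  have r : IsSimpleFor Z X.basis X.basis (LinearEquiv.refl Λ _) :=
    .of_perm (Equiv.refl _) fun _ => rfl
  have c1 := ((r.prod q).trans (prod_simple X (free Λ X.m))).trans q1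
  have c2 := q'.prod (q0.trans (finAdd_simple X.m 0))
  refine ((c1.symm.trans g1).trans c2).congr fun p => ?_
  obtain ⟨p, rfl⟩ := (((LinearEquiv.refl Λ (X × (Fin X.m → Λ))).prodCongr
    LinearEquiv.prodUnique.symm).trans ((LinearEquiv.prodProdProdComm Λ X (Fin X.m → Λ)
      (Fin X.m → Λ) (Fin 0 → Λ)).trans ((LinearEquiv.refl Λ (X × (Fin X.m → Λ))).prodCongr
        (finAdd Λ X.m 0))) |>.trans
          (LinearEquiv.prodUnique (M₂ := Fin 0 → Λ)).symm).surjective p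
  simp only [LinearEquiv.trans_apply, LinearEquiv.symm_trans_apply, LinearEquiv.symm_apply_apply]
  exact Prod.ext (Prod.ext rfl (Subsingleton.elim _ _))
    (congrArg (finAdd Λ X.m 0) (Prod.ext rfl (Subsingleton.elim _ _)))

theorem prod_stab_simple (U U' : BasedModule Λ) (a a' : ℕ) :
    ∃ s : (((U × (Fin U.m → Λ)) × (Fin a → Λ)) × ((U' × (Fin U'.m → Λ)) × (Fin a' → Λ))) ≃ₗ[Λ]
      (((U.prod U') × (Fin (U.prod U').m → Λ)) × (Fin (a + a') → Λ)),
    (∀ p, s p = (((p.1.1.1, p.2.1.1), finAdd Λ _ _ (p.1.1.2, p.2.1.2)),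
      finAdd Λ _ _ (p.1.2, p.2.2))) ∧
    IsSimpleFor Z ((U.basis.prod (Pi.basisFun Λ (Fin a))).prod
      (U'.basis.prod (Pi.basisFun Λ (Fin a'))))
      ((U.prod U').basis.prod (Pi.basisFun Λ (Fin (a + a')))) s := by
  have h1 : IsSimpleFor Z ((U.basis.prod (Pi.basisFun Λ (Fin a))).prod
      (U'.basis.prod (Pi.basisFun Λ (Fin a'))))
      ((U.basis.prod U'.basis).prod ((Pi.basisFun Λ (Fin a)).prod (Pi.basisFun Λ (Fin a'))))
      (LinearEquiv.prodProdProdComm Λ _ _ _ _) :=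
    IsSimpleFor.of_perm (Equiv.sumSumSumComm _ _ _ _)
      (by rintro ((i | i) | (i | i)) <;> simp)
  exact ⟨_, fun _ => rfl, h1.trans ((prod_simple U U').prod (finAdd_simple a a'))⟩

/-- Simplicity of f can be tested after adding a based module. This turns every later comparison of
based structures into a computation in a larger module. -/
theorem IsSimple.cancel {X X' Y : BasedModule Λ} {f : X ≃ₗ[Λ] X'}
    (h : IsSimple Z (X.prod Y) (X'.prod Y) (f.prodCongr (LinearEquiv.refl Λ Y))) :
    IsSimple Z X X' f := by
  obtain ⟨s1, e1, p1⟩ := prod_stab_simple (Z := Z) X Y X'.m Y.m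
  obtain ⟨s2, e2, p2⟩ := prod_stab_simple (Z := Z) X' Y X.m Y.m
  have h1 := (p1.trans h).trans p2.symm
  have r : IsSimpleFor Z (X'.basis.prod (Pi.basisFun Λ (Fin X.m)))
      (X'.basis.prod (Pi.basisFun Λ (Fin X.m))) (LinearEquiv.refl Λ _) :=
    .of_perm (Equiv.refl _) fun _ => rfl
  -- `stabIso` of the identity of Y is not the identity: it exchanges the two free summands.
  -- Composing with its inverse leaves the identity on the Y factor, which can then be cancelled.
  have h2 := h1.trans (r.prod (IsSimpleFor.symm (IsSimple.refl (Z := Z) Y)))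
  refine IsSimpleFor.cancel (h2.congr fun p => ?_)
  simp only [LinearEquiv.trans_apply, e1]
  have h3 : s2 ((stabIso X X' f p.1), (stabIso Y Y (LinearEquiv.refl Λ Y) p.2)) = stabIso (X.prod Y)
      (X'.prod Y) (f.prodCongr (LinearEquiv.refl Λ Y))
      (((p.1.1.1, p.2.1.1), finAdd Λ _ _ (p.1.1.2, p.2.1.2)), finAdd Λ _ _ (p.1.2, p.2.2)) :=
    e2 _
  rw [← h3, LinearEquiv.symm_apply_apply]
  rfl

theorem IsSimple.free_add (a b : ℕ) :
    IsSimple Z ((free Λ a).prod (free Λ b)) (free Λ (a + b)) (finAdd Λ a b) := by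
  have q (n : ℕ) : IsSimpleFor Z (Pi.basisFun Λ (Fin n)) (free Λ n).basis
    LinearEquiv.prodUnique.symm := .of_perm (Equiv.refl _) fun _ => by simp
  have h := (((prod_simple (Z := Z) (free Λ a) (free Λ b)).symm.trans
    ((q a).symm.prod (q b).symm)).trans (finAdd_simple a b)).trans (q (a + b))
  refine .of_direct (LinearEquiv.refl Λ (Fin 0 → Λ)) (.of_perm (Equiv.refl _) fun _ => rfl) ?_
  refine h.congr fun p => Prod.ext ?_ (Subsingleton.elim _ _)
  rfl

theorem IsSimple.ofBasis_prod {a b : ℕ} {M N : Type u} [AddCommGroup M] [Module Λ M]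
    [AddCommGroup N] [Module Λ N] (B : Basis (Fin a) Λ M) (C : Basis (Fin b) Λ N) :
    IsSimple Z ((BasedModule.ofBasis B).prod (BasedModule.ofBasis C))
      (BasedModule.ofBasis ((B.prod C).reindex finSumFinEquiv)) (LinearEquiv.refl Λ _) := by
  have q {n : ℕ} {M : Type u} [AddCommGroup M] [Module Λ M] (B : Basis (Fin n) Λ M) :
      IsSimpleFor Z B (BasedModule.ofBasis B).basis LinearEquiv.prodUnique.symm :=
    .of_perm (Equiv.refl _) fun _ => by simp
  have r : IsSimpleFor Z (B.prod C) ((B.prod C).reindex finSumFinEquiv) (LinearEquiv.refl Λ _) :=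
    .of_perm finSumFinEquiv fun _ => by simp
  have h := (((prod_simple (Z := Z) (BasedModule.ofBasis B) (BasedModule.ofBasis C)).symm.trans
    ((q B).symm.prod (q C).symm)).trans r).trans (q _)
  refine .of_direct (LinearEquiv.refl Λ (Fin 0 → Λ)) (.of_perm (Equiv.refl _) fun _ => rfl) ?_
  exact h.congr fun p => Prod.ext rfl (Subsingleton.elim _ _)

/-- Coordinates in the s-basis of X give a simple isomorphism onto a free module: a based module is
simply stably free. -/
theorem IsSimple.stab_free (X : BasedModule Λ) :
    IsSimple Z (X.prod (free Λ X.m)) (free Λ X.n) X.basis.equivFun := by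
  have h : IsSimple Z (BasedModule.ofBasis X.basis) (free Λ X.n) X.basis.equivFun :=
    IsSimple.ofBasis X.basis (Pi.basisFun Λ (Fin X.n)) (Equiv.refl _) X.basis.equivFun fun i => by
      ext j
      simp [Pi.single_apply, eq_comm]
  exact ((IsSimple.stabilise X).trans h).congr fun _ => rfl

theorem exists_free_simple (X : BasedModule Λ) (k : ℕ) :
    ∃ f : (X × (Fin (X.m + k) → Λ)) ≃ₗ[Λ] (Fin (X.n + k) → Λ),
      IsSimple Z (X.prod (free Λ (X.m + k))) (free Λ (X.n + k)) f :=
  ⟨_, ((((IsSimple.refl X).prod (IsSimple.free_add X.m k).symm).trans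
    (IsSimple.prodAssoc X (free Λ X.m) (free Λ k)).symm).trans
      ((IsSimple.stab_free X).prod (.refl _))).trans (IsSimple.free_add X.n k)⟩

/-! ### Based structures on complements. -/

section Complement

variable {A : Type u} [AddCommGroup A] [Module Λ A] {B C : BasedModule Λ}

/-- The isomorphism `A ⊕ Λ^{n(C)+m(B)} ≅ (B ⊕ Λ^{m(B)}) ⊕ Λ^{m(C)}` induced by `A ⊕ C ≅ B`. -/
def complementEquiv (e : (A × C) ≃ₗ[Λ] B) :
    (A × (Fin (C.n + B.m) → Λ)) ≃ₗ[Λ] ((B × (Fin B.m → Λ)) × (Fin C.m → Λ)) :=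
  ((LinearEquiv.refl Λ A).prodCongr
    ((C.basis.equivFun.prodCongr (LinearEquiv.refl Λ (Fin B.m → Λ))).trans
      (finAdd Λ C.n B.m))).symm.trans
  { toFun := fun p => ((e (p.1, p.2.1.1), p.2.2), p.2.1.2)
    invFun := fun p => ((e.symm p.1.1).1, (((e.symm p.1.1).2, p.2), p.1.2))
    map_add' := fun p q => by
      refine Prod.ext (Prod.ext ?_ rfl) rfl
      exact map_add e (p.1, p.2.1.1) (q.1, q.2.1.1)
    map_smul' := fun a p => by
      refine Prod.ext (Prod.ext ?_ rfl) rfl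
      exact map_smul e a (p.1, p.2.1.1)
    left_inv := fun p => by simp
    right_inv := fun p => by simp }

/-- The based structure on `A` for which an isomorphism `A ⊕ C ≅ B` becomes simple. -/
abbrev complement (e : (A × C) ≃ₗ[Λ] B) : BasedModule Λ where
  carrier := A
  m := C.n + B.m
  n := B.n + C.m
  basis := ((B.basis.prod (Pi.basisFun Λ (Fin C.m))).reindex finSumFinEquiv).map
    (complementEquiv e).symm

/-- After adding Λ^{m(C)} ⊕ Λ^{m(B)}, the coordinates of C absorb the first summand, and e becomes
`complementEquiv`, which matches the two bases by construction. The added summand is then cancelled.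
-/
theorem IsSimple.complement (e : (A × C) ≃ₗ[Λ] B) :
    IsSimple Z ((BasedModule.complement e).prod C) B e := by
  let W := BasedModule.complement e
  let B' := (B.basis.prod (Pi.basisFun Λ (Fin C.m))).reindex finSumFinEquiv
  have h1 := IsSimple.stabilise (Z := Z) W
  have h2 : IsSimple Z (BasedModule.ofBasis W.basis) (BasedModule.ofBasis B') (complementEquiv e) :=
    IsSimple.ofBasis (n := B.n + C.m) W.basis B' (Equiv.refl _) (complementEquiv e) fun i => by
      simp [W, B']
  have h3 := (IsSimple.ofBasis_prod (Z := Z) B.basis (Pi.basisFun Λ (Fin C.m))).symm.trans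
    ((IsSimple.stabilise B).symm.prod (.refl (free Λ C.m)))
  have h4 := h3.trans ((IsSimple.prodAssoc B (free Λ B.m) (free Λ C.m)).trans
    ((IsSimple.refl B).prod (.prodComm _ _)))
  have h5 := ((IsSimple.stab_free (Z := Z) C).prod (.refl (free Λ B.m))).trans (.free_add C.n B.m)
  have h6 := (IsSimple.prodAssoc (Z := Z) W C ((free Λ C.m).prod (free Λ B.m))).trans
    ((IsSimple.refl W).prod ((IsSimple.prodAssoc C (free Λ C.m) (free Λ B.m)).symm.trans h5))
  refine IsSimple.cancel ((((h6.trans h1).trans h2).trans h4).congr fun p => ?_)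
  obtain ⟨⟨a, c⟩, u, v⟩ := p
  let f := (LinearEquiv.refl Λ A).prodCongr
    ((C.basis.equivFun.prodCongr (LinearEquiv.refl Λ (Fin B.m → Λ))).trans (finAdd Λ C.n B.m))
  have h : f.symm (f (a, ((c, u), v))) = (a, ((c, u), v)) := f.symm_apply_apply _
  exact congrArg (fun p : A × ((C × (Fin C.m → Λ)) × (Fin B.m → Λ)) =>
    ((e (p.1, p.2.1.1), (p.2.1.2, p.2.2)) : B × ((Fin C.m → Λ) × (Fin B.m → Λ)))) h

end Complement

/-- A based complement is determined up to simple isomorphism by a triangular comparison. -/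
theorem IsSimple.of_triangular {A A' B C : BasedModule Λ} {e : (A × C) ≃ₗ[Λ] B}
    {e' : (A' × C) ≃ₗ[Λ] B} (he : IsSimple Z (A.prod C) B e) (he' : IsSimple Z (A'.prod C) B e')
    {f : A ≃ₗ[Λ] A'} {g : C →ₗ[Λ] A'} (h : ∀ a c, e (a, c) = e' (f a + g c, c)) :
    IsSimple Z A A' f := by
  -- The comparison e'⁻¹e is f ⊕ 1 followed by the shear of g. Removing the shear leaves f ⊕ 1, from
  -- which C cancels.
  refine IsSimple.cancel (Y := C)
    (((he.trans he'.symm).trans (IsSimple.shear A' C g).symm).congr fun p => ?_)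
  obtain ⟨a, c⟩ := p
  change (SurgeryMonoid.shear g).symm (e'.symm (e (a, c))) = (f a, c)
  rw [h, LinearEquiv.symm_apply_apply, LinearEquiv.symm_apply_eq]
  rfl

end

section

variable {Λ : Type u} [Ring Λ] [StarRing Λ] {Z : AddSubgroup (RedK1 Λ)}

/-- Splitting the dual of the stabilised module into the duals of its summands turns the dual of
`stabIso` into the `stabIso` of the dual map, so the statement for bases suffices. -/
theorem IsSimple.dual (hZ : ∀ z ∈ Z, RedK1.conj z ∈ Z) {X Y : BasedModule Λ} {f : X ≃ₗ[Λ] Y}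
    (h : IsSimple Z X Y f) : IsSimple Z X.dual Y.dual (SDual.congr f) := by
  have h1 := IsSimpleFor.dual hZ h
  have k (U : BasedModule Λ) (a : ℕ) := ((SDual.prodEquiv_simple (Z := Z) U.basis
    (Pi.basisFun Λ (Fin a))).trans ((dual_simple U).prod (SDual.coordEquiv_simple _)))
  have h2 := ((k X Y.m).symm.trans h1).trans (k Y X.m)
  refine h2.congr fun p => ?_
  obtain ⟨F, rfl⟩ := ((SDual.prodEquiv (X × (Fin X.m → Λ)) (Fin Y.m → Λ)).trans
    (((SDual.prodEquiv X (Fin X.m → Λ)).trans ((LinearEquiv.refl Λ _).prodCongr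
      (SDual.coordEquiv (Pi.basisFun Λ (Fin X.m))))).prodCongr
        (SDual.coordEquiv (Pi.basisFun Λ (Fin Y.m))))).surjective p
  simp only [LinearEquiv.trans_apply, LinearEquiv.symm_trans_apply, LinearEquiv.symm_apply_apply]
  have hz : f.symm 0 = 0 := map_zero _
  refine Prod.ext (Prod.ext (SDual.ext fun y => rfl) (funext fun i => ?_)) (funext fun i => ?_)
  · change star (F ((f.symm 0, 0), _)) = star (F ((0, 0), _))
    rw [hz]; rfl
  · change star (F ((f.symm 0, _), 0)) = star (F ((0, _), 0))
    rw [hz]; rfl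

end

end BasedModule

end

section

/-! ### Calculus in Q_ε. -/

section QEpsCalculus

variable {Λ : Type u} [Ring Λ] [StarRing Λ] {M N P : Type u} [AddCommGroup M] [Module Λ M]
  [AddCommGroup N] [Module Λ N] [AddCommGroup P] [Module Λ P] {ε : ℤˣ}

namespace QEps

theorem mk_dualityInvolution (φ : M →ₗ[Λ] SDual Λ M) :
    mk ε (dualityInvolution ε M φ) = mk ε φ :=
  (mk_eq (χ := φ) fun x y => by rw [dualityInvolution_apply]).symm

theorem exists_of_mk_eq {φ φ' : M →ₗ[Λ] SDual Λ M} (h : mk ε φ = mk ε φ') :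
    ∃ χ : M →ₗ[Λ] SDual Λ M, ∀ x y, φ' x y - φ x y = χ x y - (ε : ℤ) • star (χ y x) := by
  let N := (AddMonoidHom.id (M →ₗ[Λ] SDual Λ M) - dualityInvolution ε M).range
  have h0 : mk ε (φ' - φ) = 0 := by rw [map_sub, h, sub_self]
  have h1 : φ' - φ ∈ (QuotientAddGroup.mk' N).ker := h0
  rw [QuotientAddGroup.ker_mk'] at h1
  obtain ⟨χ, hχ⟩ := h1
  exact ⟨χ, fun x y => congrArg (fun F : M →ₗ[Λ] SDual Λ M => F x y) hχ.symm⟩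

theorem sym_symm (ψ : QEps (Λ := Λ) ε M) (x y : M) :
    sym ε ψ x y = (ε : ℤ) • star (sym ε ψ y x) := by
  obtain ⟨φ, rfl⟩ := mk_surjective ε ψ
  simp only [sym_mk, star_add, star_zsmul, star_star, smul_add, smul_smul, Int.units_coe_mul_self,
    one_smul]
  abel

/-- The sesquilinear form `(x, y) ↦ φ(f x)(g y)`. -/
def cross (φ : N →ₗ[Λ] SDual Λ N) (f g : M →ₗ[Λ] N) : M →ₗ[Λ] SDual Λ M :=
  (SDual.map g).comp (φ.comp f)

@[simp] theorem cross_apply (φ : N →ₗ[Λ] SDual Λ N) (f g : M →ₗ[Λ] N) (x y : M) :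
    cross φ f g x y = φ (f x) (g y) := rfl

/-- The quadratic refinement identity: the failure of additivity is the symmetrisation, evaluated on
the two maps. -/
theorem pull_add (f g : M →ₗ[Λ] N) (ψ : QEps (Λ := Λ) ε N) :
    pull (f + g) ψ = pull f ψ + pull g ψ + mk ε (cross (sym ε ψ) f g) := by
  obtain ⟨φ, rfl⟩ := mk_surjective ε ψ
  simp only [pull_mk, ← map_add]
  -- Expanding gives two mixed terms. Modulo 1 - T_ε, the term φ(g x)(f y) may be replaced by its
  -- ε-dual, and together with φ(f x)(g y) it forms the symmetrisation.
  refine mk_eq (χ := cross φ g f) fun x y => ?_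
  simp only [pullHom_apply, LinearMap.add_apply, SDual.add_apply, cross_apply, sym_mk, map_add]
  abel

theorem neg_prod (ψ : QEps (Λ := Λ) ε M) (ψ' : QEps (Λ := Λ) ε N) :
    -prod ψ ψ' = prod (-ψ) (-ψ') := by
  rw [prod, prod, map_neg, map_neg, neg_add]

end QEps

end QEpsCalculus

/-! ### Hyperbolic forms and splitting along isotropic submodules. -/

namespace QForm

variable {Λ : Type u} [Ring Λ] [StarRing Λ] {ε : ℤˣ} {Z : AddSubgroup (RedK1 Λ)}

theorem sym_symm (v : QForm Λ ε) (x y : v.X) : v.sym x y = (ε : ℤ) • star (v.sym y x) :=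
  QEps.sym_symm v.ψ x y

/-- The form `(X, -ψ)`. -/
abbrev neg (v : QForm Λ ε) : QForm Λ ε := ⟨v.X, -v.ψ⟩

theorem Isometric.neg {v w : QForm Λ ε} (h : Isometric Z v w) : Isometric Z v.neg w.neg := by
  obtain ⟨e, he, h⟩ := h
  exact ⟨e, he, by rw [map_neg, h]⟩

theorem Isometric.of_eq {X : BasedModule Λ} {ψ ψ' : QEps (Λ := Λ) ε X} (h : ψ = ψ') :
    Isometric Z (⟨X, ψ⟩ : QForm Λ ε) ⟨X, ψ'⟩ := h ▸ .refl _

theorem Isometric.neg_prod (v w : QForm Λ ε) :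
    Isometric Z (v.prod w).neg (v.neg.prod w.neg) :=
  .of_eq (QEps.neg_prod v.ψ w.ψ)

theorem pull_hyp_congr {K K' : BasedModule Λ} (f : K ≃ₗ[Λ] K') :
    QEps.pull (f.prodCongr (SDual.congr f)).toLinearMap (hyp ε K').ψ = (hyp ε K).ψ := by
  rw [QEps.pull_mk]
  congr 1
  refine LinearMap.ext fun x => SDual.ext fun y => ?_
  change x.2 (f.symm (f y.1)) = x.2 y.1
  rw [LinearEquiv.symm_apply_apply]

theorem Isometric.hyp_congr (hZ : ∀ z ∈ Z, RedK1.conj z ∈ Z) {K K' : BasedModule Λ}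
    {f : K ≃ₗ[Λ] K'} (hf : BasedModule.IsSimple Z K K' f) :
    Isometric Z (hyp ε K) (hyp ε K') :=
  ⟨f.prodCongr (SDual.congr f), hf.prod (hf.dual hZ), pull_hyp_congr f⟩

theorem Isometric.hyp_prod (K K' : BasedModule Λ) :
    Isometric Z ((hyp ε K).prod (hyp ε K')) (hyp ε (K.prod K')) :=
  ⟨QuasiFormation.hypProd K K', QuasiFormation.hypProd_simple K K',
    QuasiFormation.pull_hypProd K K'⟩

/-- The isometry is (x, f) ↦ (x, -f). -/
theorem Isometric.hyp_neg (K : BasedModule Λ) : Isometric Z (hyp ε K).neg (hyp ε K) := by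
  refine ⟨(LinearEquiv.refl Λ K).prodCongr (BasedModule.signEquiv (-1) _),
    (BasedModule.IsSimple.refl K).prod (BasedModule.IsSimple.sign (-1) K.dual), ?_⟩
  change _ = -QEps.mk ε (hypHom (K : Type u))
  rw [QEps.pull_mk, ← map_neg]
  congr 1
  refine LinearMap.ext fun x => SDual.ext fun y => ?_
  change ((((-1 : ℤˣ) : ℤ) • x.2 : SDual Λ K)) y.1 = -(x.2 y.1)
  simp

/-- An isotropic `K` with a section `σ` of the restriction `M → K*` splits off a hyperbolic
form. -/
theorem Isometric.of_isotropic {v : QForm Λ ε} {K W : BasedModule Λ} {i : K →ₗ[Λ] v.X}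
    {k : W →ₗ[Λ] v.X} {σ : SDual Λ K →ₗ[Λ] v.X} (hi : QEps.pull i v.ψ = 0)
    (hk : ∀ w, v.restr i (k w) = 0) (hσ : ∀ f, v.restr i (σ f) = f)
    {T : ((K × SDual Λ K) × W) ≃ₗ[Λ] v.X}
    (hT : BasedModule.IsSimple Z ((K.prod K.dual).prod W) v.X T)
    (hT' : ∀ x f w, T ((x, f), w) = i x + σ f + k w) :
    Isometric Z ((hyp ε K).prod ⟨W, QEps.pull k v.ψ⟩) v := by
  obtain ⟨κ, hκ⟩ := QEps.mk_surjective ε (QEps.pull σ v.ψ)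
  -- The section σ need be neither isotropic nor orthogonal to W. Both defects are corrected by
  -- moving σ f and k w along K: δ is chosen with f(δ g) = κ f g, killing the form on the image of
  -- σ.
  let δ : SDual Λ K →ₗ[Λ] K :=
    (BasedModule.evalEquiv K).symm.toLinearMap.comp (dualityInvolution 1 _ κ)
  -- Chosen with f(γ w) = φ(σ f)(k w), to kill the pairing of σ with W; the factor ε compensates the
  -- exchange of arguments of φ.
  let γ : W →ₗ[Λ] K := (BasedModule.evalEquiv K).symm.toLinearMap.comp
    ((BasedModule.signEquiv ε (SDual Λ (SDual Λ K))).toLinearMap.comp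
      ((SDual.map σ).comp (v.sym.comp k)))
  have he (X : SDual Λ (SDual Λ K)) (f : SDual Λ K) :
      f ((BasedModule.evalEquiv K).symm X) = star (X f) := by
    obtain ⟨x, rfl⟩ := (BasedModule.evalEquiv K).surjective X
    simp
  have hδ (f g : SDual Λ K) : f (δ g) = κ f g := by
    change f ((BasedModule.evalEquiv K).symm (dualityInvolution 1 _ κ g)) = _
    rw [he]; simp
  have hγ (f : SDual Λ K) (w : W) : f (γ w) = v.sym (σ f) (k w) := by
    change f ((BasedModule.evalEquiv K).symm ((ε : ℤ) • SDual.map σ (v.sym (k w)))) = _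
    rw [he, SDual.zsmul_apply, star_zsmul, SDual.map_apply, ← sym_symm]
  -- Because K is isotropic and W pairs trivially with K, a correction along K affects only the
  -- pairing with σ. It is also a shear, so the torsion is unchanged.
  let g : (SDual Λ K × W) →ₗ[Λ] K := -(δ.coprod γ)
  let S : ((K × SDual Λ K) × W) ≃ₗ[Λ] ((K × SDual Λ K) × W) :=
    ((LinearEquiv.prodAssoc Λ _ _ _).trans (shear g)).trans (LinearEquiv.prodAssoc Λ _ _ _).symm
  have hS : BasedModule.IsSimple Z ((K.prod K.dual).prod W) ((K.prod K.dual).prod W) S :=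
    ((BasedModule.IsSimple.prodAssoc K K.dual W).trans
      (.shear K (K.dual.prod W) g)).trans (.symm (.prodAssoc _ _ _))
  refine ⟨S.trans T, hS.trans hT, ?_⟩
  let b : ((K × SDual Λ K) × W) →ₗ[Λ] SDual Λ K :=
    (LinearMap.snd Λ K (SDual Λ K)).comp (LinearMap.fst Λ _ _)
  let c : ((K × SDual Λ K) × W) →ₗ[Λ] W := LinearMap.snd Λ _ _
  let a : ((K × SDual Λ K) × W) →ₗ[Λ] K :=
    (LinearMap.fst Λ K (SDual Λ K)).comp (LinearMap.fst Λ _ _) + g.comp (b.prod c)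
  have ha (p) : a p = p.1.1 - δ p.1.2 - γ p.2 := by
    change p.1.1 + -(δ p.1.2 + γ p.2) = _
    abel
  have hST : (S.trans T).toLinearMap = (σ.comp b + k.comp c) + i.comp a := by
    refine LinearMap.ext fun p => ?_
    change T ((a p, p.1.2), p.2) = _
    rw [hT']
    change _ = (σ p.1.2 + k p.2) + i (a p)
    abel
  change _ = QEps.prod (QEps.mk ε (hypHom (K : Type u))) (QEps.pull k v.ψ)
  rw [hST, QEps.pull_add, QEps.pull_add, ← QEps.pull_pull a i, ← QEps.pull_pull b σ,
    ← QEps.pull_pull c k, hi, map_zero, add_zero, ← hκ, QEps.pull_mk, QEps.prod, QEps.pull_mk,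
    add_right_comm (QEps.mk ε _), add_right_comm _ (QEps.pull c _), ← map_add, ← map_add]
  -- What remains is an equality of sesquilinear forms, not merely of classes: κ and the mixed term
  -- cancel against δ and γ, leaving the evaluation of the hyperbolic form.
  congr 2
  refine LinearMap.ext fun p => SDual.ext fun q => ?_
  change κ p.1.2 q.1.2 + v.sym (σ p.1.2) (k q.2) + v.sym (σ p.1.2 + k p.2) (i (a q)) = p.1.2 q.1.1
  have h1 : v.sym (σ p.1.2) (i (a q)) = p.1.2 (a q) :=
    congrArg (fun f : SDual Λ K => f (a q)) (hσ p.1.2)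
  have h2 : v.sym (k p.2) (i (a q)) = 0 :=
    congrArg (fun f : SDual Λ K => f (a q)) (hk p.2)
  rw [map_add, SDual.add_apply, h1, h2, ha, map_sub, map_sub, hδ, hγ]
  abel

/-- A form with a simple Lagrangian `L` is isometric to `H_ε(L)`. -/
theorem IsSimpleLagrangian.isometric {v : QForm Λ ε} {L : BasedModule Λ} {i : L →ₗ[Λ] v.X}
    (h : v.IsSimpleLagrangian Z L i) : Isometric Z (hyp ε L) v := by
  obtain ⟨⟨-, -, h0⟩, e, he, h1, h2⟩ := h
  let z : ((L × SDual Λ L) × PUnit.{u + 1}) ≃ₗ[Λ] (L × SDual Λ L) :=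
    (LinearEquiv.prodComm Λ _ _).trans (BasedModule.sndEquiv PUnit.{u + 1} _)
  have hz : BasedModule.IsSimple Z ((L.prod L.dual).prod (BasedModule.zero Λ)) (L.prod L.dual) z :=
    (BasedModule.IsSimple.prodComm (L.prod L.dual) (BasedModule.zero Λ)).trans (.zeroProd _)
  -- A simple Lagrangian is the case with no remaining summand W; the section comes from the simple
  -- splitting.
  have h3 := Isometric.of_isotropic (v := v) (i := i) (K := L) (W := BasedModule.zero Λ) (k := 0)
    (σ := e.toLinearMap.comp (LinearMap.inr Λ _ _)) h0 (fun _ => map_zero _)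
    (fun f => h2 0 f) (hz.trans he) (fun x f w => by
      change e (x, f) = i x + e (0, f) + 0
      rw [add_zero, ← h1, ← map_add]
      simp)
  rw [QEps.pull_zero] at h3
  exact ((Isometric.zeroProd _).symm.trans (.prodComm _ _)).trans h3

end QForm

end

section

/-! ### Maps of based exact sequences. -/

section BasedExact

variable {Λ : Type u} [Ring Λ] {Z : AddSubgroup (RedK1 Λ)}

/-- Isomorphisms of the middle and right terms of based exact sequences induce a simple
isomorphism of the left terms. -/
theorem BasedExact.exists_left {A B C A' B' C' : BasedModule Λ} {i : A →ₗ[Λ] B} {p : B →ₗ[Λ] C}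
    {i' : A' →ₗ[Λ] B'} {p' : B' →ₗ[Λ] C'} (h : BasedExact Z A B C i p)
    (h' : BasedExact Z A' B' C' i' p') {β : B ≃ₗ[Λ] B'} (hβ : BasedModule.IsSimple Z B B' β)
    {γ : C ≃ₗ[Λ] C'} (hγ : BasedModule.IsSimple Z C C' γ) (hp : ∀ x, p' (β x) = γ (p x)) :
    ∃ α : A ≃ₗ[Λ] A', BasedModule.IsSimple Z A A' α ∧ ∀ a, i' (α a) = β (i a) := by
  obtain ⟨e, he, h1, h2⟩ := h
  obtain ⟨e', he', h1', h2'⟩ := h'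
  let E₀ : (A × C') ≃ₗ[Λ] B' := (((LinearEquiv.refl Λ A).prodCongr γ.symm).trans e).trans β
  have hE₀ : BasedModule.IsSimple Z (A.prod C') B' E₀ :=
    (((BasedModule.IsSimple.refl A).prod hγ.symm).trans he).trans hβ
  have hp₀ (x) : p' (E₀ x) = x.2 := by
    change p' (β (e (x.1, γ.symm x.2))) = _
    rw [hp, h2, LinearEquiv.apply_symm_apply]
  -- Transported to the two splittings, β is compatible with the projections to C', hence triangular
  -- with the identity on C'. Its diagonal entry α is therefore invertible, and simple by
  -- `IsSimple.of_triangular`.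
  let E : (A × C') ≃ₗ[Λ] (A' × C') := E₀.trans e'.symm
  have hE (x) : (E x).2 = x.2 := by
    rw [← hp₀ x, ← h2' (E x).1 (E x).2]
    change p' (e' (e'.symm (E₀ x))) = _
    rw [LinearEquiv.apply_symm_apply]
  have hE' (x) : (E.symm x).2 = x.2 := by
    rw [← hE, LinearEquiv.apply_symm_apply]
  let α : A ≃ₗ[Λ] A' :=
    { toFun := fun a => (E (a, 0)).1
      invFun := fun a => (E.symm (a, 0)).1
      map_add' := fun a b => by
        rw [← Prod.fst_add, ← map_add]; simp
      map_smul' := fun r a => by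
        rw [RingHom.id_apply, ← Prod.smul_fst, ← map_smul]; simp
      left_inv := fun a => by
        have h : ((E (a, 0)).1, (0 : C')) = E (a, 0) := Prod.ext rfl (hE (a, 0)).symm
        beta_reduce
        rw [h, LinearEquiv.symm_apply_apply]
      right_inv := fun a => by
        have h : ((E.symm (a, 0)).1, (0 : C')) = E.symm (a, 0) := Prod.ext rfl (hE' (a, 0)).symm
        beta_reduce
        rw [h, LinearEquiv.apply_symm_apply] }
  have hα (a) : E (a, 0) = (α a, 0) := Prod.ext rfl (hE _)
  refine ⟨α, BasedModule.IsSimple.of_triangular (f := α)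
    (g := (LinearMap.fst Λ _ _).comp (E.toLinearMap.comp (LinearMap.inr Λ _ _))) hE₀ he'
    fun a c => ?_, fun a => ?_⟩
  · rw [← LinearEquiv.symm_apply_eq]
    change E (a, c) = ((E (a, 0)).1 + (E (0, c)).1, c)
    refine Prod.ext ?_ (hE _)
    change _ = ((E (a, 0)) + (E (0, c))).1
    rw [← map_add]; simp
  · rw [← h1', ← hα]
    change e' (e'.symm (E₀ (a, 0))) = _
    rw [LinearEquiv.apply_symm_apply]
    change β (e (a, γ.symm 0)) = _
    rw [map_zero, h1]

end BasedExact

variable {Λ : Type u} [Ring Λ] [StarRing Λ] {ε : ℤˣ} {Z : AddSubgroup (RedK1 Λ)}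

/-! ### Based annihilators and the well-definedness of b. -/

namespace QuasiFormation

theorem exists_section (x : QuasiFormation Z ε) :
    ∃ σ : SDual Λ x.V →ₗ[Λ] x.form.X, ∀ f, x.form.restr x.j (σ f) = f := by
  obtain ⟨r, hr⟩ := x.summand
  obtain ⟨e, he, -⟩ := x.simple
  -- A functional on V is extended to M along the retraction r and then represented by an element of
  -- M, since φ is invertible.
  refine ⟨e.symm.toLinearMap.comp (SDual.map r), fun f => SDual.ext fun y => ?_⟩
  rw [QForm.restr_apply]
  change x.form.sym (e.symm (SDual.map r f)) (x.j y) = _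
  rw [← he, LinearEquiv.apply_symm_apply, SDual.map_apply, hr]

/-- The section splits M as Ker(j*φ) ⊕ V*, and the kernel takes the complementary based structure.
-/
theorem exists_isPerp (x : QuasiFormation Z ε) : ∃ W k, x.IsPerp W k := by
  obtain ⟨σ, hσ⟩ := x.exists_section
  let p := x.form.restr x.j
  let E : (LinearMap.ker p × x.V.dual) ≃ₗ[Λ] x.form.X :=
    { toFun := fun a => a.1 + σ a.2
      invFun := fun m => (⟨m - σ (p m), by
        rw [LinearMap.mem_ker, map_sub, sub_eq_zero]; exact (hσ _).symm⟩, p m)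
      map_add' := fun a b => by
        change ((a.1 : x.form.X) + b.1) + σ (a.2 + b.2) = _
        rw [map_add]; abel
      map_smul' := fun r a => by
        change r • (a.1 : x.form.X) + σ (r • a.2) = r • (a.1 + σ a.2)
        rw [map_smul, smul_add]
      left_inv := fun a => by
        have h : p (a.1 + σ a.2) = a.2 := by
          rw [map_add, LinearMap.mem_ker.1 a.1.2, zero_add]; exact hσ _
        refine Prod.ext (Subtype.ext ?_) h
        change (a.1 + σ a.2) - σ (p (a.1 + σ a.2)) = a.1
        rw [h]; abel
      right_inv := fun m => by
        change m - σ (p m) + σ (p m) = m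
        abel }
  refine ⟨BasedModule.complement E, (LinearMap.ker p).subtype, E, .complement E, fun a => ?_,
    fun a c => ?_⟩
  · change (a : x.form.X) + σ 0 = a
    rw [map_zero, add_zero]
  · change p (a.1 + σ c) = c
    rw [map_add, LinearMap.mem_ker.1 a.2, zero_add]; exact hσ _

/-- Serves two purposes: with f and g the identity it shows independence of the choice of based
annihilator, and with f an isomorphism of quasi-formations it gives invariance. -/
theorem IsPerp.isometric {x y : QuasiFormation Z ε} {W W' : BasedModule Λ}
    {k : W →ₗ[Λ] x.form.X} {k' : W' →ₗ[Λ] y.form.X} (h : x.IsPerp W k) (h' : y.IsPerp W' k')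
    {f : x.form.X ≃ₗ[Λ] y.form.X} (hf : BasedModule.IsSimple Z x.form.X y.form.X f)
    (hψ : QEps.pull f.toLinearMap y.form.ψ = x.form.ψ) {g : x.V.dual ≃ₗ[Λ] y.V.dual}
    (hg : BasedModule.IsSimple Z x.V.dual y.V.dual g)
    (hp : ∀ m, y.form.restr y.j (f m) = g (x.form.restr x.j m)) :
    QForm.Isometric Z (x.formPerp W k) (y.formPerp W' k') := by
  obtain ⟨α, hα, hk⟩ := h.exists_left h' hf hg hp
  refine ⟨α, hα, ?_⟩
  change QEps.pull α.toLinearMap (-QEps.pull k' y.form.ψ) = -QEps.pull k x.form.ψ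
  rw [map_neg, QEps.pull_pull, ← hψ, QEps.pull_pull]
  congr 3
  exact LinearMap.ext hk

/-- The pair `([V, θ], [V^⊥, -θ^⊥])`. -/
def boundaryForms (x : QuasiFormation Z ε) : ZeroStabForms Z ε × ZeroStabForms Z ε :=
  (ZeroStabForms.mk Z x.formV, ZeroStabForms.mk Z
    (x.formPerp x.exists_isPerp.choose x.exists_isPerp.choose_spec.choose))

theorem IsPerp.boundaryForms_eq {x : QuasiFormation Z ε} {W : BasedModule Λ}
    {k : W →ₗ[Λ] x.form.X} (h : x.IsPerp W k) :
    x.boundaryForms = (ZeroStabForms.mk Z x.formV, ZeroStabForms.mk Z (x.formPerp W k)) :=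
  Prod.ext rfl (Quotient.sound (.of_isometric
    (IsPerp.isometric (x := x) (y := x) x.exists_isPerp.choose_spec.choose_spec h (.refl _)
      (QEps.pull_id _) (.refl _) fun _ => rfl)))

theorem boundaryForms_prod (x y : QuasiFormation Z ε) :
    (x.prod y).boundaryForms = x.boundaryForms + y.boundaryForms := by
  obtain ⟨W, k, h⟩ := x.exists_isPerp
  obtain ⟨W', k', h'⟩ := y.exists_isPerp
  have h1 : (x.prod y).IsPerp (W.prod W') (k.prodMap k') :=
    BasedExact.congr_right (C' := (x.V.prod y.V).dual) (h.prod h') (SDual.prodEquiv x.V y.V).symm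
      (BasedModule.IsSimple.dualProd x.V y.V).symm
        fun p => QForm.prod_restr x.form y.form x.j y.j p
  rw [h1.boundaryForms_eq, h.boundaryForms_eq, h'.boundaryForms_eq]
  refine Prod.ext (Quotient.sound (.of_isometric (.of_eq ?_)))
    (Quotient.sound (.of_isometric (.of_eq ?_)))
  · exact QEps.pull_prodCongr x.j y.j x.form.ψ y.form.ψ
  · exact (congrArg Neg.neg (QEps.pull_prodCongr k k' x.form.ψ y.form.ψ)).trans
      (QEps.neg_prod _ _)

/-- Adding the zero module to one side and P to the other leaves two orderings of the same sum of
zero forms. -/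
theorem _root_.SurgeryMonoid.ZeroStabForms.mk_eq_zero (P : BasedModule Λ)
    {ψ : QEps (Λ := Λ) ε P} (h : ψ = 0) : ZeroStabForms.mk Z (⟨P, ψ⟩ : QForm Λ ε) = 0 := by
  subst h
  exact Quotient.sound ⟨BasedModule.zero Λ, P, .prodComm _ _⟩

/-- Since V^⊥ equals V, its inclusion k factors through j; hence ψ vanishes on it as well. The based
structures play no role, because every zero form represents 0. -/
theorem IsFormation.boundaryForms_eq_zero {x : QuasiFormation Z ε} (h : x.IsFormation) :
    x.boundaryForms = 0 := by
  obtain ⟨W, k, hk⟩ := x.exists_isPerp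
  obtain ⟨⟨r, hr⟩, h1, h2⟩ := h
  rw [hk.boundaryForms_eq]
  refine Prod.ext (ZeroStabForms.mk_eq_zero _ h2) (ZeroStabForms.mk_eq_zero _ ?_)
  have h3 : k = x.j.comp (r.comp k) := LinearMap.ext fun w => by
    have h4 : k w ∈ LinearMap.range x.j := by
      rw [h1, ← hk.range_eq.2]; exact ⟨w, rfl⟩
    obtain ⟨v, hv⟩ := h4
    change k w = x.j (r (k w))
    rw [← hv, hr]
  rw [h3, ← QEps.pull_pull, h2, map_zero, neg_zero]

theorem ofLagrangian_isFormation (x : QuasiFormation Z ε) (K : BasedModule Λ)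
    (k : K →ₗ[Λ] x.form.X) (hk : x.form.IsSimpleLagrangian Z K k) :
    (x.ofLagrangian K k hk).IsFormation := x.lag.1

/-- The isomorphism `(x, f) ↦ (f, ε x)` from `P ⊕ P*` to `P* ⊕ P**`. -/
def flip (ε : ℤˣ) (P : BasedModule Λ) : (P × SDual Λ P) ≃ₗ[Λ] (SDual Λ P × SDual Λ (SDual Λ P)) :=
  (LinearEquiv.prodComm Λ _ _).trans ((LinearEquiv.refl Λ _).prodCongr
    ((BasedModule.evalEquiv P).trans (BasedModule.signEquiv ε _)))

theorem flip_simple (P : BasedModule Λ) :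
    BasedModule.IsSimple Z (P.prod P.dual) (P.dual.prod P.dual.dual) (flip ε P) :=
  (BasedModule.IsSimple.prodComm P P.dual).trans ((BasedModule.IsSimple.refl P.dual).prod
    ((BasedModule.IsSimple.eval P).trans (.sign ε P.dual.dual)))

/-- The pulled-back form is the T_ε-dual of the standard hyperbolic one, so the two agree only as
classes in Q_ε. -/
theorem flip_pull (P : BasedModule Λ) :
    QEps.pull (flip ε P).toLinearMap (QForm.hyp ε P.dual).ψ = (QForm.hyp ε P).ψ := by
  refine Eq.trans ?_ (QEps.mk_dualityInvolution _)
  refine (QEps.pull_mk _ _).trans (congrArg (QEps.mk ε) ?_)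
  refine LinearMap.ext fun x => SDual.ext fun y => ?_
  change ((ε : ℤ) • SDual.eval P x.1 : SDual Λ (SDual Λ P)) y.2 = (ε : ℤ) • star (y.2 x.1)
  rw [SDual.zsmul_apply, SDual.eval_apply]

/-- The dual summand `P*` is a simple Lagrangian of `H_ε(P)`. -/
theorem dual_lagrangian (P : BasedModule Λ) :
    (QForm.hyp ε P).IsSimpleLagrangian Z P.dual (LinearMap.inr Λ P (SDual Λ P)) := by
  have hr (p : P × SDual Λ P) : (QForm.hyp ε P).restr (LinearMap.inr Λ P (SDual Λ P)) p =
      (ε : ℤ) • SDual.eval P p.1 := SDual.ext fun g => by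
    rw [QForm.restr_apply, QForm.hyp_sym, SDual.zsmul_apply, SDual.eval_apply]
    simp
  refine ⟨⟨⟨LinearMap.snd Λ P (SDual Λ P), fun _ => rfl⟩, ?_, ?_⟩,
    ⟨(flip ε P).symm, (flip_simple P).symm, fun a => ?_, fun a c => ?_⟩⟩
  · refine Submodule.ext fun p => ?_
    rw [QForm.perp, LinearMap.mem_ker, hr]
    constructor
    · rintro ⟨a, rfl⟩
      exact (congrArg _ (map_zero _)).trans (smul_zero _)
    · intro h
      refine ⟨p.2, Prod.ext (((BasedModule.evalEquiv P).trans
        (BasedModule.signEquiv ε _)).injective ?_) rfl⟩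
      exact (map_zero _).trans h.symm
  · refine (QEps.pull_mk _ _).trans ((congrArg (QEps.mk ε) ?_).trans (map_zero _))
    refine LinearMap.ext fun x => SDual.ext fun y => ?_
    exact map_zero x
  · rw [LinearEquiv.symm_apply_eq]
    exact Prod.ext rfl (map_zero ((BasedModule.evalEquiv P).trans (BasedModule.signEquiv ε _))).symm
  · obtain ⟨q, hq⟩ := (flip ε P).surjective (a, c)
    rw [← hq, LinearEquiv.symm_apply_apply, hr]
    exact congrArg Prod.snd hq

theorem trivial_isFormation (P : BasedModule Λ) : (trivial Z ε P).IsFormation :=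
  (dual_lagrangian (Z := Z) P).1

/-- Neither V nor its annihilator refers to the chosen Lagrangian. -/
theorem boundaryForms_replaceLagrangian (x : QuasiFormation Z ε) (K : BasedModule Λ)
    (k : K →ₗ[Λ] x.form.X) (hk : x.form.IsSimpleLagrangian Z K k) :
    (x.replaceLagrangian K k hk).boundaryForms = x.boundaryForms := by
  obtain ⟨W, l, h⟩ := x.exists_isPerp
  have h' : (x.replaceLagrangian K k hk).IsPerp W l := h
  rw [h.boundaryForms_eq, h'.boundaryForms_eq]
  rfl

/-- The isomorphism h of the half-rank summands gives the first coordinate. For the second, its dual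
must be simple, in order to compare the two sequences that base the annihilators. -/
theorem Iso.boundaryForms_eq (hZ : ∀ z ∈ Z, RedK1.conj z ∈ Z) {x y : QuasiFormation Z ε}
    (h : x.Iso y) : x.boundaryForms = y.boundaryForms := by
  obtain ⟨f, hf, hψ, -, h, hh, hj⟩ := h
  obtain ⟨W, k, hx⟩ := x.exists_isPerp
  obtain ⟨W', k', hy⟩ := y.exists_isPerp
  rw [hx.boundaryForms_eq, hy.boundaryForms_eq]
  refine Prod.ext (Quotient.sound (.of_isometric ⟨h, hh, ?_⟩))
    (Quotient.sound (.of_isometric (hx.isometric hy hf hψ (hh.dual hZ) fun m => ?_)))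
  · change QEps.pull h.toLinearMap (QEps.pull y.j y.form.ψ) = QEps.pull x.j x.form.ψ
    rw [QEps.pull_pull, ← hψ, QEps.pull_pull]
    congr 2
    exact LinearMap.ext fun a => (hj a).symm
  · refine SDual.ext fun v => ?_
    obtain ⟨v, rfl⟩ := h.surjective v
    rw [QForm.restr_apply, ← hj]
    change _ = x.form.restr x.j m (h.symm (h v))
    rw [LinearEquiv.symm_apply_apply, QForm.restr_apply]
    change QEps.sym ε y.form.ψ (f m) (f (x.j v)) = QEps.sym ε x.form.ψ m (x.j v)
    rw [← hψ, QEps.sym_pull]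
    rfl

/-- Trivial formations and the summand (M, ψ; K, L) of the shift relation are formations, so they
contribute 0; the Lagrangian of the other summand is irrelevant. -/
theorem Rel.boundaryForms_eq (hZ : ∀ z ∈ Z, RedK1.conj z ∈ Z) {x y : QuasiFormation Z ε}
    (h : Rel x y) : x.boundaryForms = y.boundaryForms := by
  induction h with
  | iso h => exact h.boundaryForms_eq hZ
  | stab x P =>
    rw [boundaryForms_prod, (trivial_isFormation P).boundaryForms_eq_zero, add_zero]
  | shift x K k hk =>
    rw [boundaryForms_prod, (ofLagrangian_isFormation x K k hk).boundaryForms_eq_zero, zero_add,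
      boundaryForms_replaceLagrangian]
  | add _ _ h h' => rw [boundaryForms_prod, boundaryForms_prod, h, h']
  | symm _ h => exact h.symm
  | trans _ _ h h' => exact h.trans h'

end QuasiFormation

/-- The homomorphism `b : [M, ψ; L, V] ↦ ([V, θ], [V^⊥, -θ^⊥])`. -/
def LMonoid.boundaryHom (hZ : ∀ z ∈ Z, RedK1.conj z ∈ Z) :
    LMonoid Z ε →+ ZeroStabForms Z ε × ZeroStabForms Z ε where
  toFun := Quotient.lift QuasiFormation.boundaryForms fun _ _ h =>
    QuasiFormation.Rel.boundaryForms_eq hZ h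
  map_zero' := (QuasiFormation.trivial_isFormation _).boundaryForms_eq_zero
  map_add' := by
    rintro ⟨x⟩ ⟨y⟩
    exact QuasiFormation.boundaryForms_prod x y

theorem LMonoid.boundaryHom_mk (hZ : ∀ z ∈ Z, RedK1.conj z ∈ Z) (x : QuasiFormation Z ε) :
    boundaryHom hZ (mk x) = x.boundaryForms := rfl

end

section

/-! ### Composition and stabilisation of based epimorphisms. -/

section BasedExact

variable {Λ : Type u} [Ring Λ] {Z : AddSubgroup (RedK1 Λ)}

/-- The composite of two based epimorphisms. -/
theorem BasedExact.comp {A B C A' D : BasedModule Λ} {i : A →ₗ[Λ] B} {p : B →ₗ[Λ] C}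
    {i' : A' →ₗ[Λ] C} {p' : C →ₗ[Λ] D} (h : BasedExact Z A B C i p)
    (h' : BasedExact Z A' C D i' p') (l : A' →ₗ[Λ] B) (hl : ∀ a, p (l a) = i' a) :
    BasedExact Z (A.prod A') B D (i.coprod l) (p'.comp p) := by
  obtain ⟨e, he, h1, h2⟩ := h
  obtain ⟨e', he', h1', h2'⟩ := h'
  -- The lift l need not agree with the chosen splitting e; s is the A-component of l, so l a' = e(s
  -- a', i' a'). The shear of s absorbs the discrepancy without torsion.
  let s : A' →ₗ[Λ] A := (LinearMap.fst Λ _ _).comp (e.symm.toLinearMap.comp l)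
  have hs (a') : e (s a', i' a') = l a' := by
    obtain ⟨q, hq⟩ := e.surjective (l a')
    have h3 : i' a' = q.2 := by rw [← hl, ← hq]; exact h2 q.1 q.2
    rw [h3]
    change e ((e.symm (l a')).1, q.2) = _
    rw [← hq, LinearEquiv.symm_apply_apply]
  refine ⟨(((shear s).prodCongr (LinearEquiv.refl Λ D)).trans (LinearEquiv.prodAssoc Λ A A' D)).trans
    (((LinearEquiv.refl Λ A).prodCongr e').trans e),
    (((BasedModule.IsSimple.shear A A' s).prod (.refl D)).trans (.prodAssoc A A' D)).trans
      (((BasedModule.IsSimple.refl A).prod he').trans he), fun a => ?_, fun a d => ?_⟩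
  · change e (a.1 + s a.2, e' (a.2, 0)) = i a.1 + l a.2
    rw [h1', ← hs, ← h1, ← map_add]
    congr 1
    exact Prod.ext rfl (zero_add _).symm
  · change p' (p (e (a.1 + s a.2, e' (a.2, d)))) = d
    rw [h2, h2']

theorem BasedExact.prod_equiv {A B C H H' : BasedModule Λ} {i : A →ₗ[Λ] B} {p : B →ₗ[Λ] C}
    (h : BasedExact Z A B C i p) {g : H ≃ₗ[Λ] H'} (hg : BasedModule.IsSimple Z H H' g) :
    BasedExact Z A (B.prod H) (C.prod H') ((LinearMap.inl Λ B H).comp i)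
      (p.prodMap g.toLinearMap) := by
  obtain ⟨e, he, h1, h2⟩ := h
  refine ⟨((LinearEquiv.prodAssoc Λ A C H').symm).trans (e.prodCongr g.symm),
    (BasedModule.IsSimple.prodAssoc A C H').symm.trans (he.prod hg.symm), fun a => ?_,
    fun a c => ?_⟩
  · exact Prod.ext (h1 a) (map_zero g.symm)
  · exact Prod.ext (h2 a c.1) (LinearEquiv.apply_symm_apply g c.2)

theorem BasedExact.apply_apply {A B C : BasedModule Λ} {i : A →ₗ[Λ] B} {p : B →ₗ[Λ] C}
    (h : BasedExact Z A B C i p) (a : A) : p (i a) = 0 := by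
  obtain ⟨e, -, h1, h2⟩ := h
  rw [← h1, h2]

end BasedExact

variable {Λ : Type u} [Ring Λ] [StarRing Λ] {ε : ℤˣ} {Z : AddSubgroup (RedK1 Λ)}

/-! ### The image of b: stable equality of the two forms. -/

namespace ZeroStabForms

theorem mk_eq {v w : QForm Λ ε} (h : QForm.Isometric Z v w) : mk Z v = mk Z w :=
  Quotient.sound (.of_isometric h)

theorem mk_prod (v w : QForm Λ ε) : mk Z (v.prod w) = mk Z v + mk Z w := rfl

theorem mk_prod_zeroForm (v : QForm Λ ε) (P : BasedModule Λ) :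
    mk Z (v.prod (QForm.zeroForm ε P)) = mk Z v := by
  rw [mk_prod, mk_eq_zero P rfl, add_zero]

/-- Turns H(K) into a free hyperbolic form. The parameter k lets two based modules be stabilised by
free modules of the same size. -/
theorem mk_hyp_add_free (hZ : ∀ z ∈ Z, RedK1.conj z ∈ Z) (K : BasedModule Λ) (k : ℕ) :
    mk Z (QForm.hyp ε K) + mk Z (QForm.hyp ε (BasedModule.free Λ (K.m + k))) =
      mk Z (QForm.hyp ε (BasedModule.free Λ (K.n + k))) := by
  obtain ⟨f, hf⟩ := BasedModule.exists_free_simple (Z := Z) K k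
  rw [← mk_prod]
  exact mk_eq ((QForm.Isometric.hyp_prod _ _).trans (.hyp_congr hZ hf))

end ZeroStabForms

namespace QuasiFormation

/-- `H_ε(V) ⊕ (V^⊥, -θ^⊥)` and `H_ε(L) ⊕ (V, θ)` are isometric. -/
theorem IsPerp.isometric_prod {x : QuasiFormation Z ε} {W : BasedModule Λ}
    {k : W →ₗ[Λ] x.form.X} (h : x.IsPerp W k) :
    QForm.Isometric Z ((QForm.hyp ε x.V).prod (x.formPerp W k))
      ((QForm.hyp ε x.L).prod x.formV) := by
  obtain ⟨e, he, h1, h2⟩ := h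
  have hk (w : W) : x.form.restr x.j (k w) = 0 := by rw [← h1]; exact h2 w 0
  let v : QForm Λ ε := x.form.prod x.formV.neg
  -- The diagonal copy of V is isotropic because θ and -θ cancel. Pairing with it is j*φ on M ⊕ 0,
  -- so a section of j*φ and the annihilator V^⊥, both placed in M ⊕ 0, supply the remaining data.
  let i : x.V →ₗ[Λ] v.X := x.j.prod LinearMap.id
  let k' : W →ₗ[Λ] v.X := (LinearMap.inl Λ x.form.X x.V).comp k
  let σ : SDual Λ x.V →ₗ[Λ] v.X :=
    (LinearMap.inl Λ x.form.X x.V).comp (e.toLinearMap.comp (LinearMap.inr Λ W x.V.dual))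
  have hi : QEps.pull i v.ψ = 0 := by
    refine (QEps.pull_prod i x.form.ψ x.formV.neg.ψ).trans ?_
    change QEps.pull x.j x.form.ψ + QEps.pull LinearMap.id (-QEps.pull x.j x.form.ψ) = 0
    rw [QEps.pull_id, add_neg_cancel]
  have hres (m : x.form.X) : v.restr i ((m, 0) : x.form.X × x.V) = x.form.restr x.j m :=
    SDual.ext fun y => by
      refine (QForm.prod_sym x.form x.formV.neg _ _).trans ?_
      exact (congrArg (fun f : SDual Λ x.V => x.form.sym m (x.j y) + f y)
        (map_zero x.formV.neg.sym)).trans (add_zero _)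
  let T : ((x.V × SDual Λ x.V) × W) ≃ₗ[Λ] (x.form.X × x.V) :=
    ((LinearEquiv.prodAssoc Λ x.V (SDual Λ x.V) W).trans (LinearEquiv.prodComm Λ _ _)).trans
      ((((LinearEquiv.prodComm Λ _ _).trans e).prodCongr (LinearEquiv.refl Λ x.V)).trans
        (shear x.j))
  have hT : BasedModule.IsSimple Z ((x.V.prod x.V.dual).prod W) (x.form.X.prod x.V) T :=
    ((BasedModule.IsSimple.prodAssoc x.V x.V.dual W).trans (.prodComm _ _)).trans
      ((((BasedModule.IsSimple.prodComm x.V.dual W).trans he).prod (.refl x.V)).trans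
        (.shear x.form.X x.V x.j))
  have h3 := QForm.Isometric.of_isotropic (v := v) (i := i) (k := k') (σ := σ) hi
    (fun w => (hres _).trans (hk w)) (fun f => (hres _).trans (h2 0 f)) hT fun y f w => by
      change (e (w, f) + x.j y, y) = ((x.j y + e (0, f)) + k w, y + 0 + 0)
      have h4 : e (w, f) = e (w, 0) + e (0, f) := by rw [← map_add]; simp
      rw [h4, h1, add_zero, add_zero]
      congr 1
      abel
  have h5 : QEps.pull k' v.ψ = QEps.pull k x.form.ψ := by
    refine (QEps.pull_prod k' x.form.ψ x.formV.neg.ψ).trans ?_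
    have h6 : (LinearMap.snd Λ x.form.X x.V).comp k' = 0 := rfl
    have h7 : (LinearMap.fst Λ x.form.X x.V).comp k' = k := rfl
    change QEps.pull ((LinearMap.fst Λ x.form.X x.V).comp k') x.form.ψ +
      QEps.pull ((LinearMap.snd Λ x.form.X x.V).comp k') (-QEps.pull x.j x.form.ψ) = _
    rw [h6, h7, QEps.pull_zero, add_zero]
  rw [h5] at h3
  have h8 : QForm.Isometric Z x.formV.neg.neg x.formV := .of_eq (neg_neg _)
  have h9 : QForm.Isometric Z x.form.neg (QForm.hyp ε x.L) :=
    x.lag.isometric.symm.neg.trans (.hyp_neg _)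
  -- The splitting reads H(V) ⊕ (V^⊥, θ^⊥) ≅ (M, ψ) ⊕ (V, -θ). All signs are reversed, using that
  -- H(V) and H(L) ≅ (M, ψ) are isometric to their negatives.
  exact (((QForm.Isometric.hyp_neg x.V).symm.prod (.refl _)).trans
    ((QForm.Isometric.neg_prod _ _).symm.trans h3.neg)).trans
      ((QForm.Isometric.neg_prod _ _).trans (h9.prod h8))

theorem exists_boundaryForms_add_eq (hZ : ∀ z ∈ Z, RedK1.conj z ∈ Z) (x : QuasiFormation Z ε) :
    ∃ r : ℕ, x.boundaryForms.1 + ZeroStabForms.mk Z (QForm.hyp ε (BasedModule.free Λ r)) =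
      x.boundaryForms.2 + ZeroStabForms.mk Z (QForm.hyp ε (BasedModule.free Λ r)) := by
  obtain ⟨W, k, h⟩ := x.exists_isPerp
  rw [h.boundaryForms_eq]
  have h1 := ZeroStabForms.mk_eq h.isometric_prod
  rw [ZeroStabForms.mk_prod, ZeroStabForms.mk_prod] at h1
  -- Both L and V have half the rank of M. This equality makes H(V) and H(L) stabilise, by the same
  -- H(Λ^{m(V)+m(L)}), to one and the same free hyperbolic form.
  have hr : x.V.n + x.L.m = x.L.n + x.V.m := by
    have h2 := x.lag.rank_eq
    have h3 := x.half
    simp only [BasedModule.rank] at h2 h3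
    omega
  have hV := ZeroStabForms.mk_hyp_add_free (ε := ε) hZ x.V x.L.m
  have hL := ZeroStabForms.mk_hyp_add_free (ε := ε) hZ x.L x.V.m
  rw [add_comm x.L.m, ← hr] at hL
  refine ⟨x.V.n + x.L.m, ?_⟩
  dsimp only
  conv_lhs => rw [← hL, ← add_assoc, add_comm (ZeroStabForms.mk Z x.formV), ← h1]
  rw [← hV]
  abel

/-- `V^⊥` for a boundary `δ(K, ρ)` is the graph of `-T_ε ρ`. -/
theorem boundary_isPerp (K : BasedModule Λ) (ρ : K →ₗ[Λ] SDual Λ K) :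
    (boundary Z ε K ρ).IsPerp K (LinearMap.prod LinearMap.id (-dualityInvolution ε K ρ)) := by
  let g : K →ₗ[Λ] K.dual := -dualityInvolution ε K ρ
  refine ⟨((LinearEquiv.prodComm Λ K K.dual).trans (shear g)).trans
    (LinearEquiv.prodComm Λ K.dual K), ((BasedModule.IsSimple.prodComm K K.dual).trans
      (.shear K.dual K g)).trans (.prodComm K.dual K), fun a => ?_, fun a (c : SDual Λ K) => ?_⟩
  · exact Prod.ext rfl (zero_add _)
  · refine SDual.ext fun (y : K) => ?_
    change (c + g a) y + (ε : ℤ) • star (ρ y a) = c y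
    change c y + -((ε : ℤ) • star (ρ y a)) + (ε : ℤ) • star (ρ y a) = c y
    abel

/-- On the graph of -T_ε ρ the hyperbolic form is -T_ε ρ, which has the class of -ρ. The sign in the
second coordinate of b then makes boundaries diagonal. -/
theorem boundary_formPerp (K : BasedModule Λ) (ρ : K →ₗ[Λ] SDual Λ K) :
    QEps.pull (LinearMap.prod LinearMap.id (-dualityInvolution ε K ρ)) (QForm.hyp ε K).ψ =
      -QEps.mk ε ρ := by
  rw [← QEps.mk_dualityInvolution ρ]
  exact (QEps.pull_mk _ _).trans (map_neg (QEps.mk ε) (dualityInvolution ε K ρ))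

theorem boundaryForms_boundary (K : BasedModule Λ) (ρ : K →ₗ[Λ] SDual Λ K) :
    (boundary Z ε K ρ).boundaryForms =
      (ZeroStabForms.mk Z ⟨K, QEps.mk ε ρ⟩, ZeroStabForms.mk Z ⟨K, QEps.mk ε ρ⟩) := by
  rw [(boundary_isPerp K ρ).boundaryForms_eq]
  refine Prod.ext rfl (ZeroStabForms.mk_eq (.of_eq ?_))
  exact (congrArg Neg.neg (boundary_formPerp K ρ)).trans (neg_neg _)

end QuasiFormation

end

/-! ### The image of b: realisation of stably equal forms. -/

section

variable {Λ : Type u} [Ring Λ] [StarRing Λ] {ε : ℤˣ} {Z : AddSubgroup (RedK1 Λ)}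

namespace QForm

theorem pull_inl_hyp (R : BasedModule Λ) :
    QEps.pull (LinearMap.inl Λ R (SDual Λ R)) (hyp ε R).ψ = 0 :=
  (hyp_lagrangian (Z := ⊤) R).1.2.2

/-- `R → (v ⊕ H_ε(R))* → (v ⊕ R)*` is based, where the first map is given by the form. -/
theorem exact_restrict_hyp (v : QForm Λ ε) (R : BasedModule Λ) :
    BasedExact Z R (v.X.prod (R.prod R.dual)).dual (v.X.prod R).dual
      ((v.prod (hyp ε R)).sym.comp
        ((LinearMap.inr Λ v.X (R × SDual Λ R)).comp (LinearMap.inl Λ R (SDual Λ R))))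
      (SDual.map ((LinearMap.id : v.X →ₗ[Λ] v.X).prodMap (LinearMap.inl Λ R (SDual Λ R)))) := by
  obtain ⟨g, hg, hgs⟩ := hyp_simple (Z := Z) (ε := ε) R
  have hg' (a : R) (f : SDual Λ R) (r : R × SDual Λ R) :
      g (a, f) r = f r.1 + (ε : ℤ) • star (r.2 a) := by
    rw [hg]; exact hyp_sym R (a, f) r
  -- A functional on v ⊕ R is extended by zero over R*; the functionals vanishing on v ⊕ R are the
  -- φ-duals of R. The map s only reorders the summands for this splitting.
  let s : (R × (SDual Λ v.X × SDual Λ R)) ≃ₗ[Λ] (SDual Λ v.X × (R × SDual Λ R)) :=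
    (LinearEquiv.prodAssoc Λ _ _ _).symm.trans
      (((LinearEquiv.prodComm Λ _ _).prodCongr (LinearEquiv.refl Λ _)).trans
        (LinearEquiv.prodAssoc Λ _ _ _))
  have hs : BasedModule.IsSimple Z (R.prod (v.X.dual.prod R.dual)) (v.X.dual.prod (R.prod R.dual))
      s := (BasedModule.IsSimple.prodAssoc R v.X.dual R.dual).symm.trans
    (((BasedModule.IsSimple.prodComm R v.X.dual).prod (.refl R.dual)).trans
      (.prodAssoc v.X.dual R R.dual))
  refine ⟨(((LinearEquiv.refl Λ R).prodCongr (SDual.prodEquiv v.X R)).trans s).trans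
    (((LinearEquiv.refl Λ _).prodCongr g).trans (SDual.prodEquiv v.X (R × SDual Λ R)).symm),
    (((BasedModule.IsSimple.refl R).prod (.dualProd v.X R)).trans hs).trans
      (((BasedModule.IsSimple.refl v.X.dual).prod hgs).trans
        (BasedModule.IsSimple.dualProd v.X (R.prod R.dual)).symm), fun a => ?_, fun a F => ?_⟩
  · refine SDual.ext fun (z : v.X × (R × SDual Λ R)) => ?_
    refine Eq.trans ?_ (prod_sym v (hyp ε R) (0, (a, 0)) z).symm
    change (0 : SDual Λ v.X) z.1 + g (a, 0) z.2 = v.sym 0 z.1 + (hyp ε R).sym (a, 0) z.2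
    rw [hg, map_zero]
  · refine SDual.ext fun (z : v.X × R) => ?_
    change F (z.1, 0) + g (a, SDual.map (LinearMap.inr Λ v.X R) F) (z.2, 0) = F z
    rw [hg']
    change F (z.1, 0) + (F (0, z.2) + (ε : ℤ) • star ((0 : SDual Λ R) a)) = F z
    rw [SDual.zero_apply, star_zero, smul_zero, add_zero]
    refine (map_add F _ _).symm.trans (congrArg F ?_)
    simp

end QForm

namespace QuasiFormation

/-- In `H_ε(K) ⊕ w` the annihilator of `graph(ρ) ⊕ w` is the graph of `-T_ε ρ`. -/
theorem exact_graph_prod (hZ : ∀ z ∈ Z, RedK1.conj z ∈ Z) {K X : BasedModule Λ}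
    (ρ : K →ₗ[Λ] SDual Λ K) {w : QForm Λ ε} (hw : w.IsSimple Z) {A : X ≃ₗ[Λ] (K × w.X)}
    (hA : BasedModule.IsSimple Z X (K.prod w.X) A) :
    BasedExact Z K ((K.prod K.dual).prod w.X) X.dual
      ((LinearMap.inl Λ (K × SDual Λ K) w.X).comp
        (LinearMap.prod LinearMap.id (-dualityInvolution ε K ρ)))
      (((QForm.hyp ε K).prod w).restr
        (((LinearMap.prod LinearMap.id ρ).prodMap LinearMap.id).comp A.toLinearMap)) := by
  have E₁ : BasedExact Z K (K.prod K.dual) K.dual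
    (LinearMap.prod LinearMap.id (-dualityInvolution ε K ρ))
    ((QForm.hyp ε K).restr (LinearMap.prod LinearMap.id ρ)) := boundary_isPerp K ρ
  obtain ⟨g, hg, hgs⟩ := hw
  -- As w is nonsingular, the summand w contributes nothing to the annihilator; A merely
  -- reparametrises the submodule, through its dual.
  have E₂ : BasedExact Z K ((K.prod K.dual).prod w.X) (K.dual.prod w.X.dual) _ _ :=
    E₁.prod_equiv hgs
  obtain ⟨γ, hγ, hγs⟩ : ∃ γ : (SDual Λ K × SDual Λ w.X) ≃ₗ[Λ] SDual Λ X,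
      (∀ f h z, γ (f, h) z = f (A z).1 + h (A z).2) ∧
        BasedModule.IsSimple Z (K.dual.prod w.X.dual) X.dual γ :=
    ⟨(SDual.prodEquiv K w.X).symm.trans (SDual.congr A.symm), fun _ _ _ => rfl,
      (BasedModule.IsSimple.dualProd K w.X).symm.trans (hA.symm.dual hZ)⟩
  have hp (m : (K × SDual Λ K) × w.X) : ((QForm.hyp ε K).prod w).restr
      (((LinearMap.prod LinearMap.id ρ).prodMap LinearMap.id).comp A.toLinearMap) m =
        γ ((QForm.hyp ε K).restr (LinearMap.prod LinearMap.id ρ) m.1, g m.2) := by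
    refine SDual.ext fun z => ?_
    rw [hγ, hg]
    exact QForm.prod_sym (QForm.hyp ε K) w m _
  exact E₂.congr_right (C' := X.dual) γ hγs hp

/-- The half-rank summand is the image of v ⊕ R under an isometric embedding of v ⊕ H(R) in H(v') ⊕
H(R). -/
theorem exists_boundaryForms_eq (hZ : ∀ z ∈ Z, RedK1.conj z ∈ Z) {v v' : QForm Λ ε}
    {R : BasedModule Λ}
    (h : QForm.Isometric Z (v.prod (QForm.hyp ε R)) (v'.prod (QForm.hyp ε R))) :
    ∃ x : QuasiFormation Z ε, x.boundaryForms = (ZeroStabForms.mk Z v, ZeroStabForms.mk Z v') := by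
  obtain ⟨A, hA, hψ⟩ := h
  obtain ⟨ρ, hρ⟩ := QEps.mk_surjective ε v'.ψ
  let M : QForm Λ ε := (QForm.hyp ε v'.X).prod (QForm.hyp ε R)
  -- The graph of ρ carries the form ρ inside H(v'), so J, and hence its composite with A, is an
  -- isometric embedding.
  let J : (v'.X × (R × SDual Λ R)) →ₗ[Λ] M.X := (LinearMap.prod LinearMap.id ρ).prodMap LinearMap.id
  let ι : (v.X × R) →ₗ[Λ] (v.X × (R × SDual Λ R)) :=
    LinearMap.id.prodMap (LinearMap.inl Λ R (SDual Λ R))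
  let κ : R →ₗ[Λ] (v.X × (R × SDual Λ R)) :=
    (LinearMap.inr Λ v.X (R × SDual Λ R)).comp (LinearMap.inl Λ R (SDual Λ R))
  let JA : (v.X × (R × SDual Λ R)) →ₗ[Λ] M.X := J.comp A.toLinearMap
  let l : R →ₗ[Λ] M.X := JA.comp κ
  let k₀ : v'.X →ₗ[Λ] M.X := (LinearMap.inl Λ (v'.X × SDual Λ v'.X) (R × SDual Λ R)).comp
    (LinearMap.prod LinearMap.id (-dualityInvolution ε v'.X ρ))
  have hJ : QEps.pull J M.ψ = (v'.prod (QForm.hyp ε R)).ψ := by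
    refine (QEps.pull_prodCongr _ _ _ _).trans (congrArg₂ QEps.prod ?_ (QEps.pull_id _))
    exact Eq.trans rfl hρ
  have hJA : QEps.pull JA M.ψ = (v.prod (QForm.hyp ε R)).ψ := by
    rw [← hψ, ← hJ, QEps.pull_pull]
  let x : QuasiFormation Z ε :=
    { form := M
      simple := (QForm.hyp_simple v'.X).prod (QForm.hyp_simple R)
      L := v'.X.prod R
      i := (LinearMap.inl Λ v'.X (SDual Λ v'.X)).prodMap (LinearMap.inl Λ R (SDual Λ R))
      lag := (QForm.hyp_lagrangian v'.X).prod (QForm.hyp_lagrangian R)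
      V := v.X.prod R
      j := JA.comp ι
      summand := by
        refine ⟨(LinearMap.id.prodMap (LinearMap.fst Λ R (SDual Λ R))).comp
          (A.symm.toLinearMap.comp ((LinearMap.fst Λ _ _).prodMap LinearMap.id)), fun a => ?_⟩
        change ((A.symm (A (ι a))).1, (A.symm (A (ι a))).2.1) = a
        rw [LinearEquiv.symm_apply_apply]
        rfl
      half := by
        -- A being an isomorphism forces rk v = rk v', which makes v ⊕ R of half rank.
        have h1 := hA.rank_eq
        simp only [BasedModule.rank_prod, BasedModule.rank_dual, M] at h1 ⊢
        linarith }
  have E₂ : BasedExact Z v'.X M.X (v.X.prod (R.prod R.dual)).dual k₀ (M.restr JA) :=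
    exact_graph_prod hZ ρ (QForm.hyp_simple R) hA
  have hl (a : R) : M.restr JA (l a) = (v.prod (QForm.hyp ε R)).sym (κ a) := by
    refine SDual.ext fun z => ?_
    change QEps.sym ε M.ψ (JA (κ a)) (JA z) = QEps.sym ε (v.prod (QForm.hyp ε R)).ψ (κ a) z
    rw [← hJA, QEps.sym_pull]
  -- Restriction to v ⊕ R factors through restriction to v ⊕ H(R). The first kernel is the graph of
  -- -T_ε ρ, the second is R, lifted to M by l.
  have hx : x.IsPerp (v'.X.prod R) (k₀.coprod l) := E₂.comp (v.exact_restrict_hyp R) l hl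
  refine ⟨x, hx.boundaryForms_eq.trans (Prod.ext ?_ ?_)⟩
  · refine Eq.trans ?_ (ZeroStabForms.mk_prod_zeroForm v R)
    refine ZeroStabForms.mk_eq (.of_eq ?_)
    change QEps.pull (JA.comp ι) M.ψ = QEps.prod v.ψ 0
    rw [← QEps.pull_pull, hJA]
    exact (QEps.pull_prodCongr _ _ _ _).trans
      (congrArg₂ QEps.prod (QEps.pull_id _) (QForm.pull_inl_hyp R))
  · refine Eq.trans ?_ (ZeroStabForms.mk_prod_zeroForm v' R)
    refine ZeroStabForms.mk_eq (.of_eq ?_)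
    change -QEps.pull (k₀.coprod l) M.ψ = QEps.prod v'.ψ 0
    have h1 : k₀.coprod l = k₀.comp (LinearMap.fst Λ v'.X R) + l.comp (LinearMap.snd Λ v'.X R) := rfl
    have h2 : QEps.pull k₀ M.ψ = -v'.ψ := by
      rw [← hρ]
      refine (QEps.pull_prod k₀ (QForm.hyp ε v'.X).ψ (QForm.hyp ε R).ψ).trans ?_
      refine (congrArg₂ (· + ·) (boundary_formPerp v'.X ρ) (QEps.pull_zero _)).trans ?_
      exact add_zero _
    have h3 : QEps.pull l M.ψ = 0 := by
      rw [← QEps.pull_pull, hJA]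
      refine (QEps.pull_prod κ v.ψ (QForm.hyp ε R).ψ).trans ?_
      refine (congrArg₂ (· + ·) (QEps.pull_zero _) (QForm.pull_inl_hyp R)).trans ?_
      exact add_zero _
    -- The image of k₀ annihilates the whole embedded v ⊕ H(R), which contains l(R), so the two
    -- summands of V^⊥ are orthogonal.
    have h4 : QEps.cross (QEps.sym ε M.ψ) (k₀.comp (LinearMap.fst Λ v'.X R))
        (l.comp (LinearMap.snd Λ v'.X R)) = 0 := by
      refine LinearMap.ext fun p => SDual.ext fun q => ?_
      exact congrArg (fun F : SDual Λ (v.X × (R × SDual Λ R)) => F (κ q.2))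
        (E₂.apply_apply p.1)
    rw [h1, QEps.pull_add, ← QEps.pull_pull _ k₀, ← QEps.pull_pull _ l, h2, h3, h4, map_zero, map_zero,
      add_zero, add_zero, map_neg, neg_neg, QEps.prod, map_zero, add_zero]

end QuasiFormation

theorem LMonoid.range_boundaryHom (hZ : ∀ z ∈ Z, RedK1.conj z ∈ Z) :
    Set.range (LMonoid.boundaryHom (ε := ε) hZ) = {p | ∃ r : ℕ,
      p.1 + ZeroStabForms.mk Z (QForm.hyp _ (BasedModule.free Λ r)) =
        p.2 + ZeroStabForms.mk Z (QForm.hyp _ (BasedModule.free Λ r))} := by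
  refine Set.Subset.antisymm ?_ ?_
  · rintro _ ⟨⟨x⟩, rfl⟩
    exact x.exists_boundaryForms_add_eq hZ
  · rintro ⟨⟨v⟩, ⟨v'⟩⟩ ⟨r, h⟩
    obtain ⟨P, P', h⟩ := Quotient.exact h
    let H := QForm.hyp ε (BasedModule.free Λ r)
    -- Equality of classes holds only after adding (P, 0) and (P', 0); these are absorbed into v and
    -- v', which does not affect their classes.
    have sw (w : QForm Λ ε) (Q : BasedModule Λ) : QForm.Isometric Z
        ((w.prod (QForm.zeroForm ε Q)).prod H) ((w.prod H).prod (QForm.zeroForm ε Q)) :=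
      (QForm.Isometric.prodAssoc _ _ _).trans
        ((QForm.Isometric.prod (.refl w) (.prodComm _ _)).trans
          (QForm.Isometric.prodAssoc _ _ _).symm)
    obtain ⟨x, hx⟩ := QuasiFormation.exists_boundaryForms_eq hZ
      (((sw v P).trans h).trans (sw v' P').symm)
    rw [ZeroStabForms.mk_prod_zeroForm, ZeroStabForms.mk_prod_zeroForm] at hx
    exact ⟨mk x, hx⟩

end

/-! ### The fibre of b over zero. -/

section

variable {Λ : Type u} [Ring Λ] [StarRing Λ] {ε : ℤˣ} {Z : AddSubgroup (RedK1 Λ)}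

/-- An isometry of v ⊕ (P, 0) with a zero form is restricted to the first summand. -/
theorem ZeroStabForms.form_eq_zero {v : QForm Λ ε} (h : mk Z v = 0) : v.ψ = 0 := by
  obtain ⟨P, Q, e, -, he⟩ := Quotient.exact h
  have h1 : QEps.pull (LinearMap.inl Λ v.X P) (QEps.prod v.ψ 0) = v.ψ := by
    rw [QEps.pull_prod, map_zero, add_zero]
    exact QEps.pull_id _
  rw [← h1]
  refine (congrArg (QEps.pull (LinearMap.inl Λ v.X P)) he.symm).trans ?_
  refine (congrArg (fun ψ => QEps.pull (LinearMap.inl Λ v.X P) (QEps.pull e.toLinearMap ψ))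
    QEps.prod_zero_zero).trans ?_
  rw [map_zero, map_zero]

namespace QuasiFormation

theorem isFormation_of_boundaryForms_eq_zero {x : QuasiFormation Z ε}
    (h : x.boundaryForms = 0) : x.IsFormation := by
  obtain ⟨W, k, hk⟩ := x.exists_isPerp
  rw [hk.boundaryForms_eq] at h
  have hθ : QEps.pull x.j x.form.ψ = 0 := ZeroStabForms.form_eq_zero (congrArg Prod.fst h)
  have hθ' : QEps.pull k x.form.ψ = 0 :=
    neg_eq_zero.1 (ZeroStabForms.form_eq_zero (congrArg Prod.snd h))
  refine ⟨x.summand, le_antisymm ?_ fun m hm => ?_, hθ⟩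
  · rintro _ ⟨a, rfl⟩
    refine LinearMap.mem_ker.2 (SDual.ext fun b => ?_)
    refine (QEps.sym_pull x.j x.form.ψ a b).symm.trans ?_
    rw [hθ, map_zero]
    rfl
  · have hm' := hm
    rw [← hk.range_eq.2] at hm'
    obtain ⟨w₀, hw₀⟩ := hm'
    have hkw (w : W) : x.form.sym (k w) m = 0 := by
      rw [← hw₀]
      refine (QEps.sym_pull k x.form.ψ w w₀).symm.trans ?_
      rw [hθ', map_zero]
      rfl
    have hkj (w : W) (y : x.V) : x.form.sym (k w) (x.j y) = 0 :=
      congrArg (fun f : SDual Λ x.V => f y) (hk.apply_apply w)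
    obtain ⟨r, hr⟩ := x.summand
    obtain ⟨e, he, -⟩ := x.simple
    -- The projection of M along V. It suffices to show π m = 0, since then m = j(r m).
    let π : x.form.X →ₗ[Λ] x.form.X := LinearMap.id - x.j.comp r
    have hπj (y : x.V) : π (x.j y) = 0 := by
      change x.j y - x.j (r (x.j y)) = 0
      rw [hr, sub_self]
    -- The functional g ∘ π vanishes on V, hence equals φ(k w) for some w, the element k w lying in
    -- V^⊥; this pairs to 0 with m because ψ vanishes on V^⊥.
    have hg (g : SDual Λ x.form.X) : g (π m) = 0 := by
      have h1 : e.symm (SDual.map π g) ∈ x.form.perp x.j := by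
        refine LinearMap.mem_ker.2 (SDual.ext fun y => ?_)
        rw [QForm.restr_apply, ← he, LinearEquiv.apply_symm_apply, SDual.map_apply, hπj, map_zero,
          SDual.zero_apply]
      rw [← hk.range_eq.2] at h1
      obtain ⟨w, hw⟩ := h1
      have h2 := hkw w
      rwa [hw, ← he, LinearEquiv.apply_symm_apply, SDual.map_apply] at h2
    -- Functionals separate the points of a based module, because evaluation into the double dual is
    -- injective.
    have h0 : π m = 0 := (BasedModule.evalEquiv x.form.X).injective (SDual.ext fun g => by
      rw [BasedModule.evalEquiv_apply, hg, map_zero, SDual.zero_apply, star_zero])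
    exact ⟨r m, (sub_eq_zero.1 h0).symm⟩

/-! ### Elementary elements and the diagonal. -/

/-- `(H_ε(P); P*, graph(ρ))`. -/
def dualBoundary (Z : AddSubgroup (RedK1 Λ)) (ε : ℤˣ) (P : BasedModule Λ)
    (ρ : P →ₗ[Λ] SDual Λ P) : QuasiFormation Z ε :=
  (boundary Z ε P ρ).replaceLagrangian P.dual (LinearMap.inr Λ P (SDual Λ P)) (dual_lagrangian P)

theorem Iso.flip (P : BasedModule Λ) : (dualBoundary Z ε P 0).Iso (trivial Z ε P.dual) :=
  ⟨QuasiFormation.flip ε P, flip_simple P, flip_pull P,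
    ⟨LinearEquiv.refl Λ _, .refl _, fun _ => Prod.ext rfl
      (map_zero ((BasedModule.evalEquiv P).trans (BasedModule.signEquiv ε _)))⟩,
    ⟨(BasedModule.evalEquiv P).trans (BasedModule.signEquiv ε _),
      (BasedModule.IsSimple.eval P).trans (.sign ε P.dual.dual), fun _ => rfl⟩⟩

theorem Iso.dualBoundary {P : BasedModule Λ} {ρ ρ' : P →ₗ[Λ] SDual Λ P}
    (h : QEps.mk ε ρ = QEps.mk ε ρ') :
    (dualBoundary Z ε P ρ).Iso (dualBoundary Z ε P ρ') := by
  obtain ⟨χ, hχ⟩ := QEps.exists_of_mk_eq h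
  -- The shear (x, f) ↦ (x, f + (ρ' - ρ)x) carries one graph to the other and fixes P* pointwise. It
  -- changes the hyperbolic form by ρ' - ρ = χ - T_ε χ, so it is an isometry. It would in general
  -- move P, whence the choice of P* as Lagrangian.
  let g : P →ₗ[Λ] P.dual := ρ' - ρ
  refine ⟨((LinearEquiv.prodComm Λ P P.dual).trans (shear g)).trans (LinearEquiv.prodComm Λ P.dual P),
    ((BasedModule.IsSimple.prodComm P P.dual).trans (.shear P.dual P g)).trans
      (.prodComm P.dual P), ?_, ⟨LinearEquiv.refl Λ _, .refl _, fun a => Prod.ext rfl ?_⟩,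
    ⟨LinearEquiv.refl Λ _, .refl _, fun a => Prod.ext rfl ?_⟩⟩
  · refine (QEps.pull_mk _ _).trans (QEps.mk_eq (χ := QEps.pullHom (LinearMap.fst Λ _ _) χ)
      fun p q => ?_)
    refine Eq.trans ?_ (hχ p.1 q.1)
    change p.2 q.1 + (ρ' p.1 q.1 - ρ p.1 q.1) - p.2 q.1 = _
    abel
  · exact (congrArg (a + ·) (map_zero g)).trans (add_zero a)
  · exact add_sub_cancel (ρ a) (ρ' a)

theorem Iso.boundary (hZ : ∀ z ∈ Z, RedK1.conj z ∈ Z) {K K' : BasedModule Λ} {h : K ≃ₗ[Λ] K'}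
    (hs : BasedModule.IsSimple Z K K' h) (ρ : K' →ₗ[Λ] SDual Λ K') :
    (boundary Z ε K (QEps.pullHom h.toLinearMap ρ)).Iso (boundary Z ε K' ρ) :=
  ⟨h.prodCongr (SDual.congr h), hs.prod (hs.dual hZ), QForm.pull_hyp_congr h,
    ⟨h, hs, fun _ => Prod.ext rfl (map_zero (SDual.congr h))⟩,
    ⟨h, hs, fun a => Prod.ext rfl (SDual.ext fun y => by
      change ρ (h a) (h (h.symm y)) = ρ (h a) y
      rw [LinearEquiv.apply_symm_apply])⟩⟩

end QuasiFormation

namespace LMonoid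

open QuasiFormation

theorem mk_eq {x y : QuasiFormation Z ε} (h : x.Iso y) : mk x = mk y := Quotient.sound (.iso h)

theorem mk_prod (x y : QuasiFormation Z ε) : mk (x.prod y) = mk x + mk y := rfl

theorem mk_trivial (P : BasedModule Λ) : mk (trivial Z ε P) = 0 := by
  rw [← zero_add (mk (trivial Z ε P))]
  exact Quotient.sound (.stab _ P)

theorem mk_dualBoundary_zero (P : BasedModule Λ) : mk (dualBoundary Z ε P 0) = 0 :=
  (mk_eq (.flip P)).trans (mk_trivial _)

/-- The shift relation with Lagrangians P* and P differs from the claim by (H_ε(P); P*, P), which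
the flip identifies with a trivial formation. -/
theorem mk_boundary (P : BasedModule Λ) (ρ : P →ₗ[Λ] SDual Λ P) :
    mk (boundary Z ε P ρ) = mk (dualBoundary Z ε P ρ) := by
  have h1 : mk ((boundary Z ε P ρ).ofLagrangian P.dual (LinearMap.inr Λ P (SDual Λ P))
      (dual_lagrangian P)) = 0 := by
    refine Eq.trans (mk_eq ?_) (mk_dualBoundary_zero (Z := Z) (ε := ε) P)
    exact ⟨LinearEquiv.refl Λ _, .refl _, QEps.pull_id _,
      ⟨LinearEquiv.refl Λ _, .refl _, fun _ => rfl⟩, ⟨LinearEquiv.refl Λ _, .refl _, fun _ => rfl⟩⟩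
  have h2 : mk ((boundary Z ε P ρ).ofLagrangian P.dual (LinearMap.inr Λ P (SDual Λ P))
      (dual_lagrangian P)) + mk (boundary Z ε P ρ) = mk (dualBoundary Z ε P ρ) :=
    Quotient.sound (.shift _ _ _ _)
  rwa [h1, zero_add] at h2

theorem mk_boundary_zero (P : BasedModule Λ) : mk (boundary Z ε P 0) = 0 :=
  (mk_boundary P 0).trans (mk_dualBoundary_zero P)

theorem mk_boundary_congr {P : BasedModule Λ} {ρ ρ' : P →ₗ[Λ] SDual Λ P}
    (h : QEps.mk ε ρ = QEps.mk ε ρ') : mk (boundary Z ε P ρ) = mk (boundary Z ε P ρ') := by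
  rw [mk_boundary, mk_boundary, mk_eq (.dualBoundary h)]

/-- The class of `δ(K, ρ)` depends only on the `0`-stabilised form `[K, ρ]`. -/
theorem mk_boundary_eq (hZ : ∀ z ∈ Z, RedK1.conj z ∈ Z) {K K' : BasedModule Λ}
    {ρ : K →ₗ[Λ] SDual Λ K} {ρ' : K' →ₗ[Λ] SDual Λ K'}
    (h : ZeroStabForms.mk Z (⟨K, QEps.mk ε ρ⟩ : QForm Λ ε) =
      ZeroStabForms.mk Z ⟨K', QEps.mk ε ρ'⟩) :
    mk (boundary Z ε K ρ) = mk (boundary Z ε K' ρ') := by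
  let s {A : BasedModule Λ} (B : BasedModule Λ) (α : A →ₗ[Λ] SDual Λ A) :
      (A × B) →ₗ[Λ] SDual Λ (A × B) :=
    (SDual.prodEquiv A B).symm.toLinearMap.comp (α.prodMap 0)
  have h1 {A : BasedModule Λ} (B : BasedModule Λ) (α : A →ₗ[Λ] SDual Λ A) :
      mk (boundary Z ε A α) = mk (boundary Z ε (A.prod B) (s B α)) := by
    rw [← mk_eq (boundary_prod A B α 0), mk_prod, mk_boundary_zero, add_zero]
  have h2 {A : BasedModule Λ} (B : BasedModule Λ) (α : A →ₗ[Λ] SDual Λ A) :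
      QEps.mk ε (s B α) = QEps.prod (QEps.mk ε α) (0 : QEps (Λ := Λ) ε B) := by
    rw [QEps.prod, map_zero, add_zero, QEps.pull_mk]
    congr 1
    refine LinearMap.ext fun p => SDual.ext fun q => ?_
    exact add_zero _
  obtain ⟨P, P', e, he, hψ⟩ := Quotient.exact h
  -- Adding zero forms is free because δ(B, 0) has class 0. After transport along e, the two
  -- sesquilinear forms live on the same module and agree only in Q_ε, which is enough by
  -- `mk_boundary_congr`.
  rw [h1 P ρ, h1 P' ρ', ← mk_eq (Iso.boundary hZ he _)]
  refine mk_boundary_congr ?_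
  rw [← QEps.pull_mk, h2, h2]
  exact hψ.symm

/-- The first coordinate of b already determines an elementary element. -/
theorem boundaryHom_injOn (hZ : ∀ z ∈ Z, RedK1.conj z ∈ Z) {x y : LMonoid Z ε}
    (hx : x ∈ elementary Z ε) (hy : y ∈ elementary Z ε)
    (h : boundaryHom hZ x = boundaryHom hZ y) : x = y := by
  obtain ⟨K, ρ, rfl⟩ := hx
  obtain ⟨K', ρ', rfl⟩ := hy
  rw [boundaryHom_mk, boundaryHom_mk, boundaryForms_boundary, boundaryForms_boundary] at h
  exact mk_boundary_eq hZ (congrArg Prod.fst h)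

theorem exists_elementary (hZ : ∀ z ∈ Z, RedK1.conj z ∈ Z) (w : ZeroStabForms Z ε) :
    ∃ x ∈ elementary Z ε, boundaryHom hZ x = (w, w) := by
  obtain ⟨⟨K, ψ⟩⟩ := w
  obtain ⟨ρ, rfl⟩ := QEps.mk_surjective ε ψ
  exact ⟨_, ⟨K, ρ, rfl⟩, boundaryForms_boundary K ρ⟩

/-- The isomorphism from the elementary submonoid to the diagonal. -/
def elementaryEquiv (hZ : ∀ z ∈ Z, RedK1.conj z ∈ Z) :
    elementary Z ε ≃+ diagonal (ZeroStabForms Z ε) :=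
  AddEquiv.ofBijective
    (((boundaryHom hZ).comp (elementary Z ε).subtype).codRestrict (diagonal (ZeroStabForms Z ε))
      (by
        rintro ⟨_, K, ρ, rfl⟩
        exact (congrArg Prod.fst (boundaryForms_boundary K ρ)).trans
          (congrArg Prod.snd (boundaryForms_boundary K ρ)).symm)) <| by
    refine ⟨fun x y h => Subtype.ext (boundaryHom_injOn hZ x.2 y.2 (congrArg Subtype.val h)), ?_⟩
    rintro ⟨⟨w, w'⟩, hw⟩
    obtain rfl : w = w' := hw
    obtain ⟨x, hx, h⟩ := exists_elementary hZ w
    exact ⟨⟨x, hx⟩, Subtype.ext h⟩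

theorem boundaryHom_preimage_zero (hZ : ∀ z ∈ Z, RedK1.conj z ∈ Z) :
    boundaryHom (ε := ε) hZ ⁻¹' {(0, 0)} = LGroup Z ε := by
  refine Set.Subset.antisymm ?_ ?_
  · rintro ⟨x⟩ h
    exact ⟨x, isFormation_of_boundaryForms_eq_zero h, rfl⟩
  · rintro _ ⟨x, hx, rfl⟩
    exact hx.boundaryForms_eq_zero

end LMonoid

end

end

end SurgeryMonoid

theorem mainTheorem6 {Λ : Type*} [Ring Λ] [StarRing Λ] [InvariantBasisNumber Λ]
    (q : ℕ) (hq : 0 < q) (Z : AddSubgroup (RedK1 Λ)) (hZ : ∀ z ∈ Z, RedK1.conj z ∈ Z) :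
    -- every `V^⊥` has a preferred based structure
    (∀ x : QuasiFormation Z ((-1) ^ q), ∃ W k, x.IsPerp W k) ∧
    -- there is a monoid map `b` with `b [M, ψ; L, V] = ([V, θ], [V^⊥, -θ^⊥])`
    ∃ b : LMonoid Z ((-1) ^ q) →+ ZeroStabForms Z ((-1) ^ q) × ZeroStabForms Z ((-1) ^ q),
      (∀ x W k, x.IsPerp W k → b (LMonoid.mk x) =
        (ZeroStabForms.mk Z x.formV, ZeroStabForms.mk Z (x.formPerp W k))) ∧
      -- the image of `b`
      Set.range b = {p | ∃ r : ℕ,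
        p.1 + ZeroStabForms.mk Z (QForm.hyp _ (BasedModule.free Λ r)) =
          p.2 + ZeroStabForms.mk Z (QForm.hyp _ (BasedModule.free Λ r))} ∧
      -- `b` restricts to an isomorphism from the elementary submonoid to the diagonal
      (∃ e : LMonoid.elementary Z ((-1) ^ q) ≃+ diagonal (ZeroStabForms Z ((-1) ^ q)),
        ∀ x, (e x : ZeroStabForms Z ((-1) ^ q) × ZeroStabForms Z ((-1) ^ q)) = b x) ∧
      -- the elementary element `e([w])` is unique
      (∀ w : ZeroStabForms Z ((-1) ^ q), ∃! x, x ∈ LMonoid.elementary Z ((-1) ^ q) ∧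
        b x = (w, w)) ∧
      -- the fibre over `(0, 0)`
      b ⁻¹' {(0, 0)} = LMonoid.LGroup Z ((-1) ^ q) := by
  refine ⟨fun x => x.exists_isPerp, LMonoid.boundaryHom hZ, fun x W k h => h.boundaryForms_eq,
    LMonoid.range_boundaryHom hZ, ⟨LMonoid.elementaryEquiv hZ, fun _ => rfl⟩, fun w => ?_,
    LMonoid.boundaryHom_preimage_zero hZ⟩
  obtain ⟨x, hx, h⟩ := LMonoid.exists_elementary hZ w
  exact ⟨x, ⟨hx, h⟩, fun y hy => LMonoid.boundaryHom_injOn hZ hy.1 hx (hy.2.trans h.symm)⟩
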